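/- **Setting.** For $Q\in\mathbb Z[X]$ let $\#Q$ be its number of nonzero coefficients and $\|Q\|$ the largest absolute value of a coefficient. Let $P\in\mathbb Z[X]$ be monic of degree $n\ge 1$, let $k=\deg(P-X^n)$ ($k=0$ if $P=X^n$), and let $\gamma=(n-k)/n$ be the gap parameter of $P$. Let $F,G,H\in\mathbb Z[X]$ have degree less than $n$, and let $0<\epsilon<1$. $P$ is given by the list of its nonzero terms; $F,G,H$ are given either all densely (the vectors of their $n$ coefficients) or all sparsely (the lists of their nonzero terms). Write $C=\max(\|P\|,\|F\|,\|G\|,\|H\|)$ and $T=\max(\#F,\#G,\#H)$. **Cost model.** Integers are in binary. Multiplying two integers of at most $m$ bits costs $\mathsf I(m)$ bit operations (up to an additive constant), where $\mathsf I$ is any function such that $\mathsf I(1)\ge 1$, $\mathsf I(m)/m$ is nondecreasing and $\mathsf I(2m)=\mathcal O(\mathsf I(m))$; additions, subtractions, comparisons, shifts, memory accesses and drawing a uniform random integer below a bound cost linearly many bit operations in the bit lengths involved. Everything else (division, modular arithmetic, primality testing, sparse vectors) is programmed from these operations. **Algorithm (ModularVerificationOverZ).** Let $\Delta_\infty=\|H\|+\min(\#F,\#G)\,\|F\|\,\|G\|\,(\#P\,\|P\|)^{\lceil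 1/\gamma\rceil}$, and let $s=\lceil 1/\epsilon\rceil$, which is the form in which $\epsilon$ is given. (1) Compute from the bit lengths of the quantities in $\Delta_\infty$ an integer $B$ with $\Delta_\infty<2^B$, and put $\lambda=\max(21,2sn,5sB)$; thus $\lambda\ge\max(21,\frac2\epsilon n,\frac{20}{3\epsilon}\ln\Delta_\infty)$. (2) Draw a random $q\in[\lambda,2\lambda]$ by RandomPrime: uniformly random candidates are subjected to rounds of the Miller–Rabin test, with a bound on the total number of rounds, so that $q$ is prime except with probability less than $\epsilon/8$. (3) Reduce $F,G,H,P$ modulo $q$. (4) In the sparse case, if the reduced $P$ is not $X^n$, return False if $\#H>\#F\,\#G\,(\#P-1)^{\lceil1/\gamma\rceil}$, these quantities being those of the reduced polynomials. Then draw $\alpha\in\mathbb Z/q$ uniformly at random, evaluate $(FG\bmod P)(\alpha)$ modulo $q$ without computing $FG\bmod P$, by means of the recurrence $F^{[i+1]}(\alpha)=\alpha F^{[i]}(\alpha)-f^{[i]}_{n-1}P(\alpha)$, where $F^{[i]}=X^iF\bmod P$ has leading coefficients $f^{[i]}_{n-1}$ (of degree $n-1$), and return True if and only if the result equals $H(\alpha)$.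 **Theorem.** The algorithm is correct for dense and for sparse inputs: if $H=FG\bmod P$ it always returns True, and if $H\ne FG\bmod P$ it returns False with probability at least $1-\epsilon$. Moreover, with $\log x$ denoting $\max(1,\log_2x)$ and with constants in $\mathcal O$ that depend only on $\mathsf I$, every run of it uses $$\mathcal O\Bigl(\log^2\bigl(\tfrac n\epsilon\log C\bigr)\,\log\log\bigl(\tfrac n\epsilon\log C\bigr)\,\log\tfrac1\epsilon\;\mathsf I\bigl(\bigl\lceil\log(\tfrac n\epsilon\log C)\bigr\rceil\bigr)\Bigr)$$ bit operations to get $q$, plus - $\mathcal O\Bigl(\bigl(\#P\,n+n\frac{\log C}{\log(\frac n\epsilon\log C)}\bigr)\,\mathsf I\bigl(\bigl\lceil\log(\tfrac n\epsilon\log C)\bigr\rceil\bigr)\Bigr)$ bit operations if $F,G,H$ are dense, or - $\mathcal O\Bigl(\bigl(T\,\#P^{\lceil\frac1\gamma-1\rceil}\log n+(T+\#P)\frac{\log C}{\log(\frac n\epsilon\log C)}\bigr)\,\mathsf I\bigl(\bigl\lceil\log(\tfrac n\epsilon\log C)\bigr\rceil\bigr)\Bigr)$ bit operations if $F,G,H$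 are sparse and $T\ge1$. -/

import Mathlib

open Polynomial

namespace ModVerif

/-! Randomized programs with a count of the bit operations. -/

/-- A randomized program: it may stop with a value, spend `c` bit operations, or draw an integer
uniformly from `{0, …, N}`. -/
inductive Prog (α : Type) : Type
  | ret (a : α) : Prog α
  | tick (c : ℕ) (k : Prog α) : Prog α
  | rand (N : ℕ) (k : Fin (N + 1) → Prog α) : Prog α

namespace Prog

/-- Sequential composition. -/
def bind {α β : Type} : Prog α → (α → Prog β) → Prog β
  | ret a, f => f a
  | tick c k, f => tick c (bind k f)
  | rand N k, f => rand N (fun i => bind (k i) f)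

instance : Monad Prog where
  pure := ret
  bind := bind

/-- The joint law of the returned value and of the number of bit operations spent. -/
noncomputable def dist {α : Type} : Prog α → PMF (α × ℕ)
  | ret a => PMF.pure (a, 0)
  | tick c k => (dist k).map (fun r => (r.1, c + r.2))
  | rand N k => (PMF.uniformOfFintype (Fin (N + 1))).bind (fun i => dist (k i))

end Prog

/-! Elementary operations. Integers are stored in binary; `Nat.size` is the bit length. All
operations cost a number of bit operations linear in the bit length of their operands and results,
except multiplication, which costs `I m` for operands of bit length at most `m`. -/

/-- An operation on two numbers at linear cost (used for `+`, `-`, comparisons, maxima, right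
shifts, splitting into blocks of bits). -/
def lin {α : Type} (f : ℕ → ℕ → α) (a b : ℕ) : Prog α :=
  .tick (a.size + b.size + 1) (.ret (f a b))

def add (a b : ℕ) : Prog ℕ := lin (· + ·) a b
/-- Subtraction; only used when `b ≤ a`. -/
def sub (a b : ℕ) : Prog ℕ := lin (· - ·) a b
def lt (a b : ℕ) : Prog Bool := lin (fun x y => decide (x < y)) a b
def le (a b : ℕ) : Prog Bool := lin (fun x y => decide (x ≤ y)) a b
def eq (a b : ℕ) : Prog Bool := lin (fun x y => decide (x = y)) a b
def maximum (a b : ℕ) : Prog ℕ := lin max a b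
def minimum (a b : ℕ) : Prog ℕ := lin min a b
/-- `⌊a / 2 ^ k⌋`. -/
def shr (a k : ℕ) : Prog ℕ := lin (fun x y => x / 2 ^ y) a k
/-- `a * 2 ^ k`. -/
def shl (a k : ℕ) : Prog ℕ := .tick (a.size + k + 1) (.ret (a * 2 ^ k))
/-- `2 * a + t` for a bit `t`. -/
def push (t : Bool) (a : ℕ) : Prog ℕ := .tick (a.size + 1) (.ret (2 * a + t.toNat))
/-- The bit length. -/
def len (a : ℕ) : Prog ℕ := .tick (a.size + 1) (.ret a.size)
/-- The binary digits, most significant first. -/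
def bits (a : ℕ) : Prog (List Bool) := .tick (a.size + 1) (.ret a.bits.reverse)
/-- The `d` lowest binary digits, most significant first. -/
def keyBits (d a : ℕ) : Prog (List Bool) :=
  .tick (a.size + d + 1) (.ret ((List.range d).reverse.map a.testBit))
/-- The digits in base `2 ^ w`, most significant first. -/
def blocks (w a : ℕ) : Prog (List ℕ) := lin (fun x y => (Nat.digits (2 ^ x) y).reverse) w a
/-- Multiplication. -/
def mul (I : ℕ → ℕ) (a b : ℕ) : Prog ℕ := .tick (I (max a.size b.size) + 1) (.ret (a * b))
/-- A uniformly random element of `{0, …, N}`. -/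
def uniform (N : ℕ) : Prog ℕ := .tick (N.size + 1) (.rand N (fun i => .ret i.val))

/-- Memory cells, each holding a natural number. -/
abbrev Mem : Type := ℕ → ℕ
def load (V : Mem) (i : ℕ) : Prog ℕ := .tick (i.size + (V i).size + 1) (.ret (V i))
def store (V : Mem) (i v : ℕ) : Prog Mem :=
  .tick (i.size + v.size + 1) (.ret (Function.update V i v))

/-- What is required of a cost function `I` of integer multiplication: `I m / m` is nondecreasing,
`I (2 m) = O(I m)`, and at least one operation is needed to multiply two bits. -/
structure IsMulCost (I : ℕ → ℕ) : Prop where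
  one_le : 1 ≤ I 1
  superlinear : ∀ m n : ℕ, 1 ≤ m → m ≤ n → I m * n ≤ I n * m
  doubling : ∃ K : ℕ, ∀ m : ℕ, 1 ≤ m → I (2 * m) ≤ K * I m

/-! Integer division and arithmetic modulo `q`. -/

/-- Schoolbook division by `b` of the number with binary digits `ts` (most significant first);
`Q` and `r` are the current quotient and remainder. -/
def divLoop (b : ℕ) : List Bool → ℕ → ℕ → Prog (ℕ × ℕ)
  | [], Q, r => .ret (Q, r)
  | t :: ts, Q, r => do
    let r ← push t r
    if ← le b r then
      let r ← sub r b
      let Q ← push true Q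
      divLoop b ts Q r
    else
      let Q ← push false Q
      divLoop b ts Q r

/-- Quotient and remainder of `a` by `b`. -/
def divMod (a b : ℕ) : Prog (ℕ × ℕ) := do
  divLoop b (← bits a) 0 0

/-- A modulus `q` with the data for fast reduction: its bit length `ℓ`, the number `2 ℓ`, and
`⌊4 ^ ℓ / q⌋`. -/
structure Modulus where
  q : ℕ
  len : ℕ
  len2 : ℕ
  recip : ℕ

def mkModulus (q : ℕ) : Prog Modulus := do
  let l ← len q
  let l2 ← add l l
  let a ← shl 1 l2
  let d ← divMod a q
  return ⟨q, l, l2, d.1⟩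

/-- Barrett reduction: `x mod q` for `0 ≤ x < 4 ^ ℓ`. -/
def reduce (I : ℕ → ℕ) (M : Modulus) (x : ℕ) : Prog ℕ := do
  let y ← mul I x M.recip
  let t ← shr y M.len2
  let z ← mul I t M.q
  let r ← sub x z
  if ← le M.q r then sub r M.q else return r

def addMod (M : Modulus) (x y : ℕ) : Prog ℕ := do
  let s ← add x y
  if ← le M.q s then sub s M.q else return s

def subMod (M : Modulus) (x y : ℕ) : Prog ℕ := do
  let s ← add x M.q
  let s ← sub s y
  if ← le M.q s then sub s M.q else return s

def mulMod (I : ℕ → ℕ) (M : Modulus) (x y : ℕ) : Prog ℕ := do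
  reduce I M (← mul I x y)

def powLoop (I : ℕ → ℕ) (M : Modulus) (a : ℕ) : List Bool → ℕ → Prog ℕ
  | [], r => return r
  | t :: ts, r => do
    let r ← mulMod I M r r
    if t then
      let r ← mulMod I M r a
      powLoop I M a ts r
    else
      powLoop I M a ts r

/-- `a ^ e mod q` by binary powering. -/
def powMod (I : ℕ → ℕ) (M : Modulus) (a e : ℕ) : Prog ℕ := do
  powLoop I M a (← bits e) 1

def blockLoop (I : ℕ → ℕ) (M : Modulus) : List ℕ → ℕ → Prog ℕ
  | [], r => return r
  | d :: ds, r => do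
    let r ← shl r M.len
    let r ← add r d
    let r ← reduce I M r
    blockLoop I M ds r

/-- `c mod q` for an integer `c` of any size, which is cut into blocks of the bit length of `q`. -/
def reduceInt (I : ℕ → ℕ) (M : Modulus) (c : ℤ) : Prog ℕ := do
  let ds ← blocks M.len c.natAbs
  let r ← blockLoop I M ds 0
  if c < 0 then subMod M 0 r else return r

/-! Random primes, by the Miller-Rabin test. -/

/-- Writes `m * 2 ^ h` as `m' * 2 ^ h'` with `m'` odd (at most `fuel` halvings). -/
def oddPart : (fuel : ℕ) → (m h : ℕ) → Prog (ℕ × ℕ)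
  | 0, m, h => return (m, h)
  | fuel + 1, m, h => do
    let m' ← shr m 1
    let d ← push false m'
    if ← eq d m then
      let h ← add h 1
      oddPart fuel m' h
    else return (m, h)

/-- Is `-1` among `y, y ^ 2, y ^ 4, …` (`h` terms) modulo `q`? -/
def hitsMinusOne (I : ℕ → ℕ) (M : Modulus) (q1 : ℕ) : (h : ℕ) → (y : ℕ) → Prog Bool
  | 0, _ => return false
  | h + 1, y => do
    if ← eq y q1 then return true
    else
      let y ← mulMod I M y y
      hitsMinusOne I M q1 h y

/-- One round of the Miller-Rabin test: `true` if `q` may be prime. -/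
def millerRabin (I : ℕ → ℕ) (M : Modulus) : Prog Bool := do
  let q1 ← sub M.q 1
  let q2 ← sub q1 1
  let a ← uniform q2
  let a ← add a 1
  let mh ← oddPart M.len q1 0
  let y ← powMod I M a mh.1
  if ← eq y 1 then return true
  else hitsMinusOne I M q1 mh.2 y

/-- A uniformly random integer of `[lam, 2 lam]`. -/
def candidate (lam : ℕ) : Prog Modulus := do
  let x ← uniform lam
  let q ← add lam x
  mkModulus q

/-- At most `fuel` rounds of the test in all; a candidate that fails a round is replaced by a new
one, and a candidate that has passed `t` rounds is returned. -/
def primeLoop (I : ℕ → ℕ) (lam t : ℕ) : (fuel : ℕ) → Modulus → (passed : ℕ) → Prog Modulus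
  | 0, M, _ => return M
  | fuel + 1, M, passed => do
    let _ ← sub (fuel + 1) 1
    if ← le t passed then return M
    else
      if ← millerRabin I M then
        let passed ← add passed 1
        primeLoop I lam t fuel M passed
      else
        let M ← candidate lam
        primeLoop I lam t fuel M 0

/-- A random element of `[lam, 2 lam]`, prime with probability at least `1 - 2 ^ (-w)`, with the
data for reductions modulo it. -/
def randomPrime (I : ℕ → ℕ) (lam w : ℕ) : Prog Modulus := do
  let b ← len lam
  let R ← mul I b w
  let R ← mul I 16 R
  let r ← len R
  let t ← add r w
  let t ← add t 1
  let M ← candidate lam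
  primeLoop I lam t R M 0

/-! Input statistics and the choice of the range of the prime. A sparse polynomial is the list of
its nonzero terms (exponent, coefficient); the modulus is listed by decreasing exponents. -/

def supNorm : List ℤ → ℕ → Prog ℕ
  | [], m => return m
  | c :: cs, m => do
    let m ← maximum c.natAbs m
    supNorm cs m

def countNonzero : List ℤ → ℕ → Prog ℕ
  | [], m => return m
  | c :: cs, m => do
    if c = 0 then .tick 1 (countNonzero cs m)
    else
      let m ← add m 1
      countNonzero cs m

def countTerms : List (ℕ × ℕ) → ℕ → Prog ℕ
  | [], m => return m
  | _ :: ts, m => do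
    let m ← add m 1
    countTerms ts m

def leadExp {α : Type} : List (ℕ × α) → ℕ
  | [] => 0
  | t :: _ => t.1

/-- `⌈1 / γ⌉ = ⌈n / (n - k)⌉` for a modulus of degree `n` and second degree `k`. -/
def ceilInvGap (n k : ℕ) : Prog ℕ := do
  let d ← sub n k
  let x ← add n d
  let x ← sub x 1
  let r ← divMod x d
  return r.1

/-- The lower end `lam` of the range of the prime: with `s = ⌈1 / ε⌉`, the maximum of `21`,
`2 s n` and `5 s B`, where `2 ^ B` exceeds
`Δ∞ = ‖H‖ + min (#F) (#G) ‖F‖ ‖G‖ (#P ‖P‖) ^ ⌈1 / γ⌉`; so it is at least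
`max 21 (2 n / ε) (20 / (3 ε) * log Δ∞)` (natural logarithm). -/
def chooseLambda (I : ℕ → ℕ) (s : ℕ) (P : List (ℕ × ℤ)) (Fc Gc Hc : List ℤ) : Prog ℕ := do
  let n := leadExp P
  let Pc := P.map Prod.snd
  let e ← ceilInvGap n (leadExp P.tail)
  let lF ← len (← supNorm Fc 0)
  let lG ← len (← supNorm Gc 0)
  let lH ← len (← supNorm Hc 0)
  let lP ← len (← supNorm Pc 0)
  let cF ← countNonzero Fc 0
  let cG ← countNonzero Gc 0
  let cP ← len (← countNonzero Pc 0)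
  let m ← len (← minimum cF cG)
  let x ← add cP lP
  let x ← mul I e x
  let x ← add x m
  let x ← add x lF
  let x ← add x lG
  let B ← maximum lH x
  let B ← add B 1
  let u ← mul I s n
  let u ← mul I 2 u
  let v ← mul I s B
  let v ← mul I 5 v
  maximum 21 (← maximum u v)

/-! Reduction of the inputs modulo `q`. -/

def reduceDense (I : ℕ → ℕ) (M : Modulus) : List ℤ → Prog (List ℕ)
  | [] => return []
  | c :: cs => do
    let r ← reduceInt I M c
    let rs ← reduceDense I M cs
    return r :: rs

/-- The terms whose coefficient vanishes modulo `q` are dropped. -/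
def reduceSparse (I : ℕ → ℕ) (M : Modulus) : List (ℕ × ℤ) → Prog (List (ℕ × ℕ))
  | [] => return []
  | (e, c) :: ts => do
    let r ← reduceInt I M c
    let rs ← reduceSparse I M ts
    if ← eq r 0 then return rs
    else .tick (e.size + 1) (.ret ((e, r) :: rs))

/-! Evaluation of `(F G mod P)(α)` for dense `F` and `G`. In the following, `n` is the degree of
`P`, and `Pt` lists the terms of `P` other than `X ^ n` by decreasing exponents. -/

/-- Horner evaluation of a polynomial, given by its coefficients from the constant one upwards. -/
def evalDense (I : ℕ → ℕ) (M : Modulus) (x : ℕ) : List ℕ → Prog ℕ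
  | [] => return 0
  | c :: cs => do
    let r ← evalDense I M x cs
    let r ← mulMod I M x r
    addMod M r c

/-- The sum of `c * x ^ e` over the terms `(e, c)` of the list. -/
def evalSparse (I : ℕ → ℕ) (M : Modulus) (x : ℕ) : List (ℕ × ℕ) → Prog ℕ
  | [] => return 0
  | (e, c) :: ts => do
    let r ← evalSparse I M x ts
    let y ← powMod I M x e
    let y ← mulMod I M c y
    addMod M r y

/-- Writes the list into the cells `i, i - 1, …`. -/
def storeDown : List ℕ → (i : ℕ) → Mem → Prog Mem
  | [], _, V => return V
  | c :: cs, i, V => do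
    let V ← store V i c
    let j ← sub i 1
    storeDown cs j V

/-- `V[i + n - k] ← V[i + n - k] - p * v` for the terms `(k, p)` of `P` with `i < k < n`. -/
def updateDense (I : ℕ → ℕ) (M : Modulus) (n i v : ℕ) : List (ℕ × ℕ) → Mem → Prog Mem
  | [], V => return V
  | (k, p) :: ts, V => do
    if ← lt i k then
      let j ← sub (← add i n) k
      let x ← mulMod I M p v
      let y ← load V j
      let y ← subMod M y x
      let V ← store V j y
      updateDense I M n i v ts V
    else return V

/-- `m` rounds of the main loop of `leadingCoefficients`, starting with round `i`. -/
def leadingLoop (I : ℕ → ℕ) (M : Modulus) (n : ℕ) (Pt : List (ℕ × ℕ)) :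
    (m : ℕ) → (i : ℕ) → Mem → Prog Mem
  | 0, _, V => return V
  | m + 1, i, V => do
    let v ← load V i
    let V ← updateDense I M n i v Pt V
    let i ← add i 1
    leadingLoop I M n Pt m i V

/-- The coefficients of degree `n - 1` of `(X ^ i F) mod P`, for `i ≤ n - 2`. -/
def leadingCoefficients (I : ℕ → ℕ) (M : Modulus) (n : ℕ) (Pt : List (ℕ × ℕ)) (F : List ℕ) :
    Prog Mem := do
  let m ← sub n 1
  let V ← storeDown F m (fun _ => 0)
  leadingLoop I M n Pt m 0 V

/-- The loop over the coefficients `g_(i + 1), g_(i + 2), …` of `G`; `Fx` is the value at `x` of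
`(X ^ i F) mod P`. -/
def modularEvalLoop (I : ℕ → ℕ) (M : Modulus) (x Px : ℕ) (V : Mem) :
    List ℕ → (i Fx res : ℕ) → Prog ℕ
  | [], _, _, res => return res
  | g :: gs, i, Fx, res => do
    let v ← load V i
    let y ← mulMod I M x Fx
    let z ← mulMod I M v Px
    let Fx ← subMod M y z
    let w ← mulMod I M Fx g
    let res ← addMod M res w
    let i ← add i 1
    modularEvalLoop I M x Px V gs i Fx res

/-- `(F G mod P)(x)`. -/
def modularEval (I : ℕ → ℕ) (M : Modulus) (P : List (ℕ × ℕ)) (F G : List ℕ) (x : ℕ) :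
    Prog ℕ := do
  let V ← leadingCoefficients I M (leadExp P) P.tail F
  let Px ← evalSparse I M x P
  let Fx ← evalDense I M x F
  match G with
  | [] => return 0
  | g :: gs => do
    let res ← mulMod I M Fx g
    modularEvalLoop I M x Px V gs 0 Fx res

/-! Evaluation of `(F G mod P)(α)` for sparse `F` and `G`. -/

/-- A sparse vector, as a binary tree whose leaf for index `i` is found by following the binary
digits of `i`. -/
inductive Trie : Type
  | nil : Trie
  | leaf (v : ℕ) : Trie
  | node (l r : Trie) : Trie

namespace Trie

def left : Trie → Trie
  | node l _ => l
  | _ => nil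

def right : Trie → Trie
  | node _ r => r
  | _ => nil

/-- A node, or the empty tree if both children are empty. -/
def join : Trie → Trie → Trie
  | nil, nil => nil
  | l, r => node l r

/-- Adds `v` modulo `q` to the entry with the given index. -/
def addAt (M : Modulus) (v : ℕ) : (index : List Bool) → Trie → Prog Trie
  | [], leaf u => do
    let w ← addMod M u v
    return leaf w
  | [], _ => .tick (v.size + 1) (.ret (leaf v))
  | true :: bs, t => .tick 1 (do
    let r ← addAt M v bs t.right
    return node t.left r)
  | false :: bs, t => .tick 1 (do
    let l ← addAt M v bs t.left
    return node l t.right)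

/-- Extracts the entry of minimal index: the index, the value and the other entries. The number
`i` is formed by the binary digits read so far. -/
def popMin : Trie → (i : ℕ) → Prog (Option (ℕ × ℕ × Trie))
  | nil, _ => .tick 1 (.ret none)
  | leaf v, i => .tick (v.size + 1) (.ret (some (i, v, nil)))
  | node l r, i => do
    let j ← push false i
    match ← popMin l j with
    | some (j, v, l) => return some (j, v, join l r)
    | none => do
      let j ← push true i
      match ← popMin r j with
      | some (j, v, r) => return some (j, v, join nil r)
      | none => return none

end Trie

/-- Enters the coefficient `c` of `X ^ e` with index `n - 1 - e`; `d` is the bit length of `n`. -/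
def sparseInit (M : Modulus) (n d : ℕ) : List (ℕ × ℕ) → Trie → Prog Trie
  | [], V => return V
  | (e, c) :: ts, V => do
    let j ← sub (← sub n 1) e
    let V ← Trie.addAt M c (← keyBits d j) V
    sparseInit M n d ts V

/-- `V[i + n - k] ← V[i + n - k] - p * v` for the terms `(k, p)` of `P` with `i < k < n`. -/
def updateSparse (I : ℕ → ℕ) (M : Modulus) (n d i v : ℕ) : List (ℕ × ℕ) → Trie → Prog Trie
  | [], V => return V
  | (k, p) :: ts, V => do
    if ← lt i k then
      let j ← sub (← add i n) k
      let x ← mulMod I M p v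
      let y ← subMod M 0 x
      let V ← Trie.addAt M y (← keyBits d j) V
      updateSparse I M n d i v ts V
    else return V

/-- While `V` is not empty, its entry of minimal index is extracted and, if it is not zero, listed
and used for updates. The extracted indices increase and are less than `n`, so `n` rounds
suffice. -/
def sparseLeadingLoop (I : ℕ → ℕ) (M : Modulus) (n d : ℕ) (Pt : List (ℕ × ℕ)) :
    (rounds : ℕ) → Trie → Prog (List (ℕ × ℕ))
  | 0, _ => return []
  | m + 1, V => do
    match ← Trie.popMin V 0 with
    | none => return []
    | some (i, v, V) => do
      if ← eq v 0 then sparseLeadingLoop I M n d Pt m V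
      else
        let V ← updateSparse I M n d i v Pt V
        let L ← sparseLeadingLoop I M n d Pt m V
        return (i, v) :: L

/-- The pairs `(i, v)`, by increasing `i`, with `v ≠ 0` the coefficient of degree `n - 1` of
`(X ^ i F) mod P`. -/
def sparseLeadingCoefficients (I : ℕ → ℕ) (M : Modulus) (n : ℕ) (Pt F : List (ℕ × ℕ)) :
    Prog (List (ℕ × ℕ)) := do
  let d ← len n
  let V ← sparseInit M n d F .nil
  sparseLeadingLoop I M n d Pt n V

/-- Merges two lists sorted by increasing index into one list of triples `(j, v_j, g_j)`, with `0`
for a missing entry. -/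
def mergeTerms : List (ℕ × ℕ) → List (ℕ × ℕ) → Prog (List (ℕ × ℕ × ℕ))
  | [], [] => return []
  | (i, v) :: L, [] => do
    let R ← mergeTerms L []
    .tick 1 (.ret ((i, v, 0) :: R))
  | [], (j, g) :: G => do
    let R ← mergeTerms [] G
    .tick 1 (.ret ((j, 0, g) :: R))
  | (i, v) :: L, (j, g) :: G => do
    if ← lt i j then
      let R ← mergeTerms L ((j, g) :: G)
      return (i, v, 0) :: R
    else if ← lt j i then
      let R ← mergeTerms ((i, v) :: L) G
      return (j, 0, g) :: R
    else
      let R ← mergeTerms L G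
      return (j, v, g) :: R
  termination_by L G => L.length + G.length

/-- The loop over the triples `(j, v_j, g_j)`: `i` is the previous index, `v = v_i`, and `Fx` is the
value at `x` of `(X ^ i F) mod P`; the value for `j > i` is
`x ^ (j - i - 1) * (x * Fx - v * P(x))`. -/
def sparseEvalLoop (I : ℕ → ℕ) (M : Modulus) (x Px : ℕ) :
    List (ℕ × ℕ × ℕ) → (i v Fx res : ℕ) → Prog ℕ
  | [], _, _, _, res => return res
  | (j, vj, g) :: ts, i, v, Fx, res => do
    if ← eq i j then
      let w ← mulMod I M Fx g
      let res ← addMod M res w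
      sparseEvalLoop I M x Px ts j vj Fx res
    else
      let e ← sub (← sub j i) 1
      let y ← mulMod I M x Fx
      let z ← mulMod I M v Px
      let y ← subMod M y z
      let u ← powMod I M x e
      let Fx ← mulMod I M u y
      let w ← mulMod I M Fx g
      let res ← addMod M res w
      sparseEvalLoop I M x Px ts j vj Fx res

/-- `(F G mod P)(x)`. -/
def sparseModularEval (I : ℕ → ℕ) (M : Modulus) (P F G : List (ℕ × ℕ)) (x : ℕ) : Prog ℕ := do
  let V ← sparseLeadingCoefficients I M (leadExp P) P.tail F
  let Px ← evalSparse I M x P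
  let Fx ← evalSparse I M x F
  let ts ← mergeTerms V G
  sparseEvalLoop I M x Px ts 0 0 Fx 0

/-! Verification of `H = F G mod P` modulo `q`, at a random point. -/

def verifyDense (I : ℕ → ℕ) (M : Modulus) (P : List (ℕ × ℕ)) (F G H : List ℕ) : Prog Bool := do
  let x ← uniform (← sub M.q 1)
  let y ← modularEval I M P F G x
  let z ← evalDense I M x H
  eq y z

/-- Is `h ≤ a * r ^ e`, for `r ≥ 1`? Stops as soon as the answer is known. -/
def atMostPow (I : ℕ → ℕ) (h r : ℕ) : (e : ℕ) → (a : ℕ) → Prog Bool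
  | 0, a => le h a
  | e + 1, a => do
    let _ ← sub (e + 1) 1
    if ← le h a then return true
    else
      let a ← mul I a r
      atMostPow I h r e a

/-- The test `#H ≤ #F #G (#P - 1) ^ ⌈1 / γ⌉`, which is passed by `H = F G mod P` if `#P ≥ 2`; it is
skipped if `P = X ^ n`. -/
def sparsityTest (I : ℕ → ℕ) (P F G H : List (ℕ × ℕ)) : Prog Bool := do
  let cP ← countTerms P 0
  if ← le cP 1 then return true
  else
    let cF ← countTerms F 0
    let cG ← countTerms G 0
    let cH ← countTerms H 0
    let e ← ceilInvGap (leadExp P) (leadExp P.tail)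
    let r ← sub cP 1
    let a ← mul I cF cG
    atMostPow I cH r e a

def verifySparse (I : ℕ → ℕ) (M : Modulus) (P F G H : List (ℕ × ℕ)) : Prog Bool := do
  if ← sparsityTest I P F G H then
    let x ← uniform (← sub M.q 1)
    let y ← sparseModularEval I M P F G x
    let z ← evalSparse I M x H
    eq y z
  else return false

/-! The algorithm over `ℤ`. -/

/-- The outcome of a run: the answer, the number of bit operations spent on the generation of the
prime, and the number of all other bit operations. -/
structure Run where
  answer : Bool
  primeOps : ℕ
  otherOps : ℕ

/-- `H = F G mod P` is tested modulo a random prime; `s = ⌈1 / ε⌉`. The inputs `F`, `G`, `H` are the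
lists of their `n` coefficients, constant coefficient first. -/
noncomputable def verifyOverZDense (I : ℕ → ℕ) (s : ℕ) (P : List (ℕ × ℤ)) (F G H : List ℤ) :
    PMF Run :=
  (chooseLambda I s P F G H).dist.bind fun l =>
  (do randomPrime I l.1 (← add (← len s) 3) : Prog Modulus).dist.bind fun M =>
  (do
    let Fq ← reduceDense I M.1 F
    let Gq ← reduceDense I M.1 G
    let Hq ← reduceDense I M.1 H
    let Pq ← reduceSparse I M.1 P
    verifyDense I M.1 Pq Fq Gq Hq : Prog Bool).dist.bind fun b =>
  PMF.pure ⟨b.1, M.2, l.2 + b.2⟩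

/-- The same for sparse `F`, `G`, `H`, listed by increasing exponents. -/
noncomputable def verifyOverZSparse (I : ℕ → ℕ) (s : ℕ) (P F G H : List (ℕ × ℤ)) : PMF Run :=
  (chooseLambda I s P (F.map Prod.snd) (G.map Prod.snd) (H.map Prod.snd)).dist.bind fun l =>
  (do randomPrime I l.1 (← add (← len s) 3) : Prog Modulus).dist.bind fun M =>
  (do
    let Fq ← reduceSparse I M.1 F
    let Gq ← reduceSparse I M.1 G
    let Hq ← reduceSparse I M.1 H
    let Pq ← reduceSparse I M.1 P
    verifySparse I M.1 Pq Fq Gq Hq : Prog Bool).dist.bind fun b =>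
  PMF.pure ⟨b.1, M.2, l.2 + b.2⟩

/-! Representations and parameters of polynomials. -/

/-- The vector of the coefficients of degree less than `n`. -/
noncomputable def denseRep (n : ℕ) (F : ℤ[X]) : List ℤ := (List.range n).map F.coeff

/-- The list of the nonzero terms by increasing exponents. -/
noncomputable def sparseRep (F : ℤ[X]) : List (ℕ × ℤ) :=
  (F.support.sort (· ≤ ·)).map (fun i => (i, F.coeff i))

/-- The algorithm on dense `F`, `G`, `H`, with error bound `ε`. -/
noncomputable def runDense (I : ℕ → ℕ) (ε : ℝ) (P F G H : ℤ[X]) : PMF Run :=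
  verifyOverZDense I ⌈1 / ε⌉₊ (sparseRep P).reverse (denseRep P.natDegree F)
    (denseRep P.natDegree G) (denseRep P.natDegree H)

/-- The algorithm on sparse `F`, `G`, `H`, with error bound `ε`. -/
noncomputable def runSparse (I : ℕ → ℕ) (ε : ℝ) (P F G H : ℤ[X]) : PMF Run :=
  verifyOverZSparse I ⌈1 / ε⌉₊ (sparseRep P).reverse (sparseRep F) (sparseRep G) (sparseRep H)

/-- The sparsity `#F`: the number of nonzero coefficients. -/
def sparsity (F : ℤ[X]) : ℕ := F.support.card

/-- The norm: the largest absolute value of a coefficient. -/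
def norm (F : ℤ[X]) : ℕ := F.support.sup (fun i => (F.coeff i).natAbs)

/-- The gap parameter `(n - k) / n` of a monic polynomial `P` of degree `n`, where `k` is the degree
of `P - X ^ n` (and `k = 0` if `P = X ^ n`). -/
noncomputable def gap (P : ℤ[X]) : ℝ :=
  ((P.natDegree : ℝ) - ((P - X ^ P.natDegree).natDegree : ℝ)) / (P.natDegree : ℝ)

/-- The admissible inputs: `P` is monic of positive degree `n`, and `F`, `G`, `H` have degree less
than `n`. -/
def Admissible (P F G H : ℤ[X]) : Prop :=
  P.Monic ∧ 0 < P.natDegree ∧ F.degree < P.natDegree ∧ G.degree < P.natDegree ∧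
    H.degree < P.natDegree

/-- A randomized verification of `H = F G mod P` is correct with error at most `ε`: the answer is
always `true` if the identity holds, and `false` with probability at least `1 - ε` otherwise. -/
def Correct (ε : ℝ) (P F G H : ℤ[X]) (run : PMF Run) : Prop :=
  (H = (F * G) %ₘ P → ∀ r ∈ run.support, r.answer = true) ∧
  (H ≠ (F * G) %ₘ P → ENNReal.ofReal (1 - ε) ≤ run.toOuterMeasure {r | r.answer = false})

/-- `C = max (‖P‖, ‖F‖, ‖G‖, ‖H‖)`. -/
def maxNorm (P F G H : ℤ[X]) : ℕ := max (max (norm P) (norm F)) (max (norm G) (norm H))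

/-- `T = max (#F, #G, #H)`. -/
def maxSparsity (F G H : ℤ[X]) : ℕ := max (max (sparsity F) (sparsity G)) (sparsity H)

/-- The base-2 logarithm, replaced by `1` where it is less than `1`. -/
noncomputable def lg (x : ℝ) : ℝ := max 1 (Real.logb 2 x)

/-- `log ((n / ε) log C)`. -/
noncomputable def logSize (ε : ℝ) (P F G H : ℤ[X]) : ℝ :=
  lg ((P.natDegree : ℝ) / ε * lg (maxNorm P F G H))

/-- `log² L * log L * log (1 / ε) * I(log L)` with `L = (n / ε) log C`, the second factor being
an iterated logarithm. -/
noncomputable def primeBound (I : ℕ → ℕ) (ε : ℝ) (P F G H : ℤ[X]) : ℝ :=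
  logSize ε P F G H ^ 2 * lg (logSize ε P F G H) * lg (1 / ε) * I ⌈logSize ε P F G H⌉₊

/-- `(#P n + n log C / log ((n / ε) log C)) I(log ((n / ε) log C))`. -/
noncomputable def denseBound (I : ℕ → ℕ) (ε : ℝ) (P F G H : ℤ[X]) : ℝ :=
  ((sparsity P : ℝ) * P.natDegree
      + P.natDegree * (lg (maxNorm P F G H) / logSize ε P F G H))
    * I ⌈logSize ε P F G H⌉₊

/-- `(T #P ^ ⌈1/γ - 1⌉ log n + (T + #P) log C / log ((n / ε) log C)) I(log ((n / ε) log C))`. -/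
noncomputable def sparseBound (I : ℕ → ℕ) (ε : ℝ) (P F G H : ℤ[X]) : ℝ :=
  ((maxSparsity F G H : ℝ) * (sparsity P : ℝ) ^ ⌈1 / gap P - 1⌉₊ * lg P.natDegree
      + ((maxSparsity F G H : ℝ) + sparsity P)
        * (lg (maxNorm P F G H) / logSize ε P F G H))
    * I ⌈logSize ε P F G H⌉₊

end ModVerif

/-!
Verification of `H = F G mod P` over `ℤ` by evaluation at a random point modulo a random prime.

**Correctness.** A true identity remains true modulo every `q ≥ 2`, so that the values at all points
agree, and the sparsity test is passed because reducing `F G` modulo `P` takes `⌈1 / γ⌉` steps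
`X ^ n ↦ X ^ n - P` at most, each of which multiplies the number of terms by `#P - 1` at most
(`card_support_mul_modByMonic_le`); here it does not matter whether `q` is prime. The same steps
multiply the norm by `#P ‖P‖` at most, so the coefficients of `H - F G mod P` are less than `2 ^ B`
(`norm_mul_modByMonic_le`, `IsRange.natAbs_lt`).

If the identity is false, then a nonzero coefficient `a` of the difference is fixed, and a wrong answer
has three possible reasons (`run_soundness`).
* The number `q` is composite. A composite number passes a round of the Miller-Rabin test with
  probability at most `1 / 2`, since the passing bases are contained in a proper subgroup of the units
  (`two_mul_card_liars_le`). A candidate is prime with a probability of the order of `1 / log λ`, by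
  a bound of Chebyshev's type, which is derived from the central binomial coefficient for large `λ` and
  from a count of primes for small `λ` (`le_card_primesIn_mul_log`). An induction on the number of
  rounds gives the error `1 / (8 s)` (`mean_randomPrime_composite_le`).
* The number `q` is a prime that divides `a`. All primes of `[λ, 2 λ]` are drawn with the same
  probability (`mean_primeLoop_mem_le`), and at most `B / log₂ λ` of them divide `a`, which gives the
  error `3 / (8 s)` (`card_primesIn_dvd_le`).
* The prime `q` does not divide `a`, but the drawn point is a root of the difference modulo `q`, which
  has probability at most `n / q ≤ 1 / (2 s)` (`mean_randomPoint_le`).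

**Evaluation.** `F G mod P` is the combination of the residues `X ^ i F mod P` with the coefficients of
`G`, and the value of the next residue follows from the last one and its coefficient of degree `n - 1`
(`eval_mul_modByMonic`, `eval_shiftMod_succ`). These leading coefficients satisfy a linear recursion
with the terms of `P`: the one with index `i` contributes to those with indices `i + n - k` for the
terms `X ^ k` of `P` (`partialLead_succ`). So each nonzero one changes at most `#P - 1` later ones, with
indices that are larger by at least the gap `g` between the two highest exponents of `P`. For sparse
inputs a weight of the order of `#P ^ ((n - 1 - i) / g)` is given to the index `i`; the weight of an
entry pays for its own treatment and for the entries created by it (`growth_step`,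
`sat_sparseLeadingLoop`), which bounds the work by `T #P ^ ⌈1 / γ - 1⌉` updates.

**Costs.** `Sat p Q c` says that every outcome of `p` has a value in `Q` and a cost of at most `c`; it
is proved along the programs by `Sat.bind`. All the numbers that occur, apart from the coefficients of
the input, have `O(l)` bits, where `l = ⌈log ((n / ε) log C)⌉` (`word_bounds`), so that every operation
on them costs `O(I l)` (`exists_opCost_le`). As `q` has at least `l / 4` bits
(`logSize_le_two_mul_size`), a coefficient of the input is reduced modulo `q` in
`O(log C / log ((n / ε) log C) + 1)` operations.
-/

namespace ModVerif

/-! ### Outcomes, costs and expectations of randomized programs -/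

namespace Prog

/-- Every outcome of the program has a value in `Q` and costs at most `c` bit operations. -/
def Sat {α : Type} : Prog α → (α → Prop) → ℕ → Prop
  | ret a, Q, _ => Q a
  | tick d k, Q, c => d ≤ c ∧ Sat k Q (c - d)
  | rand _ k, Q, c => ∀ i, Sat (k i) Q c

/-- The expectation of `f` at the value returned by the program. -/
noncomputable def mean {α : Type} : Prog α → (α → ℝ) → ℝ
  | ret a, f => f a
  | tick _ k, f => mean k f
  | rand N k, f => (∑ i, mean (k i) f) / (N + 1)

variable {α β : Type}

theorem pure_eq (a : α) : (pure a : Prog α) = ret a := rfl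

@[simp] theorem sat_pure {a : α} {Q : α → Prop} {c : ℕ} : Sat (pure a) Q c ↔ Q a := Iff.rfl

theorem Sat.mono {p : Prog α} {Q Q' : α → Prop} {c c' : ℕ} (h : Sat p Q c) (hc : c ≤ c')
    (hQ : ∀ a, Q a → Q' a) : Sat p Q' c' := by
  induction p generalizing c c' with
  | ret a => exact hQ a h
  | tick d k ih => exact ⟨h.1.trans hc, ih h.2 (by omega)⟩
  | rand N k ih => exact fun i => ih i (h i) hc

theorem Sat.mono_cost {p : Prog α} {Q : α → Prop} {c c' : ℕ} (h : Sat p Q c) (hc : c ≤ c') :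
    Sat p Q c' := h.mono hc fun _ => id

theorem Sat.bind_add {p : Prog α} {f : α → Prog β} {Q : α → Prop} {R : β → Prop} {c c' : ℕ}
    (hp : Sat p Q c) (hf : ∀ a, Q a → Sat (f a) R c') : Sat (p >>= f) R (c + c') := by
  induction p generalizing c with
  | ret a => exact (hf a hp).mono_cost (by omega)
  | tick d k ih => exact ⟨by have := hp.1; omega, (ih hp.2).mono_cost (by have := hp.1; omega)⟩
  | rand N k ih => exact fun i => ih i (hp i)

/-- The rule of composition in the form in which programs are analyzed: a total budget `c'` is fixed,
and each step takes its share `c` from what is left of it. -/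
theorem Sat.bind {p : Prog α} {f : α → Prog β} {Q : α → Prop} {R : β → Prop} {c c' : ℕ}
    (hp : Sat p Q c) (hc : c ≤ c') (hf : ∀ a, Q a → Sat (f a) R (c' - c)) :
    Sat (p >>= f) R c' :=
  (hp.bind_add hf).mono_cost (by omega)

/-- The predicate `Sat` controls the joint law of value and cost. -/
theorem Sat.of_mem_support {p : Prog α} {Q : α → Prop} {c : ℕ} (h : Sat p Q c) {r : α × ℕ}
    (hr : r ∈ p.dist.support) : Q r.1 ∧ r.2 ≤ c := by
  induction p generalizing c r with
  | ret a =>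
    simp only [dist, PMF.support_pure, Set.mem_singleton_iff] at hr
    subst hr
    exact ⟨h, Nat.zero_le _⟩
  | tick d k ih =>
    simp only [dist, PMF.support_map, Set.mem_image] at hr
    obtain ⟨r', hr', rfl⟩ := hr
    have := ih h.2 hr'
    exact ⟨this.1, by have := this.2; have := h.1; simp only; omega⟩
  | rand N k ih =>
    simp only [dist, PMF.mem_support_bind_iff] at hr
    obtain ⟨i, -, hi⟩ := hr
    exact ih i (h i) hi

theorem mean_ret (a : α) (f : α → ℝ) : mean (ret a) f = f a := rfl

theorem mean_bind (p : Prog α) (g : α → Prog β) (f : β → ℝ) :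
    mean (p >>= g) f = mean p (fun a => mean (g a) f) := by
  induction p with
  | ret a => rfl
  | tick d k ih => exact ih
  | rand N k ih =>
    have : (Bind.bind (rand N k) g : Prog β) = rand N (fun i => Bind.bind (k i) g) := rfl
    rw [this]
    simp only [mean, ih]

theorem mean_le {p : Prog α} {Q : α → Prop} {c : ℕ} (h : Sat p Q c) {f : α → ℝ} {b : ℝ}
    (hf : ∀ a, Q a → f a ≤ b) : mean p f ≤ b := by
  induction p generalizing c with
  | ret a => exact hf a h
  | tick d k ih => exact ih h.2
  | rand N k ih =>
    rw [mean, div_le_iff₀ (by positivity)]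
    calc ∑ i, mean (k i) f ≤ ∑ _i : Fin (N + 1), b := Finset.sum_le_sum fun i _ => ih i (h i)
      _ = b * (N + 1) := by simp; ring

theorem mean_mono (p : Prog α) {f g : α → ℝ} (h : ∀ a, f a ≤ g a) : mean p f ≤ mean p g := by
  induction p with
  | ret a => exact h a
  | tick d k ih => exact ih
  | rand N k ih =>
    simp only [mean]
    gcongr with i
    exact ih i

theorem mean_mono_of_sat {p : Prog α} {Q : α → Prop} {c : ℕ} (h : Sat p Q c) {f g : α → ℝ}
    (hf : ∀ a, Q a → f a ≤ g a) : mean p f ≤ mean p g := by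
  induction p generalizing c with
  | ret a => exact hf a h
  | tick d k ih => exact ih h.2
  | rand N k ih =>
    simp only [mean]
    gcongr with i
    exact ih i (h i)

theorem mean_add (p : Prog α) (f g : α → ℝ) :
    mean p (fun a => f a + g a) = mean p f + mean p g := by
  induction p with
  | ret a => rfl
  | tick d k ih => exact ih
  | rand N k ih => simp only [mean, ih, Finset.sum_add_distrib, add_div]

theorem mean_const (p : Prog α) (b : ℝ) : mean p (fun _ => b) = b := by
  induction p with
  | ret a => rfl
  | tick d k ih => exact ih
  | rand N k ih =>
    have : (N : ℝ) + 1 ≠ 0 := by positivity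
    simp only [mean, ih, Finset.sum_const, Finset.card_univ, Fintype.card_fin]
    field_simp
    simp

/-- If after each outcome of a program the event `s` has at least the conditional probability
`h`, then it has at least the probability that is the expectation of `h`. -/
theorem ofReal_mean_le {γ : Type*} {p : Prog α} {Q : α → Prop} {c : ℕ} (hp : Sat p Q c)
    (h : α → ℝ) (g : α × ℕ → PMF γ) (s : Set γ)
    (hg : ∀ r, Q r.1 → ENNReal.ofReal (h r.1) ≤ (g r).toOuterMeasure s) :
    ENNReal.ofReal (mean p h) ≤ (p.dist.bind g).toOuterMeasure s := by
  induction p generalizing g c with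
  | ret a =>
    simp only [dist, PMF.pure_bind, mean]
    exact hg (a, 0) hp
  | tick d k ih =>
    simp only [dist, PMF.bind_map, mean]
    exact ih hp.2 _ fun r hr => hg _ hr
  | rand N k ih =>
    simp only [dist, PMF.bind_bind, mean]
    rw [PMF.toOuterMeasure_bind_apply, tsum_fintype]
    calc ENNReal.ofReal ((∑ i, mean (k i) h) / (N + 1))
        = ENNReal.ofReal (∑ i, mean (k i) h) / ((N + 1 : ℕ) : ENNReal) := by
          rw [ENNReal.ofReal_div_of_pos (by positivity), ← ENNReal.ofReal_natCast]
          push_cast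
          rfl
      _ ≤ (∑ i, ENNReal.ofReal (mean (k i) h)) / ((N + 1 : ℕ) : ENNReal) := by
          gcongr
          refine Finset.induction_on Finset.univ (by simp) fun i t hi ih' => ?_
          rw [Finset.sum_insert hi, Finset.sum_insert hi]
          exact ENNReal.ofReal_add_le.trans (by gcongr)
      _ = ∑ i, PMF.uniformOfFintype (Fin (N + 1)) i * ENNReal.ofReal (mean (k i) h) := by
          simp only [PMF.uniformOfFintype_apply, Fintype.card_fin, ← Finset.mul_sum]
          rw [div_eq_mul_inv, mul_comm]
      _ ≤ _ := by
          gcongr with i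
          exact ih i (hp i) g hg

end Prog

open Prog

/-! ### Elementary operations, division and modular arithmetic -/

/-- All elementary operations on numbers of at most `W` bits, multiplication included, cost at most
`J` bit operations. -/
structure Budget (I : ℕ → ℕ) (W J : ℕ) : Prop where
  lin : 3 * W + 3 ≤ J
  mul : ∀ m ≤ W, I m + 1 ≤ J

theorem Sat.bind_ite {β : Type} {p : Prog Bool} {φ : Prop} {X Y : Prog β} {R : β → Prop}
    {c c' : ℕ} (hp : Sat p (fun b => b = true ↔ φ) c) (hc : c ≤ c')
    (hX : φ → Sat X R (c' - c)) (hY : ¬φ → Sat Y R (c' - c)) :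
    Sat (p >>= fun b => if b = true then X else Y) R c' := by
  refine hp.bind hc fun b hb => ?_
  split_ifs with h
  · exact hX (hb.1 h)
  · exact hY fun h' => h (hb.2 h')

section Budget

variable {I : ℕ → ℕ} {W J : ℕ}

theorem sat_lin {α : Type} (hB : Budget I W J) (f : ℕ → ℕ → α) {a b : ℕ} (ha : a < 2 ^ W)
    (hb : b < 2 ^ W) : Sat (lin f a b) (· = f a b) J := by
  have := hB.lin
  have := Nat.size_le.2 ha
  have := Nat.size_le.2 hb
  exact ⟨by omega, rfl⟩

theorem sat_add (hB : Budget I W J) {a b : ℕ} (ha : a < 2 ^ W) (hb : b < 2 ^ W) :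
    Sat (add a b) (· = a + b) J := sat_lin hB _ ha hb

theorem sat_sub (hB : Budget I W J) {a b : ℕ} (ha : a < 2 ^ W) (hb : b < 2 ^ W) :
    Sat (sub a b) (· = a - b) J := sat_lin hB _ ha hb

theorem sat_lt (hB : Budget I W J) {a b : ℕ} (ha : a < 2 ^ W) (hb : b < 2 ^ W) :
    Sat (lt a b) (fun t => t = true ↔ a < b) J :=
  (sat_lin hB _ ha hb).mono le_rfl fun t ht => by rw [ht]; exact decide_eq_true_iff

theorem sat_le (hB : Budget I W J) {a b : ℕ} (ha : a < 2 ^ W) (hb : b < 2 ^ W) :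
    Sat (le a b) (fun t => t = true ↔ a ≤ b) J :=
  (sat_lin hB _ ha hb).mono le_rfl fun t ht => by rw [ht]; exact decide_eq_true_iff

theorem sat_eq (hB : Budget I W J) {a b : ℕ} (ha : a < 2 ^ W) (hb : b < 2 ^ W) :
    Sat (eq a b) (fun t => t = true ↔ a = b) J :=
  (sat_lin hB _ ha hb).mono le_rfl fun t ht => by rw [ht]; exact decide_eq_true_iff

theorem sat_maximum (hB : Budget I W J) {a b : ℕ} (ha : a < 2 ^ W) (hb : b < 2 ^ W) :
    Sat (maximum a b) (· = max a b) J := sat_lin hB _ ha hb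

theorem sat_minimum (hB : Budget I W J) {a b : ℕ} (ha : a < 2 ^ W) (hb : b < 2 ^ W) :
    Sat (minimum a b) (· = min a b) J := sat_lin hB _ ha hb

theorem sat_shr (hB : Budget I W J) {a b : ℕ} (ha : a < 2 ^ W) (hb : b < 2 ^ W) :
    Sat (shr a b) (· = a / 2 ^ b) J := sat_lin hB _ ha hb

theorem sat_shl (hB : Budget I W J) {a k : ℕ} (ha : a < 2 ^ W) (hk : k ≤ W) :
    Sat (shl a k) (· = a * 2 ^ k) J := by
  have := hB.lin
  have := Nat.size_le.2 ha
  exact ⟨by omega, rfl⟩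

theorem sat_push (hB : Budget I W J) (t : Bool) {a : ℕ} (ha : a < 2 ^ W) :
    Sat (push t a) (· = 2 * a + t.toNat) J := by
  have := hB.lin
  have := Nat.size_le.2 ha
  exact ⟨by omega, rfl⟩

theorem sat_len (hB : Budget I W J) {a : ℕ} (ha : a < 2 ^ W) : Sat (len a) (· = a.size) J := by
  have := hB.lin
  have := Nat.size_le.2 ha
  exact ⟨by omega, rfl⟩

theorem sat_bits (hB : Budget I W J) {a : ℕ} (ha : a < 2 ^ W) :
    Sat (bits a) (· = a.bits.reverse) J := by
  have := hB.lin
  have := Nat.size_le.2 ha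
  exact ⟨by omega, rfl⟩

theorem sat_keyBits (hB : Budget I W J) {d a : ℕ} (ha : a < 2 ^ W) (hd : d ≤ W) :
    Sat (keyBits d a) (· = (List.range d).reverse.map a.testBit) J := by
  have := hB.lin
  have := Nat.size_le.2 ha
  exact ⟨by omega, rfl⟩

theorem sat_mul (hB : Budget I W J) {a b : ℕ} (ha : a < 2 ^ W) (hb : b < 2 ^ W) :
    Sat (mul I a b) (· = a * b) J := by
  have := Nat.size_le.2 ha
  have := Nat.size_le.2 hb
  exact ⟨hB.mul _ (by omega), rfl⟩

theorem sat_uniform (hB : Budget I W J) {N : ℕ} (hN : N < 2 ^ W) :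
    Sat (uniform N) (· ≤ N) J := by
  have := hB.lin
  have := Nat.size_le.2 hN
  exact ⟨by omega, fun i => Nat.lt_succ_iff.1 i.2⟩

theorem mean_uniform (N : ℕ) (f : ℕ → ℝ) :
    mean (uniform N) f = (∑ i ∈ Finset.range (N + 1), f i) / (N + 1) := by
  simp only [uniform, mean, Finset.sum_range]

theorem sat_load (hB : Budget I W J) {V : Mem} {i : ℕ} (hi : i < 2 ^ W) (hV : V i < 2 ^ W) :
    Sat (load V i) (· = V i) J := by
  have := hB.lin
  have := Nat.size_le.2 hi
  have := Nat.size_le.2 hV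
  exact ⟨by omega, rfl⟩

theorem sat_store (hB : Budget I W J) (V : Mem) {i v : ℕ} (hi : i < 2 ^ W) (hv : v < 2 ^ W) :
    Sat (store V i v) (· = Function.update V i v) J := by
  have := hB.lin
  have := Nat.size_le.2 hi
  have := Nat.size_le.2 hv
  exact ⟨by omega, rfl⟩

theorem foldl_bits (a : ℕ) :
    a.bits.reverse.foldl (fun x (t : Bool) => 2 * x + t.toNat) 0 = a := by
  rw [List.foldl_reverse]
  induction a using Nat.binaryRec' with
  | zero => rfl
  | bit b n h ih =>
    rw [Nat.bits_append_bit n b h, List.foldr_cons, ih, Nat.bit_val]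

theorem le_foldl_bits (ts : List Bool) (a : ℕ) :
    a ≤ ts.foldl (fun x (t : Bool) => 2 * x + t.toNat) a := by
  induction ts generalizing a with
  | nil => exact le_rfl
  | cons t ts ih =>
    rw [List.foldl_cons]
    exact le_trans (by omega) (ih _)

theorem sat_divLoop (hB : Budget I W J) {b : ℕ} (hb : 2 * b ≤ 2 ^ W) (ts : List Bool) (Q r : ℕ)
    (hr : r < b)
    (hN : ts.foldl (fun x (t : Bool) => 2 * x + t.toNat) (Q * b + r) < 2 ^ W) :
    Sat (divLoop b ts Q r) (fun p => p.2 < b ∧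
      p.1 * b + p.2 = ts.foldl (fun x (t : Bool) => 2 * x + t.toNat) (Q * b + r))
      (ts.length * (4 * J)) := by
  induction ts generalizing Q r with
  | nil => exact ⟨hr, rfl⟩
  | cons t ts ih =>
    have hlen : (t :: ts).length * (4 * J) = ts.length * (4 * J) + 4 * J := by
      rw [List.length_cons, Nat.succ_mul]
    have ht : t.toNat ≤ 1 := Bool.toNat_le t
    have hQ : Q < 2 ^ W := by
      have h1 := le_foldl_bits (t :: ts) (Q * b + r)
      have h2 : Q ≤ Q * b := Nat.le_mul_of_pos_right _ (by omega)
      omega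
    rw [List.foldl_cons] at hN ⊢
    rw [divLoop]
    refine (sat_push hB t (by omega)).bind (by omega) ?_
    rintro _ rfl
    refine Sat.bind_ite (sat_le hB (by omega) (by omega)) (by omega) (fun h => ?_) (fun h => ?_)
    · refine (sat_sub hB (by omega) (by omega)).bind (by omega) ?_
      rintro _ rfl
      refine (sat_push hB true hQ).bind (by omega) ?_
      rintro _ rfl
      have e : (2 * Q + true.toNat) * b + (2 * r + t.toNat - b)
          = 2 * (Q * b + r) + t.toNat := by
        have : (2 * Q + true.toNat) * b = 2 * (Q * b) + b := by
          simp only [Bool.toNat_true]; ring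
        omega
      refine (ih _ _ (by omega) (by rw [e]; exact hN)).mono (by omega) ?_
      rw [e]
      exact fun p hp => hp
    · refine (sat_push hB false hQ).bind (by omega) ?_
      rintro _ rfl
      have e : (2 * Q + false.toNat) * b + (2 * r + t.toNat) = 2 * (Q * b + r) + t.toNat := by
        have : (2 * Q + false.toNat) * b = 2 * (Q * b) := by
          simp only [Bool.toNat_false]; ring
        omega
      refine (ih _ _ (by omega) (by rw [e]; exact hN)).mono (by omega) ?_
      rw [e]
      exact fun p hp => hp

theorem sat_divMod (hB : Budget I W J) {a b : ℕ} (ha : a < 2 ^ W) (hb0 : 0 < b)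
    (hb : 2 * b ≤ 2 ^ W) :
    Sat (divMod a b) (· = (a / b, a % b)) ((4 * a.size + 1) * J) := by
  have hc : (4 * a.size + 1) * J = a.size * (4 * J) + J := by ring
  refine (sat_bits hB ha).bind (by omega) ?_
  rintro _ rfl
  have hlen : a.bits.reverse.length = a.size := by
    rw [List.length_reverse, Nat.size_eq_bits_len]
  have h0 : 0 * b + 0 = 0 := by simp
  have := sat_divLoop hB hb a.bits.reverse 0 0 hb0 (by rw [h0, foldl_bits]; exact ha)
  rw [h0, foldl_bits, hlen] at this
  refine this.mono (by omega) ?_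
  rintro ⟨Q, r⟩ ⟨h1, h2⟩
  simp only at h1 h2
  rw [← h2]
  ext
  · simp only
    rw [mul_comm, Nat.mul_add_div hb0, Nat.div_eq_of_lt h1, add_zero]
  · simp only
    rw [mul_comm, Nat.mul_add_mod, Nat.mod_eq_of_lt h1]

end Budget

/-- `M` holds the data for reductions modulo `q ≥ 2`, and the numbers that occur in these reductions
have at most `W` bits. -/
structure ModSetup (I : ℕ → ℕ) (W J q : ℕ) (M : Modulus) : Prop extends Budget I W J where
  two_le : 2 ≤ q
  hq : M.q = q
  hlen : M.len = q.size
  hlen2 : M.len2 = 2 * q.size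
  hrecip : M.recip = 4 ^ q.size / q
  size_le : 4 * q.size ≤ W

/-- `r` is the reduced representative of the residue class `z`. -/
def Rep (q r : ℕ) (z : ZMod q) : Prop := r < q ∧ (r : ZMod q) = z

theorem Rep.eq_iff {q r s : ℕ} {y z : ZMod q} (hr : Rep q r y) (hs : Rep q s z) :
    r = s ↔ y = z := by
  rw [← hr.2, ← hs.2, ZMod.natCast_eq_natCast_iff]
  exact ⟨fun h => by rw [h], fun h => Nat.ModEq.eq_of_lt_of_lt h hr.1 hs.1⟩

theorem Rep.mod {q : ℕ} (hq : 0 < q) (x : ℕ) : Rep q (x % q) (x : ZMod q) :=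
  ⟨Nat.mod_lt _ hq, by simp⟩

theorem Rep.zero {q : ℕ} (hq : 0 < q) : Rep q 0 0 := ⟨hq, by simp⟩

section Modulus

variable {I : ℕ → ℕ} {W J q : ℕ} {M : Modulus}

theorem ModSetup.pos (hM : ModSetup I W J q M) : 0 < q := by have := hM.two_le; omega

theorem ModSetup.lt_pow (hM : ModSetup I W J q M) {x k : ℕ} (hx : x < 2 ^ k)
    (hk : k ≤ 4 * q.size) : x < 2 ^ W :=
  hx.trans_le (Nat.pow_le_pow_right (by norm_num) (hk.trans hM.size_le))

theorem ModSetup.two_mul_lt (hM : ModSetup I W J q M) {x : ℕ} (hx : x < 2 * q) : x < 2 ^ W := by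
  have h1 : q < 2 ^ q.size := Nat.lt_size_self q
  have h2 : 0 < q.size := Nat.size_pos.2 hM.pos
  refine hM.lt_pow (k := q.size + 1) ?_ (by omega)
  rw [pow_succ]
  omega

theorem ModSetup.lt (hM : ModSetup I W J q M) {x : ℕ} (hx : x < q) : x < 2 ^ W :=
  hM.two_mul_lt (by omega)

theorem ModSetup.size_lt (hM : ModSetup I W J q M) {k : ℕ} (hk : k ≤ 4 * q.size) : k < 2 ^ W :=
  (hk.trans hM.size_le).trans_lt Nat.lt_two_pow_self

theorem mul_lt_four_pow_size {x y : ℕ} (hx : x < q) (hy : y < q) : x * y < 4 ^ q.size := by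
  have h1 : q < 2 ^ q.size := Nat.lt_size_self q
  calc x * y < 2 ^ q.size * 2 ^ q.size :=
        Nat.mul_lt_mul'' (hx.trans h1) (hy.trans h1)
    _ = 4 ^ q.size := by rw [← mul_pow]; norm_num

/-- The error of the quotient in Barrett reduction is at most one, since
`x / q - x * recip / 4 ^ ℓ ≤ x / 4 ^ ℓ < 1`. -/
theorem barrett_bounds {x q m : ℕ} (hq : 0 < q) (hx : x < m) :
    x * (m / q) / m * q ≤ x ∧ x < x * (m / q) / m * q + 2 * q := by
  have hm : 0 < m := by omega
  constructor
  · have h1 : x * (m / q) / m * q * m ≤ x * m := by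
      calc x * (m / q) / m * q * m = x * (m / q) / m * m * q := by ring
        _ ≤ x * (m / q) * q := Nat.mul_le_mul_right _ (Nat.div_mul_le_self _ _)
        _ = x * (m / q * q) := by ring
        _ ≤ x * m := Nat.mul_le_mul_left _ (Nat.div_mul_le_self _ _)
    exact Nat.le_of_mul_le_mul_right h1 hm
  · have h1 : m < (m / q + 1) * q := by
      rw [Nat.mul_comm]; exact Nat.lt_mul_div_succ m hq
    have h2 : x * (m / q) < (x * (m / q) / m + 1) * m := by
      rw [Nat.mul_comm _ m]; exact Nat.lt_mul_div_succ _ hm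
    set t := x * (m / q) / m
    set c := m / q
    have h3 : x * m ≤ x * ((c + 1) * q) := Nat.mul_le_mul_left _ h1.le
    have h4 : x * m < (t * q + 2 * q) * m := by
      have h5 : x * c * q < (t + 1) * m * q := Nat.mul_lt_mul_of_pos_right h2 hq
      have h6 : x * q ≤ m * q := Nat.mul_le_mul_right _ hx.le
      calc x * m ≤ x * c * q + x * q := by linarith
        _ < (t + 1) * m * q + m * q := by omega
        _ = (t * q + 2 * q) * m := by ring
    exact Nat.lt_of_mul_lt_mul_right h4

theorem sat_reduce (hM : ModSetup I W J q M) {x : ℕ} (hx : x < 4 ^ q.size) :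
    Sat (reduce I M x) (· = x % q) (6 * J) := by
  have hB := hM.toBudget
  have h4 : 4 ^ q.size = 2 ^ (2 * q.size) := by rw [pow_mul]; norm_num
  have hx2 := hx
  rw [h4] at hx2
  have hrec : M.recip ≤ 2 ^ (2 * q.size) / 2 := by
    rw [hM.hrecip, h4]; exact Nat.div_le_div_left hM.two_le (by norm_num)
  have hpos : 0 < 2 ^ (2 * q.size) := by positivity
  have hprod : x * M.recip < 2 ^ (4 * q.size) := by
    calc x * M.recip < 2 ^ (2 * q.size) * 2 ^ (2 * q.size) :=
          Nat.mul_lt_mul'' hx2 (by omega)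
      _ = 2 ^ (4 * q.size) := by rw [← pow_add]; congr 1; omega
  obtain ⟨hb1, hb2⟩ := barrett_bounds hM.pos hx
  rw [reduce]
  refine (sat_mul hB (hM.lt_pow hx2 (by omega)) (hM.lt_pow (k := 2 * q.size) (by omega)
    (by omega))).bind (by omega) ?_
  rintro _ rfl
  refine (sat_shr hB (hM.lt_pow hprod le_rfl) (by rw [hM.hlen2]; exact hM.size_lt (by omega))).bind
    (by omega) ?_
  rintro _ rfl
  have ht : x * M.recip / 2 ^ M.len2 = x * (4 ^ q.size / q) / 4 ^ q.size := by
    rw [hM.hlen2, hM.hrecip, h4]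
  rw [ht]
  set t := x * (4 ^ q.size / q) / 4 ^ q.size
  have htx : t ≤ x := (Nat.le_mul_of_pos_right _ hM.pos).trans hb1
  rw [hM.hq]
  refine (sat_mul hB (hM.lt_pow (htx.trans_lt hx2) (by omega))
    (hM.two_mul_lt (by have := hM.two_le; omega))).bind (by omega) ?_
  rintro _ rfl
  refine (sat_sub hB (hM.lt_pow hx2 (by omega)) (hM.lt_pow (hb1.trans_lt hx2) (by omega))).bind
    (by omega) ?_
  rintro _ rfl
  have hmod : (x - t * q) % q = x % q := by
    conv_rhs => rw [show x = (x - t * q) + t * q by omega]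
    rw [Nat.add_mul_mod_self_right]
  refine Sat.bind_ite (sat_le hB (hM.two_mul_lt (by have := hM.two_le; omega))
    (hM.two_mul_lt (by omega))) (by omega) (fun h => ?_) (fun h => ?_)
  · refine (sat_sub hB (hM.two_mul_lt (by omega)) (hM.two_mul_lt (by have := hM.two_le; omega))).mono
      (by omega) ?_
    rintro _ rfl
    rw [← hmod, Nat.mod_eq_sub_mod h, Nat.mod_eq_of_lt (by omega)]
  · rw [sat_pure, ← hmod, Nat.mod_eq_of_lt (by omega)]

theorem sat_addMod (hM : ModSetup I W J q M) {x y : ℕ} {a b : ZMod q} (hx : Rep q x a)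
    (hy : Rep q y b) : Sat (addMod M x y) (Rep q · (a + b)) (3 * J) := by
  have hB := hM.toBudget
  have := hx.1
  have := hy.1
  have hq := hM.hq
  rw [addMod]
  refine (sat_add hB (hM.lt hx.1) (hM.lt hy.1)).bind (by omega) ?_
  rintro _ rfl
  refine Sat.bind_ite (sat_le hB (hM.two_mul_lt (by omega)) (hM.two_mul_lt (by omega))) (by omega)
    (fun h => ?_) (fun h => ?_)
  · refine (sat_sub hB (hM.two_mul_lt (by omega)) (hM.two_mul_lt (by omega))).mono (by omega) ?_
    rintro _ rfl
    refine ⟨by omega, ?_⟩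
    rw [Nat.cast_sub h, hq]
    simp [hx.2, hy.2]
  · rw [sat_pure]
    exact ⟨by omega, by simp [hx.2, hy.2]⟩

theorem sat_subMod (hM : ModSetup I W J q M) {x y : ℕ} {a b : ZMod q} (hx : Rep q x a)
    (hy : Rep q y b) : Sat (subMod M x y) (Rep q · (a - b)) (4 * J) := by
  have hB := hM.toBudget
  have := hx.1
  have := hy.1
  have hq := hM.hq
  rw [subMod]
  refine (sat_add hB (hM.lt hx.1) (hM.two_mul_lt (by omega))).bind (by omega) ?_
  rintro _ rfl
  refine (sat_sub hB (hM.two_mul_lt (by omega)) (hM.lt hy.1)).bind (by omega) ?_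
  rintro _ rfl
  refine Sat.bind_ite (sat_le hB (hM.two_mul_lt (by omega)) (hM.two_mul_lt (by omega))) (by omega)
    (fun h => ?_) (fun h => ?_)
  · refine (sat_sub hB (hM.two_mul_lt (by omega)) (hM.two_mul_lt (by omega))).mono (by omega) ?_
    rintro _ rfl
    refine ⟨by omega, ?_⟩
    rw [Nat.cast_sub h, Nat.cast_sub (by omega), hq]
    simp [hx.2, hy.2]
  · rw [sat_pure]
    refine ⟨by omega, ?_⟩
    rw [Nat.cast_sub (by omega), hq]
    simp [hx.2, hy.2]

theorem sat_mulMod (hM : ModSetup I W J q M) {x y : ℕ} {a b : ZMod q} (hx : Rep q x a)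
    (hy : Rep q y b) : Sat (mulMod I M x y) (Rep q · (a * b)) (7 * J) := by
  rw [mulMod]
  refine (sat_mul hM.toBudget (hM.lt hx.1) (hM.lt hy.1)).bind (by omega) ?_
  rintro _ rfl
  refine (sat_reduce hM (mul_lt_four_pow_size hx.1 hy.1)).mono (by omega) ?_
  rintro _ rfl
  have := Rep.mod hM.pos (x * y)
  rwa [Nat.cast_mul, hx.2, hy.2] at this

theorem sat_powLoop (hM : ModSetup I W J q M) {x : ℕ} {a : ZMod q} (hx : Rep q x a)
    (ts : List Bool) (r e : ℕ) (hr : Rep q r (a ^ e)) :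
    Sat (powLoop I M x ts r)
      (Rep q · (a ^ ts.foldl (fun x (t : Bool) => 2 * x + t.toNat) e))
      (ts.length * (14 * J)) := by
  induction ts generalizing r e with
  | nil => exact hr
  | cons t ts ih =>
    have hlen : (t :: ts).length * (14 * J) = ts.length * (14 * J) + 14 * J := by
      rw [List.length_cons, Nat.succ_mul]
    rw [powLoop]
    refine (sat_mulMod hM hr hr).bind (by omega) fun r hr => ?_
    rw [← pow_add, ← two_mul] at hr
    cases t
    · refine (ih r (2 * e) hr).mono_cost (by omega)
    · simp only [if_true]
      refine (sat_mulMod hM hr hx).bind (by omega) fun r hr => ?_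
      rw [← pow_succ] at hr
      exact (ih r (2 * e + 1) hr).mono_cost (by omega)

theorem Rep.one {q : ℕ} (hq : 2 ≤ q) : Rep q 1 1 := ⟨by omega, by simp⟩

theorem sat_powMod (hM : ModSetup I W J q M) {x e : ℕ} {a : ZMod q} (hx : Rep q x a)
    (he : e < 2 ^ W) :
    Sat (powMod I M x e) (Rep q · (a ^ e)) ((14 * e.size + 1) * J) := by
  have hc : (14 * e.size + 1) * J = e.size * (14 * J) + J := by ring
  rw [powMod]
  refine (sat_bits hM.toBudget he).bind (by omega) ?_
  rintro _ rfl
  have := sat_powLoop hM hx e.bits.reverse 1 0 (by simpa using Rep.one hM.two_le)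
  rw [foldl_bits, List.length_reverse, Nat.size_eq_bits_len] at this
  exact this.mono_cost (by omega)

theorem sat_blockLoop (hM : ModSetup I W J q M) (ds : List ℕ) (hds : ∀ d ∈ ds, d < 2 ^ q.size)
    (r : ℕ) (a : ZMod q) (hr : Rep q r a) :
    Sat (blockLoop I M ds r)
      (Rep q · (ds.foldl (fun (x : ZMod q) (d : ℕ) => x * 2 ^ q.size + d) a))
      (ds.length * (8 * J)) := by
  induction ds generalizing r a with
  | nil => exact hr
  | cons d ds ih =>
    have hlen : (d :: ds).length * (8 * J) = ds.length * (8 * J) + 8 * J := by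
      rw [List.length_cons, Nat.succ_mul]
    have hB := hM.toBudget
    have hd := hds d (by simp)
    rw [blockLoop]
    have h1 : q < 2 ^ q.size := Nat.lt_size_self q
    have hr1 : (r + 1) * 2 ^ q.size ≤ 2 ^ (2 * q.size) := by
      rw [two_mul, pow_add]
      exact Nat.mul_le_mul_right _ (by have := hr.1; omega)
    have hr2 : r * 2 ^ q.size + d < 2 ^ (2 * q.size) := by linarith
    refine (sat_shl hB (hM.lt hr.1) (by rw [hM.hlen]; have := hM.size_le; omega)).bind
      (by omega) ?_
    rintro _ rfl
    rw [hM.hlen]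
    refine (sat_add hB (hM.lt_pow (k := 2 * q.size) (by omega) (by omega))
      (hM.lt_pow hd (by omega))).bind (by omega) ?_
    rintro _ rfl
    refine (sat_reduce hM (by rw [show 4 = 2 ^ 2 by norm_num, ← pow_mul]; exact hr2)).bind
      (by omega) ?_
    rintro _ rfl
    have hrep := Rep.mod hM.pos (r * 2 ^ q.size + d)
    push_cast at hrep
    rw [hr.2] at hrep
    exact (ih (fun d' hd' => hds d' (by simp [hd'])) _ _ hrep).mono_cost (by omega)

theorem foldl_digits (q b a : ℕ) :
    (Nat.digits b a).reverse.foldl (fun (x : ZMod q) (d : ℕ) => x * b + d) 0 = a := by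
  rw [List.foldl_reverse]
  conv_rhs => rw [← Nat.ofDigits_digits b a]
  induction Nat.digits b a with
  | nil => simp
  | cons d ds ih =>
    rw [List.foldr_cons, ih, Nat.ofDigits_cons]
    push_cast
    ring

theorem length_digits_two_pow_le {w : ℕ} (hw : 0 < w) (a : ℕ) :
    (Nat.digits (2 ^ w) a).length ≤ a.size / w + 1 := by
  have h2 : 1 < 2 ^ w := Nat.one_lt_two_pow hw.ne'
  rw [Nat.digits_length_le_iff h2, ← pow_mul]
  refine (Nat.lt_size_self a).trans_le (Nat.pow_le_pow_right (by norm_num) ?_)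
  rw [mul_comm, Nat.mul_comm]
  exact (Nat.lt_mul_div_succ _ hw).le

theorem sat_reduceInt (hM : ModSetup I W J q M) {c : ℤ} {S : ℕ} (hc : c.natAbs.size ≤ S) :
    Sat (reduceInt I M c) (Rep q · (c : ZMod q)) (14 * (S / q.size + 1) * J) := by
  have hpos : 0 < q.size := Nat.size_pos.2 hM.pos
  have hJ := hM.lin
  have hW := hM.size_le
  have hlen : (Nat.digits (2 ^ q.size) c.natAbs).length ≤ S / q.size + 1 :=
    (length_digits_two_pow_le hpos _).trans (Nat.succ_le_succ (Nat.div_le_div_right hc))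
  set D := S / q.size + 1 with hD
  have hDJ : 8 * D * J = D * (8 * J) := by ring
  have hcost : 14 * D * J = D * (8 * J) + 6 * (D * J) := by ring
  have h1J : J ≤ D * J := Nat.le_mul_of_pos_left _ (by rw [hD]; exact Nat.succ_pos _)
  have hS : S ≤ D * J := by
    have h1 : S < q.size * D := by rw [hD]; exact Nat.lt_mul_div_succ _ hpos
    have h2 : q.size * D ≤ D * J := by rw [mul_comm]; exact Nat.mul_le_mul_left _ (by omega)
    omega
  rw [reduceInt, hM.hlen]
  have hblocks : Sat (blocks q.size c.natAbs)
      (· = (Nat.digits (2 ^ q.size) c.natAbs).reverse) (D * J + J) := by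
    have : q.size.size ≤ W := Nat.size_le.2 (hM.size_lt (by omega))
    exact ⟨by omega, rfl⟩
  refine hblocks.bind (by omega) ?_
  rintro _ rfl
  have hloop := sat_blockLoop hM (Nat.digits (2 ^ q.size) c.natAbs).reverse
    (fun d hd => Nat.digits_lt_base (Nat.one_lt_two_pow hpos.ne') (List.mem_reverse.1 hd)) 0 0
    (Rep.zero hM.pos)
  have hfold := foldl_digits q (2 ^ q.size) c.natAbs
  push_cast at hfold
  rw [hfold, List.length_reverse] at hloop
  refine (hloop.mono_cost (Nat.mul_le_mul_right (8 * J) hlen)).bind (by omega) fun r hr => ?_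
  split_ifs with h
  · have h0 := sat_subMod hM (Rep.zero hM.pos) hr
    have hz : (0 : ZMod q) - (c.natAbs : ZMod q) = (c : ZMod q) := by
      have h2 : c = -(c.natAbs : ℤ) := by omega
      conv_rhs => rw [h2, Int.cast_neg, Int.cast_natCast]
      rw [zero_sub]
    rw [hz] at h0
    exact h0.mono_cost (by omega)
  · have hz : (c.natAbs : ZMod q) = (c : ZMod q) := by
      have h2 : c = (c.natAbs : ℤ) := by omega
      conv_rhs => rw [h2, Int.cast_natCast]
    rw [hz] at hr
    exact hr

theorem sat_mkModulus (hB : Budget I W J) {q : ℕ} (hq : 2 ≤ q) (hW : 4 * q.size ≤ W) :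
    Sat (mkModulus q) (ModSetup I W J q) (16 * q.size * J) := by
  have hpos : 0 < q.size := Nat.size_pos.2 (by omega)
  have h1 : q < 2 ^ q.size := Nat.lt_size_self q
  have hsz : (2 ^ (2 * q.size)).size = 2 * q.size + 1 := by
    rw [Nat.size_pow]
  have hc : 16 * q.size * J = (4 * (2 * q.size + 1) + 1) * J + 8 * (q.size * J) - 5 * J := by
    have : (4 * (2 * q.size + 1) + 1) * J = 8 * (q.size * J) + 5 * J := by ring
    rw [this]
    have : 16 * q.size * J = 16 * (q.size * J) := by ring
    omega
  have hJ : 2 * J ≤ q.size * J := Nat.mul_le_mul_right _ (Nat.lt_size.2 (by simpa using hq))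
  have hlt : ∀ {x k : ℕ}, x ≤ 2 ^ k → k < 4 * q.size → x < 2 ^ W := fun hx hk =>
    hx.trans_lt (Nat.pow_lt_pow_right (by norm_num) (by omega))
  have hqW : q < 2 ^ W := hlt h1.le (by omega)
  have hsW : ∀ {k : ℕ}, k ≤ 4 * q.size → k < 2 ^ W := fun hk =>
    (hk.trans hW).trans_lt Nat.lt_two_pow_self
  rw [mkModulus]
  refine (sat_len hB hqW).bind (by omega) ?_
  rintro _ rfl
  refine (sat_add hB (hsW (by omega)) (hsW (by omega))).bind (by omega) ?_
  rintro _ rfl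
  refine (sat_shl hB (hsW (by omega)) (by omega)).bind (by omega) ?_
  rintro _ rfl
  rw [← two_mul, one_mul]
  have hd := sat_divMod hB (a := 2 ^ (2 * q.size)) (b := q) (hlt le_rfl (by omega)) (by omega)
    (by
      calc 2 * q ≤ 2 ^ (q.size + 1) := by rw [pow_succ]; omega
        _ ≤ 2 ^ W := Nat.pow_le_pow_right (by norm_num) (by omega))
  rw [hsz] at hd
  refine hd.bind (by omega) ?_
  rintro _ rfl
  rw [sat_pure]
  exact
    { toBudget := hB
      two_le := hq
      hq := rfl
      hlen := rfl
      hlen2 := rfl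
      hrecip := by simp only [pow_mul]; norm_num
      size_le := hW }

end Modulus

/-! ### The Miller-Rabin test -/

/-- The residue class `a` passes a round of the Miller-Rabin test, where `q - 1 = m * 2 ^ h`. -/
def MRPass (q m h : ℕ) (a : ZMod q) : Prop := a ^ m = 1 ∨ ∃ j < h, a ^ (m * 2 ^ j) = -1

theorem MRPass.of_prime {q m h : ℕ} (hq : q.Prime) (hm : q - 1 = m * 2 ^ h) {a : ZMod q}
    (ha : a ≠ 0) : MRPass q m h a := by
  have := Fact.mk hq
  have h1 : a ^ (m * 2 ^ h) = 1 := by rw [← hm]; exact ZMod.pow_card_sub_one_eq_one ha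
  clear hm
  induction h with
  | zero => left; simpa using h1
  | succ h ih =>
    rw [pow_succ, ← mul_assoc, pow_mul, pow_two, mul_self_eq_one_iff] at h1
    rcases h1 with h1 | h1
    · exact (ih h1).imp_right fun ⟨j, hj, h2⟩ => ⟨j, by omega, h2⟩
    · exact Or.inr ⟨h, by omega, h1⟩

theorem MRPass.pow_eq_one {q m h : ℕ} {a : ZMod q} (ha : MRPass q m h a) :
    a ^ (m * 2 ^ h) = 1 := by
  rcases ha with ha | ⟨j, hj, ha⟩
  · rw [pow_mul, ha, one_pow]
  · obtain ⟨k, rfl⟩ := Nat.exists_eq_add_of_lt hj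
    have : m * 2 ^ (j + k + 1) = m * 2 ^ j * (2 * 2 ^ k) := by ring
    rw [this, pow_mul, ha, pow_mul]
    simp

/-- A set of residue classes that is contained in a proper subgroup of the group of units modulo `q`
fills at most half of the interval `[1, q - 1]`. -/
theorem two_mul_card_le_of_subgroup {q : ℕ} (hq : 2 ≤ q) (B : Subgroup (ZMod q)ˣ) (hB : B ≠ ⊤)
    (s : Finset ℕ) (hs : ∀ a ∈ s, a < q ∧ ∃ u ∈ B, (u : ZMod q) = a) :
    2 * s.card ≤ q - 1 := by
  classical
  have : NeZero q := ⟨by omega⟩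
  have h1 : s.card ≤ Nat.card B := by
    choose! f hf using fun a ha => (hs a ha).2
    have : s.card ≤ (Finset.univ.filter (· ∈ B) : Finset (ZMod q)ˣ).card := by
      refine Finset.card_le_card_of_injOn f (fun a ha => ?_) (fun a ha b hb hab => ?_)
      · simpa using (hf a ha).1
      · have h2 : (a : ZMod q) = b := by rw [← (hf a ha).2, ← (hf b hb).2, hab]
        rw [ZMod.natCast_eq_natCast_iff] at h2
        exact Nat.ModEq.eq_of_lt_of_lt h2 (hs a ha).1 (hs b hb).1
    refine this.trans (le_of_eq ?_)
    rw [Nat.card_eq_fintype_card, Fintype.card_subtype]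
  have h2 : Nat.card B * B.index = q.totient := by
    rw [B.card_mul_index, Nat.card_eq_fintype_card, ZMod.card_units_eq_totient]
  -- A proper subgroup has index at least `2`.
  have h3 : 2 ≤ B.index := by
    have h4 : B.index ≠ 1 := fun h => hB (Subgroup.index_eq_one.1 h)
    have h5 : B.index ≠ 0 := Subgroup.index_ne_zero_of_finite
    omega
  have h4 : q.totient < q := Nat.totient_lt q (by omega)
  have h5 : Nat.card B * 2 ≤ Nat.card B * B.index := Nat.mul_le_mul_left _ h3
  omega

theorem isUnit_of_pow_eq {q N : ℕ} {a : ZMod q} (hN : N ≠ 0) (h : a ^ N = 1 ∨ a ^ N = -1) :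
    IsUnit a := by
  have : IsUnit (a ^ N) := by
    rcases h with h | h <;> rw [h]
    · exact isUnit_one
    · exact isUnit_one.neg
  exact (isUnit_pow_iff hN).1 this

/-- The units whose `N`-th power is `1` or `-1`. -/
def powEqOneOrNegOne (q N : ℕ) : Subgroup (ZMod q)ˣ where
  carrier := {u | u ^ N = 1 ∨ u ^ N = -1}
  one_mem' := by simp
  mul_mem' := by
    rintro a b (ha | ha) (hb | hb) <;> simp [mul_pow, ha, hb]
  inv_mem' := by
    rintro a (ha | ha) <;> simp [inv_pow, ha]

theorem one_add_pow_of_mul_self {R : Type*} [CommRing R] {x : R} (hx : x * x = 0) (n : ℕ) :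
    (1 + x) ^ n = 1 + n * x := by
  induction n with
  | zero => simp
  | succ n ih =>
    rw [pow_succ, ih]
    push_cast
    linear_combination (n : R) * hx

/-- At most half of the bases pass a round of the test if `q` is composite. -/
theorem two_mul_card_liars_le {q m h : ℕ} (hq : 3 ≤ q) (hp : ¬q.Prime) (hm : Odd m)
    (hmh : q - 1 = m * 2 ^ h) (s : Finset ℕ)
    (hs : ∀ a ∈ s, a < q ∧ MRPass q m h a) : 2 * s.card ≤ q - 1 := by
  have : Fact (1 < q) := ⟨by omega⟩
  have hneg : (-1 : ZMod q) ≠ 1 := by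
    have : Fact (2 < q) := ⟨hq⟩
    exact ZMod.neg_one_ne_one
  have hq1 : q - 1 ≠ 0 := by omega
  have hcast : ((q - 1 : ℕ) : ZMod q) = -1 := by
    rw [Nat.cast_sub (by omega)]; simp
  -- The elements that pass a Fermat test form a subgroup.
  have key : ∀ u : (ZMod q)ˣ, u ^ (q - 1) ≠ 1 → 2 * s.card ≤ q - 1 := by
    intro u hu
    refine two_mul_card_le_of_subgroup (by omega) (powMonoidHom (q - 1) : (ZMod q)ˣ →* _).ker ?_ s
      fun a ha => ⟨(hs a ha).1, ?_⟩
    · intro htop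
      have : u ∈ (powMonoidHom (q - 1) : (ZMod q)ˣ →* _).ker := by rw [htop]; trivial
      exact hu (by simpa [MonoidHom.mem_ker] using this)
    · have h1 := (hs a ha).2.pow_eq_one
      rw [← hmh] at h1
      obtain ⟨v, hv⟩ := isUnit_of_pow_eq hq1 (Or.inl h1)
      refine ⟨v, ?_, hv⟩
      rw [MonoidHom.mem_ker, powMonoidHom_apply]
      ext
      rw [Units.val_pow_eq_pow_val, hv, h1, Units.val_one]
  by_cases hsq : Squarefree q
  swap
  · -- If `p ^ 2` divides `q`, then `x = q / p` satisfies `x ^ 2 = 0` and `(1 + x) ^ (q - 1) = 1 - x`.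
    rw [Nat.squarefree_iff_prime_squarefree] at hsq
    push Not at hsq
    obtain ⟨p, hpp, r, hr⟩ := hsq
    have hxx : ((p * r : ℕ) : ZMod q) * ((p * r : ℕ) : ZMod q) = 0 := by
      rw [← Nat.cast_mul, ZMod.natCast_eq_zero_iff]
      exact ⟨r, by rw [hr]; ring⟩
    have hx0 : ((p * r : ℕ) : ZMod q) ≠ 0 := by
      rw [Ne, ZMod.natCast_eq_zero_iff]
      intro hd
      have hpos : 0 < p * r := Nat.pos_of_ne_zero fun h0 => by
        rw [mul_assoc, h0, mul_zero] at hr; omega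
      have h1 := Nat.le_of_dvd hpos hd
      have h2 : 2 * (p * r) ≤ q := by
        rw [hr, mul_assoc]; exact Nat.mul_le_mul_right _ hpp.two_le
      omega
    set x : ZMod q := ((p * r : ℕ) : ZMod q)
    refine key ⟨1 + x, 1 - x, by linear_combination -hxx, by linear_combination -hxx⟩ ?_
    intro h1
    have h2 := congrArg Units.val h1
    rw [Units.val_pow_eq_pow_val, Units.val_one] at h2
    simp only at h2
    rw [one_add_pow_of_mul_self hxx, hcast] at h2
    exact hx0 (by linear_combination -h2)
  rcases Nat.even_or_odd q with he | ho
  · -- For even `q` the exponent `q - 1` is odd, and `-1` does not pass a Fermat test.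
    have hodd : Odd (q - 1) := Nat.Even.sub_odd (by omega) he odd_one
    refine key (-1) fun h1 => hneg ?_
    have h2 := congrArg Units.val h1
    rw [Units.val_pow_eq_pow_val, Units.val_one, Units.val_neg, Units.val_one, hodd.neg_one_pow] at h2
    exact h2
  -- Let `q = p * r` with coprime `p`, `r`, and let `i` be maximal with `-1` a power of exponent
  -- `m * 2 ^ i`; the Chinese remainder theorem gives a unit whose power is neither `1` nor `-1`.
  have hh : 0 < h := by
    rcases Nat.eq_zero_or_pos h with rfl | h0
    · have : Odd (q - 1) := by rw [hmh]; simpa using hm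
      have := Nat.Odd.sub_odd ho odd_one
      exact absurd this (Nat.not_even_iff_odd.2 ‹Odd (q - 1)›)
    · exact h0
  obtain ⟨p, hpp, r, hr⟩ := Nat.exists_prime_and_dvd (show q ≠ 1 by omega)
  have hcop : Nat.Coprime p r := by
    rw [hr] at hsq
    exact Nat.coprime_of_squarefree_mul hsq
  have hodd : Odd p ∧ Odd r := by rw [hr] at ho; exact Nat.odd_mul.1 ho
  have hp2 : 2 < p := by
    have := hpp.two_le
    rcases hodd.1 with ⟨t, ht⟩
    omega
  have hr2 : 2 < r := by
    have h1 : r ≠ 1 := fun h1 => hp (by rw [hr, h1, mul_one]; exact hpp)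
    rcases hodd.2 with ⟨t, ht⟩
    omega
  obtain ⟨i, ⟨hih, a, ha⟩, hmax⟩ : ∃ i, (i < h ∧ ∃ a : ZMod q, a ^ (m * 2 ^ i) = -1) ∧
      ∀ j, (j < h ∧ ∃ a : ZMod q, a ^ (m * 2 ^ j) = -1) → j ≤ i := by
    classical
    let T := (Finset.range h).filter fun j => ∃ a : ZMod q, a ^ (m * 2 ^ j) = -1
    have hT : T.Nonempty := ⟨0, by
      simp only [T, Finset.mem_filter, Finset.mem_range]
      exact ⟨hh, -1, by simpa using hm.neg_one_pow⟩⟩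
    have h1 := T.max'_mem hT
    simp only [T, Finset.mem_filter, Finset.mem_range] at h1
    refine ⟨T.max' hT, h1, fun j hj => T.le_max' j ?_⟩
    simpa only [T, Finset.mem_filter, Finset.mem_range] using hj
  have hN : m * 2 ^ i ≠ 0 := mul_ne_zero (by rintro rfl; simp at hm) (by positivity)
  refine two_mul_card_le_of_subgroup (by omega) (powEqOneOrNegOne q (m * 2 ^ i)) ?_ s
    fun b hb => ⟨(hs b hb).1, ?_⟩
  · -- The element that is `a` modulo `p` and `1` modulo `r` shows that the subgroup is proper.
    intro htop
    subst hr
    let e := ZMod.chineseRemainder hcop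
    have hua : IsUnit a := isUnit_of_pow_eq hN (Or.inr ha)
    have hu : IsUnit (e.symm ((e a).1, 1)) := by
      refine IsUnit.map e.symm (Prod.isUnit_iff.2 ⟨?_, isUnit_one⟩)
      exact (Prod.isUnit_iff.1 (hua.map e)).1
    obtain ⟨u, hu⟩ := hu
    have hmem : u ∈ powEqOneOrNegOne (p * r) (m * 2 ^ i) := by rw [htop]; trivial
    have hpow : (u : ZMod (p * r)) ^ (m * 2 ^ i) = e.symm (-1, 1) := by
      rw [hu, ← map_pow, Prod.pow_mk, one_pow]
      congr 2
      have h1 := congrArg (fun z => (e z).1) ha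
      simpa using h1
    have : Fact (2 < p) := ⟨hp2⟩
    have : Fact (2 < r) := ⟨hr2⟩
    rcases hmem with h1 | h1
    · have h2 := congrArg Units.val h1
      rw [Units.val_pow_eq_pow_val, hpow, Units.val_one, RingEquiv.symm_apply_eq, map_one] at h2
      exact ZMod.neg_one_ne_one (congrArg Prod.fst h2)
    · have h2 := congrArg Units.val h1
      rw [Units.val_pow_eq_pow_val, hpow, Units.val_neg, Units.val_one, RingEquiv.symm_apply_eq,
        map_neg, map_one] at h2
      exact ZMod.neg_one_ne_one (congrArg Prod.snd h2).symm
  · -- By the maximality of `i`, the power `-1` of a passing base occurs at an exponent `m * 2 ^ j`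
    -- with `j ≤ i`, if at all.
    have h1 : ((b : ZMod q) ^ (m * 2 ^ i) = 1 ∨ (b : ZMod q) ^ (m * 2 ^ i) = -1) := by
      rcases (hs b hb).2 with h2 | ⟨j, hj, h2⟩
      · left; rw [pow_mul, h2, one_pow]
      · obtain ⟨k, hk⟩ := Nat.exists_eq_add_of_le (hmax j ⟨hj, _, h2⟩)
        rcases Nat.eq_zero_or_pos k with rfl | hk0
        · right; rw [hk]; exact h2
        · left
          rw [hk, pow_add, ← mul_assoc, pow_mul, h2]
          exact Even.neg_one_pow ((Nat.even_pow' hk0.ne').2 even_two)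
    obtain ⟨v, hv⟩ := isUnit_of_pow_eq hN h1
    refine ⟨v, ?_, hv⟩
    refine h1.imp (fun h1 => ?_) (fun h1 => ?_)
    · ext; rw [Units.val_pow_eq_pow_val, hv, h1, Units.val_one]
    · ext; rw [Units.val_pow_eq_pow_val, hv, h1, Units.val_neg, Units.val_one]

section Programs

variable {I : ℕ → ℕ} {W J q : ℕ} {M : Modulus}

theorem sat_oddPart (hB : Budget I W J) (fuel m h : ℕ) (hm : 0 < m) (hf : m < 2 ^ fuel)
    (hmW : m < 2 ^ W) (hW : h + fuel ≤ W) :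
    Sat (oddPart fuel m h)
      (fun p => Odd p.1 ∧ p.1 * 2 ^ p.2 = m * 2 ^ h ∧ p.2 ≤ h + fuel) (fuel * (4 * J)) := by
  induction fuel generalizing m h with
  | zero => simp at hf; omega
  | succ fuel ih =>
    have hc : (fuel + 1) * (4 * J) = fuel * (4 * J) + 4 * J := Nat.succ_mul _ _
    have hs : ∀ {k : ℕ}, k ≤ W → k < 2 ^ W := fun hk => hk.trans_lt Nat.lt_two_pow_self
    rw [oddPart]
    refine (sat_shr hB hmW (hs (by omega))).bind (by omega) ?_
    rintro _ rfl
    rw [pow_one]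
    refine (sat_push hB false (by omega)).bind (by omega) ?_
    rintro _ rfl
    rw [Bool.toNat_false, add_zero]
    refine Sat.bind_ite (sat_eq hB (by omega) hmW) (by omega) (fun he => ?_) (fun he => ?_)
    · refine (sat_add hB (hs (by omega)) (hs (by omega))).bind (by omega) ?_
      rintro _ rfl
      rw [pow_succ] at hf
      refine (ih (m / 2) (h + 1) (by omega) (by omega) (by omega) (by omega)).mono (by omega) ?_
      rintro p ⟨h1, h2, h3⟩
      refine ⟨h1, ?_, by omega⟩
      rw [h2, pow_succ, mul_comm (2 ^ h), ← mul_assoc, mul_comm _ 2, he]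
    · rw [sat_pure]
      exact ⟨by rw [Nat.odd_iff]; omega, rfl, by simp only; omega⟩

theorem sat_hitsMinusOne (hM : ModSetup I W J q M) {q1 : ℕ} (hq1 : Rep q q1 (-1)) (h y : ℕ)
    (z : ZMod q) (hy : Rep q y z) :
    Sat (hitsMinusOne I M q1 h y) (fun b => b = true ↔ ∃ j < h, z ^ 2 ^ j = -1)
      (h * (8 * J)) := by
  induction h generalizing y z with
  | zero => simp [hitsMinusOne]
  | succ h ih =>
    have hc : (h + 1) * (8 * J) = h * (8 * J) + 8 * J := Nat.succ_mul _ _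
    rw [hitsMinusOne]
    refine Sat.bind_ite (sat_eq hM.toBudget (hM.lt hy.1) (hM.lt hq1.1)) (by omega)
      (fun he => ?_) (fun he => ?_)
    · rw [sat_pure]
      simp only [true_iff]
      exact ⟨0, by omega, by simpa using (hy.eq_iff hq1).1 he⟩
    · refine (sat_mulMod hM hy hy).bind (by omega) fun y' hy' => ?_
      refine (ih y' (z * z) hy').mono (by omega) fun b hb => hb.trans ?_
      have hsq : ∀ j, (z * z) ^ 2 ^ j = z ^ 2 ^ (j + 1) := fun j => by
        rw [← pow_two, ← pow_mul, pow_succ, mul_comm]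
      constructor
      · rintro ⟨j, hj, h1⟩
        exact ⟨j + 1, by omega, by rw [← hsq]; exact h1⟩
      · rintro ⟨j, hj, h1⟩
        cases j with
        | zero => exact absurd ((hy.eq_iff hq1).2 (by simpa using h1)) he
        | succ j => exact ⟨j, by omega, by rw [hsq]; exact h1⟩

/-- The part of a round of the Miller-Rabin test that follows the choice of the base `a`. -/
def millerRabinBase (I : ℕ → ℕ) (M : Modulus) (q1 a : ℕ) : Prog Bool := do
  let mh ← oddPart M.len q1 0
  let y ← powMod I M a mh.1
  if ← eq y 1 then return true
  else hitsMinusOne I M q1 mh.2 y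

theorem millerRabin_eq (I : ℕ → ℕ) (M : Modulus) : millerRabin I M = (do
    let q1 ← sub M.q 1
    let q2 ← sub q1 1
    let a ← uniform q2
    let a ← add a 1
    millerRabinBase I M q1 a) := rfl

theorem sat_millerRabinBase (hM : ModSetup I W J q M) {a : ℕ} (ha : a < q) :
    Sat (millerRabinBase I M (q - 1) a)
      (fun b => ∃ m h, Odd m ∧ q - 1 = m * 2 ^ h ∧ (b = true ↔ MRPass q m h a))
      ((26 * q.size + 2) * J) := by
  have hq := hM.two_le
  have hW := hM.size_le
  have hc : (26 * q.size + 2) * J =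
    q.size * (4 * J) + (14 * q.size + 1) * J + q.size * (8 * J) + J := by ring
  have hlt : q < 2 ^ q.size := Nat.lt_size_self q
  rw [millerRabinBase, hM.hlen]
  refine (sat_oddPart hM.toBudget q.size (q - 1) 0 (by omega) (by omega) (hM.lt (by omega))
    (by omega)).bind (by omega) ?_
  rintro ⟨m, h⟩ ⟨hodd, hmh, hh⟩
  simp only at hodd hmh hh ⊢
  rw [pow_zero, mul_one] at hmh
  have hmq : m < q := by
    have : m ≤ m * 2 ^ h := Nat.le_mul_of_pos_right _ (by positivity)
    omega
  have hmsize : m.size ≤ q.size := Nat.size_le_size hmq.le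
  have hcm : (14 * m.size + 1) * J ≤ (14 * q.size + 1) * J :=
    Nat.mul_le_mul_right _ (by omega)
  have hch : h * (8 * J) ≤ q.size * (8 * J) := Nat.mul_le_mul_right _ (by omega)
  have hneg : Rep q (q - 1) (-1) := ⟨by omega, by rw [Nat.cast_sub (by omega)]; simp⟩
  refine ((sat_powMod hM ⟨ha, rfl⟩ (hM.lt hmq)).mono_cost hcm).bind (by omega) fun y hy => ?_
  refine Sat.bind_ite (sat_eq hM.toBudget (hM.lt hy.1) (hM.lt (by omega))) (by omega)
    (fun he => ?_) (fun he => ?_)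
  · rw [sat_pure]
    refine ⟨m, h, hodd, hmh.symm, ?_⟩
    simp only [true_iff]
    exact Or.inl ((hy.eq_iff (Rep.one hq)).1 he)
  · refine (sat_hitsMinusOne hM hneg h y _ hy).mono (by omega) fun b hb => ?_
    refine ⟨m, h, hodd, hmh.symm, hb.trans ?_⟩
    have hne : ¬(a : ZMod q) ^ m = 1 := fun h1 => he ((hy.eq_iff (Rep.one hq)).2 h1)
    simp only [MRPass, hne, false_or, pow_mul]

theorem sat_millerRabin (hM : ModSetup I W J q M) :
    Sat (millerRabin I M) (fun b => q.Prime → b = true) (32 * q.size * J) := by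
  have hq := hM.two_le
  have hpos : 0 < q.size := Nat.size_pos.2 hM.pos
  have hc : 32 * q.size * J = (26 * q.size + 2) * J + 6 * (q.size * J) - 2 * J := by
    have : (26 * q.size + 2) * J = 26 * (q.size * J) + 2 * J := by ring
    have : 32 * q.size * J = 32 * (q.size * J) := by ring
    omega
  have hJ : J ≤ q.size * J := Nat.le_mul_of_pos_left _ hpos
  have hB := hM.toBudget
  rw [millerRabin_eq, hM.hq]
  refine (sat_sub hB (hM.two_mul_lt (by omega)) (hM.lt (by omega))).bind (by omega) ?_
  rintro _ rfl
  refine (sat_sub hB (hM.lt (by omega)) (hM.lt (by omega))).bind (by omega) ?_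
  rintro _ rfl
  refine (sat_uniform hB (hM.lt (by omega))).bind (by omega) fun a ha => ?_
  refine (sat_add hB (hM.lt (by omega)) (hM.lt (by omega))).bind (by omega) ?_
  rintro _ rfl
  refine (sat_millerRabinBase hM (by omega)).mono (by omega) ?_
  rintro b ⟨m, h, -, hmh, hb⟩ hp
  refine hb.2 (MRPass.of_prime hp hmh ?_)
  rw [Ne, ZMod.natCast_eq_zero_iff]
  exact fun hd => by have := Nat.le_of_dvd (by omega) hd; omega

/-- A composite modulus passes a round of the test with probability at most `1 / 2`. -/
theorem mean_millerRabin_le (hM : ModSetup I W J q M) (hq : 3 ≤ q) (hp : ¬q.Prime) {f : Bool → ℝ}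
    (hf : f false ≤ f true) : mean (millerRabin I M) f ≤ (f true + f false) / 2 := by
  have hB := hM.toBudget
  rw [millerRabin_eq, hM.hq]
  simp only [mean_bind]
  refine mean_le (sat_sub hB (hM.two_mul_lt (by omega)) (hM.lt (by omega))) ?_
  rintro _ rfl
  refine mean_le (sat_sub hB (hM.lt (by omega)) (hM.lt (by omega))) ?_
  rintro _ rfl
  obtain ⟨h, m, hm, hmh⟩ := Nat.exists_eq_two_pow_mul_odd (show q - 1 ≠ 0 by omega)
  rw [mul_comm] at hmh
  classical
  let s : Finset ℕ := (Finset.range (q - 2 + 1)).filter fun i => MRPass q m h ((i + 1 : ℕ))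
  have hs : 2 * s.card ≤ q - 1 := by
    have h1 := two_mul_card_liars_le hq hp hm hmh (s.map ⟨(· + 1), add_left_injective 1⟩) ?_
    · rwa [Finset.card_map] at h1
    · intro a ha
      simp only [s, Finset.mem_map, Finset.mem_filter, Finset.mem_range,
        Function.Embedding.coeFn_mk] at ha
      obtain ⟨i, ⟨hi, hpass⟩, rfl⟩ := ha
      exact ⟨by omega, hpass⟩
  rw [mean_uniform, div_le_iff₀ (by positivity)]
  calc _ ≤ ∑ i ∈ Finset.range (q - 2 + 1), (f false + if MRPass q m h ((i + 1 : ℕ)) then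
          (f true - f false) else 0) := by
        refine Finset.sum_le_sum fun i hi => ?_
        rw [Finset.mem_range] at hi
        refine mean_le (sat_add hB (hM.lt (by omega)) (hM.lt (by omega))) ?_
        rintro _ rfl
        refine mean_le (sat_millerRabinBase hM (by omega)) ?_
        rintro b ⟨m', h', hm', hmh', hb⟩
        -- The odd part of `q - 1` is unique.
        have huniq : m' = m ∧ h' = h := by
          have h1 : 2 ^ h' * m' = 2 ^ h * m := by rw [mul_comm, ← hmh', hmh, mul_comm]
          have h2 : h' = h := by
            have h3 : ∀ {k l : ℕ}, Odd l → padicValNat 2 (2 ^ k * l) = k := by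
              intro k l hl
              have hl0 : l ≠ 0 := by rintro rfl; simp at hl
              rw [padicValNat.mul (by positivity) hl0, padicValNat.prime_pow,
                padicValNat.eq_zero_of_not_dvd (by
                  intro h2; exact Nat.not_even_iff_odd.2 hl (even_iff_two_dvd.2 h2)), add_zero]
            rw [← h3 (k := h') hm', h1, h3 hm]
          subst h2
          exact ⟨Nat.eq_of_mul_eq_mul_left (by positivity) h1, rfl⟩
        obtain ⟨rfl, rfl⟩ := huniq
        cases b
        · split_ifs <;> linarith
        · rw [if_pos (hb.1 rfl)]; linarith
    _ = (q - 2 + 1 : ℕ) * f false + s.card * (f true - f false) := by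
        rw [Finset.sum_add_distrib, ← Finset.sum_filter]
        simp only [Finset.sum_const, Finset.card_range, nsmul_eq_mul, s]
    _ ≤ (f true + f false) / 2 * ((q - 2 : ℕ) + 1) := by
        have h1 : (2 : ℝ) * s.card ≤ ((q - 2 : ℕ) : ℝ) + 1 := by
          have : 2 * s.card ≤ (q - 2) + 1 := by omega
          exact_mod_cast this
        push_cast
        nlinarith [mul_le_mul_of_nonneg_right h1 (sub_nonneg.2 hf)]

end Programs

/-! ### Random primes -/

/-- The primes of the interval `[lam, 2 lam]`. -/
def primesIn (lam : ℕ) : Finset ℕ := (Finset.Icc lam (2 * lam)).filter Nat.Prime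

theorem card_primesIn_le (lam : ℕ) : (primesIn lam).card ≤ lam + 1 := by
  refine (Finset.card_filter_le _ _).trans ?_
  rw [Nat.card_Icc]
  omega

section RandomPrime

variable {I : ℕ → ℕ} {W J lam : ℕ}

theorem sat_candidate (hB : Budget I W J) (hlam : 2 ≤ lam) (hW : 4 * (2 * lam).size ≤ W) :
    Sat (candidate lam) (fun M => ∃ q, lam ≤ q ∧ q ≤ 2 * lam ∧ ModSetup I W J q M)
      ((16 * (2 * lam).size + 2) * J) := by
  have hc : (16 * (2 * lam).size + 2) * J = 16 * (2 * lam).size * J + 2 * J := by ring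
  have h2 : 2 * lam < 2 ^ W := (Nat.lt_size_self _).trans_le
    (Nat.pow_le_pow_right (by norm_num) (by omega))
  rw [candidate]
  refine (sat_uniform hB (by omega)).bind (by omega) fun x hx => ?_
  refine (sat_add hB (by omega) (by omega)).bind (by omega) ?_
  rintro _ rfl
  have hs : (lam + x).size ≤ (2 * lam).size := Nat.size_le_size (by omega)
  have hm := sat_mkModulus hB (q := lam + x) (by omega) (by omega)
  have : 16 * (lam + x).size * J ≤ 16 * (2 * lam).size * J :=
    Nat.mul_le_mul_right _ (by omega)
  exact hm.mono (by omega) fun M hM => ⟨lam + x, by omega, by omega, hM⟩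

theorem mean_candidate_le (hB : Budget I W J) (hlam : 2 ≤ lam) (hW : 4 * (2 * lam).size ≤ W)
    (f : Modulus → ℝ) (g : ℕ → ℝ)
    (hfg : ∀ q M, lam ≤ q → q ≤ 2 * lam → ModSetup I W J q M → f M ≤ g q) :
    mean (candidate lam) f ≤ (∑ q ∈ Finset.Icc lam (2 * lam), g q) / (lam + 1) := by
  have h2 : 2 * lam < 2 ^ W := (Nat.lt_size_self _).trans_le
    (Nat.pow_le_pow_right (by norm_num) (by omega))
  have hIcc : ∑ q ∈ Finset.Icc lam (2 * lam), g q = ∑ x ∈ Finset.range (lam + 1), g (lam + x) := by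
    have : Finset.Icc lam (2 * lam) = Finset.Ico lam (2 * lam + 1) := by
      ext; simp only [Finset.mem_Icc, Finset.mem_Ico]; omega
    rw [this, Finset.sum_Ico_eq_sum_range]
    congr 2
    omega
  rw [hIcc, candidate]
  simp only [mean_bind]
  rw [mean_uniform]
  gcongr with x hx
  rw [Finset.mem_range] at hx
  refine mean_le (sat_add hB (by omega) (by omega)) ?_
  rintro _ rfl
  have hs : (lam + x).size ≤ (2 * lam).size := Nat.size_le_size (by omega)
  exact mean_le (sat_mkModulus hB (q := lam + x) (by omega) (by omega)) fun M hM =>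
    hfg _ M (by omega) (by omega) hM

/-- A candidate that is prime passes every round, so that it is returned once it has been drawn. -/
theorem sat_primeLoop (hB : Budget I W J) (hlam : 2 ≤ lam) (hW : 4 * (2 * lam).size ≤ W) {t : ℕ}
    (ht : t < 2 ^ W) (fuel : ℕ) (hf : fuel < 2 ^ W) (M : Modulus) (passed : ℕ) (hp : passed ≤ t)
    {q : ℕ} (hq1 : lam ≤ q) (hq2 : q ≤ 2 * lam) (hM : ModSetup I W J q M) :
    Sat (primeLoop I lam t fuel M passed)
      (fun M' => (∃ q', lam ≤ q' ∧ q' ≤ 2 * lam ∧ ModSetup I W J q' M') ∧ (q.Prime → M' = M))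
      (fuel * ((48 * (2 * lam).size + 5) * J)) := by
  induction fuel generalizing M passed q with
  | zero => exact ⟨⟨q, hq1, hq2, hM⟩, fun _ => rfl⟩
  | succ fuel ih =>
    have hc : (fuel + 1) * ((48 * (2 * lam).size + 5) * J) =
        fuel * ((48 * (2 * lam).size + 5) * J) + 32 * (2 * lam).size * J
          + (16 * (2 * lam).size + 2) * J + 3 * J := by ring
    have hs : q.size ≤ (2 * lam).size := Nat.size_le_size hq2
    have hmr : 32 * q.size * J ≤ 32 * (2 * lam).size * J := Nat.mul_le_mul_right _ (by omega)
    have h1W : 1 < 2 ^ W := Nat.one_lt_two_pow (by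
      have := Nat.size_pos.2 (show 0 < 2 * lam by omega); omega)
    rw [primeLoop]
    refine (sat_sub hB hf h1W).bind (by omega) fun _ _ => ?_
    refine Sat.bind_ite (sat_le hB ht (by omega)) (by omega) (fun h => ?_) (fun h => ?_)
    · exact ⟨⟨q, hq1, hq2, hM⟩, fun _ => rfl⟩
    · refine ((sat_millerRabin hM).mono_cost hmr).bind (by omega) fun b hb => ?_
      split_ifs with hbt
      · refine (sat_add hB (by omega) h1W).bind (by omega) ?_
        rintro _ rfl
        exact (ih (by omega) M (passed + 1) (by omega) hq1 hq2 hM).mono_cost (by omega)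
      · refine (sat_candidate hB hlam hW).bind (by omega) ?_
        rintro M' ⟨q', h1, h2, hM'⟩
        refine (ih (by omega) M' 0 (by omega) h1 h2 hM').mono (by omega) fun M'' hM'' => ?_
        exact ⟨hM''.1, fun hqp => absurd (hb hqp) hbt⟩

/-- The common recursion for the expectation `mean (primeLoop …) f` if the current candidate is
composite: a round is passed with probability at most `1 / 2`; otherwise a new candidate is drawn,
which is final if it is prime. -/
theorem mean_primeLoop_succ_le (hB : Budget I W J) (hlam : 3 ≤ lam) (hW : 4 * (2 * lam).size ≤ W)
    {t : ℕ} (ht : t < 2 ^ W) (fuel : ℕ) (hf : fuel + 1 < 2 ^ W) (M : Modulus) (passed : ℕ)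
    (hp : passed < t) {q : ℕ} (hq1 : lam ≤ q) (hM : ModSetup I W J q M) (hqp : ¬q.Prime)
    (f : Modulus → ℝ) (g : ℕ → ℝ) (hfg : ∀ q M, lam ≤ q → ModSetup I W J q M → q.Prime → f M = g q)
    {u u0 : ℝ} (hu : mean (primeLoop I lam t fuel M (passed + 1)) f ≤ u)
    (hu0 : ∀ q M, lam ≤ q → q ≤ 2 * lam → ModSetup I W J q M → ¬q.Prime →
      mean (primeLoop I lam t fuel M 0) f ≤ u0)
    (hle : (∑ q ∈ Finset.Icc lam (2 * lam), if q.Prime then g q else u0) / (lam + 1) ≤ u) :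
    mean (primeLoop I lam t (fuel + 1) M passed) f ≤
      (u + (∑ q ∈ Finset.Icc lam (2 * lam), if q.Prime then g q else u0) / (lam + 1)) / 2 := by
  have h1W : 1 < 2 ^ W := Nat.one_lt_two_pow (by
    have := Nat.size_pos.2 (show 0 < 2 * lam by omega); omega)
  rw [primeLoop]
  simp only [mean_bind]
  refine mean_le (sat_sub hB hf h1W) fun _ _ => ?_
  refine mean_le (sat_le hB ht (by omega)) fun b hb => ?_
  rw [if_neg (fun h => by have := hb.1 h; omega)]
  simp only [mean_bind]
  set v := (∑ q ∈ Finset.Icc lam (2 * lam), if q.Prime then g q else u0) / (lam + 1)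
  refine (mean_mono _ (g := fun b => if b = true then u else v) fun b => ?_).trans ?_
  · cases b
    · simp only [Bool.false_eq_true, if_false, mean_bind]
      refine mean_candidate_le hB (by omega) hW _ _ fun q M h1 h2 hM => ?_
      split_ifs with hqp
      · rw [← hfg q M h1 hM hqp]
        exact mean_le (sat_primeLoop hB (by omega) hW ht fuel (by omega) M 0 (by omega) h1 h2 hM)
          fun M' hM' => by rw [hM'.2 hqp]
      · exact hu0 q M h1 h2 hM hqp
    · simp only [if_true, mean_bind]
      refine mean_le (sat_add hB (by omega) h1W) ?_
      rintro _ rfl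
      exact hu
  · have := mean_millerRabin_le hM (by omega) hqp (f := fun b => if b = true then u else v)
      (by simpa using hle)
    simpa using this

theorem sum_Icc_ite_prime (u : ℝ) (g : ℕ → ℝ) :
    (∑ q ∈ Finset.Icc lam (2 * lam), if q.Prime then g q else u) =
      ∑ q ∈ primesIn lam, g q + ((lam : ℝ) + 1 - (primesIn lam).card) * u := by
  rw [Finset.sum_ite, Finset.sum_const, nsmul_eq_mul]
  congr 2
  have h1 := Finset.card_filter_add_card_filter_not (s := Finset.Icc lam (2 * lam)) Nat.Prime
  rw [Nat.card_Icc] at h1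
  have h2 : ((primesIn lam).card : ℝ) +
      ((Finset.Icc lam (2 * lam)).filter fun q => ¬q.Prime).card = (lam : ℝ) + 1 := by
    have : (primesIn lam).card +
      ((Finset.Icc lam (2 * lam)).filter fun q => ¬q.Prime).card = lam + 1 := by
        rw [primesIn, h1]; omega
    exact_mod_cast this
  linarith

open Classical in
/-- The probability that a composite number is returned. The three terms bound the probabilities
that the current candidate passes its remaining rounds, that some later composite candidate passes
`t` rounds, and that the rounds are used up before a prime is drawn. -/
theorem mean_primeLoop_composite_le (hB : Budget I W J) (hlam : 3 ≤ lam)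
    (hW : 4 * (2 * lam).size ≤ W) {t : ℕ} (ht : t < 2 ^ W) (fuel : ℕ) (hf : fuel < 2 ^ W)
    (M : Modulus) (passed : ℕ) (hp : passed ≤ t) {q : ℕ} (hq1 : lam ≤ q)
    (hM : ModSetup I W J q M) (hqp : ¬q.Prime) :
    mean (primeLoop I lam t fuel M passed) (fun M => if M.q.Prime then 0 else 1) ≤
      2 ^ passed / 2 ^ t + fuel / 2 ^ t + (1 - (primesIn lam).card / (lam + 1) / 2) ^ fuel := by
  set ρ : ℝ := (primesIn lam).card / (lam + 1) with hρ
  have hρ0 : 0 ≤ ρ := by positivity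
  have hρ1 : ρ ≤ 1 := by
    rw [hρ, div_le_one (by positivity)]
    exact_mod_cast card_primesIn_le lam
  -- `ρ` is the probability that a candidate is prime. A step fails with probability at least `1 / 2`
  -- and the next candidate is then prime with probability `ρ`, whence the factor `1 - ρ / 2`.
  have hδ : 0 ≤ 1 - ρ / 2 := by linarith
  have h2t : (0 : ℝ) < 2 ^ t := by positivity
  induction fuel generalizing M passed q with
  | zero =>
    rw [primeLoop, pure_eq, mean_ret, hM.hq, if_neg hqp]
    have : (0 : ℝ) ≤ 2 ^ passed / 2 ^ t := by positivity
    simpa using this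
  | succ fuel ih =>
    rcases hp.lt_or_eq with hp | rfl
    · have hu0 := fun q M h1 (_ : q ≤ 2 * lam) hM hqp =>
        ih (by omega) M 0 (by omega) (q := q) h1 hM hqp
      have hu := ih (by omega) M (passed + 1) (by omega) hq1 hM hqp
      set D := (1 - ρ / 2) ^ fuel
      have hD : 0 ≤ D := by positivity
      have hsum : (∑ q ∈ Finset.Icc lam (2 * lam), if q.Prime then (0 : ℝ) else
          2 ^ 0 / 2 ^ t + fuel / 2 ^ t + D) / (lam + 1) =
          (1 - ρ) * (1 / 2 ^ t + fuel / 2 ^ t + D) := by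
        rw [sum_Icc_ite_prime, hρ]
        have : (lam : ℝ) + 1 ≠ 0 := by positivity
        simp only [Finset.sum_const_zero, zero_add, pow_zero]
        field_simp
      have hU0 : 0 ≤ 1 / (2 : ℝ) ^ t + fuel / 2 ^ t + D := by positivity
      have hpow : (1 : ℝ) / 2 ^ t ≤ 2 ^ (passed + 1) / 2 ^ t := by
        gcongr
        exact one_le_pow₀ (by norm_num)
      refine (mean_primeLoop_succ_le hB hlam hW ht fuel hf M passed hp hq1 hM hqp _ (fun _ => 0)
        (fun q M _ hM hqp => by rw [hM.hq, if_pos hqp]) hu hu0 ?_).trans ?_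
      · rw [hsum]
        have : (1 - ρ) * (1 / (2 : ℝ) ^ t + fuel / 2 ^ t + D) ≤
            1 * (1 / (2 : ℝ) ^ t + fuel / 2 ^ t + D) := by gcongr; linarith
        linarith
      · rw [hsum, pow_succ (1 - ρ / 2)]
        change _ ≤ 2 ^ passed / 2 ^ t + ((fuel + 1 : ℕ) : ℝ) / 2 ^ t + D * (1 - ρ / 2)
        have h3 : (2 : ℝ) ^ (passed + 1) / 2 ^ t = 2 * (2 ^ passed / 2 ^ t) := by
          rw [pow_succ]; ring
        have h4 : (fuel + 1 : ℝ) / 2 ^ t = fuel / 2 ^ t + 1 / 2 ^ t := by rw [add_div]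
        have h5 : 0 ≤ ρ * (1 / (2 : ℝ) ^ t + fuel / 2 ^ t) := by positivity
        have h6 : (0 : ℝ) < 1 / 2 ^ t := by positivity
        rw [h3]
        push_cast
        rw [h4]
        linarith
    · have hle : mean (primeLoop I lam passed (fuel + 1) M passed)
          (fun M => if M.q.Prime then (0 : ℝ) else 1) ≤ 1 :=
        (mean_mono _ (g := fun _ => 1) fun M => by split_ifs <;> norm_num).trans
          (mean_const _ _).le
      have h1 : (2 : ℝ) ^ passed / 2 ^ passed = 1 := div_self (by positivity)
      have h2 : 0 ≤ ((fuel + 1 : ℕ) : ℝ) / 2 ^ passed + (1 - ρ / 2) ^ (fuel + 1) := by positivity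
      rw [h1]
      linarith

open Classical in
/-- All primes are returned with the same probability, so that a set `s` of primes is hit with
probability at most its share of the primes. -/
theorem mean_primeLoop_mem_le (hB : Budget I W J) (hlam : 3 ≤ lam)
    (hW : 4 * (2 * lam).size ≤ W) {t : ℕ} (ht : t < 2 ^ W) (s : Finset ℕ) (hs : s ⊆ primesIn lam)
    (hne : 0 < (primesIn lam).card) (fuel : ℕ) (hf : fuel < 2 ^ W)
    (M : Modulus) (passed : ℕ) (hp : passed ≤ t) {q : ℕ} (hq1 : lam ≤ q)
    (hM : ModSetup I W J q M) (hqp : ¬q.Prime) :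
    mean (primeLoop I lam t fuel M passed) (fun M => if M.q ∈ s then 1 else 0) ≤
      s.card / (primesIn lam).card := by
  have hqs : q ∉ s := fun h => hqp (Finset.mem_filter.1 (hs h)).2
  have hσ : (0 : ℝ) ≤ s.card / (primesIn lam).card := by positivity
  induction fuel generalizing M passed q with
  | zero =>
    rw [primeLoop, pure_eq, mean_ret, hM.hq, if_neg hqs]
    exact hσ
  | succ fuel ih =>
    rcases hp.lt_or_eq with hp | rfl
    · have hu0 := fun q M h1 (_ : q ≤ 2 * lam) hM (hqp : ¬q.Prime) =>
        ih (by omega) M 0 (by omega) (q := q) h1 hM hqp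
          fun h => hqp (Finset.mem_filter.1 (hs h)).2
      have hu := ih (by omega) M (passed + 1) (by omega) hq1 hM hqp hqs
      -- The share of `s` is a fixed point of the recursion.
      have hsum : (∑ q ∈ Finset.Icc lam (2 * lam), if q.Prime then (if q ∈ s then (1 : ℝ) else 0)
          else s.card / (primesIn lam).card) / (lam + 1) = s.card / (primesIn lam).card := by
        rw [sum_Icc_ite_prime]
        have : (lam : ℝ) + 1 ≠ 0 := by positivity
        have : ((primesIn lam).card : ℝ) ≠ 0 := by positivity
        have h3 : ∑ q ∈ primesIn lam, (if q ∈ s then (1 : ℝ) else 0) = s.card := by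
          rw [← Finset.sum_filter, Finset.filter_mem_eq_inter, Finset.inter_eq_right.2 hs]
          simp
        rw [h3]
        field_simp
        ring
      refine (mean_primeLoop_succ_le hB hlam hW ht fuel hf M passed hp hq1 hM hqp _
        (fun q => if q ∈ s then 1 else 0)
        (fun q M _ hM hqp => by rw [hM.hq]) hu hu0 hsum.le).trans ?_
      rw [hsum]
      linarith
    · have h1W : 1 < 2 ^ W := Nat.one_lt_two_pow (by
        have := Nat.size_pos.2 (show 0 < 2 * lam by omega); omega)
      rw [primeLoop]
      simp only [mean_bind]
      refine mean_le (sat_sub hB hf h1W) fun _ _ => ?_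
      refine mean_le (sat_le hB ht ht) fun b hb => ?_
      rw [if_pos (hb.2 le_rfl), pure_eq, mean_ret, hM.hq, if_neg hqs]
      exact hσ

theorem sat_randomPrime (hB : Budget I W J) (hlam : 3 ≤ lam) (hW : 4 * (2 * lam).size ≤ W) {w : ℕ}
    (hR : 16 * (lam.size * w) + w + 2 < 2 ^ W) :
    Sat (randomPrime I lam w) (fun M => ∃ q, lam ≤ q ∧ q ≤ 2 * lam ∧ ModSetup I W J q M)
      ((16 * (lam.size * w) + 1) * ((48 * (2 * lam).size + 5) * J)) := by
  have hb : 0 < (2 * lam).size := Nat.size_pos.2 (by omega)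
  have hc : (16 * (lam.size * w) + 1) * ((48 * (2 * lam).size + 5) * J) =
      16 * (lam.size * w) * ((48 * (2 * lam).size + 5) * J) +
      ((16 * (2 * lam).size + 2) * J + 32 * ((2 * lam).size * J) + 3 * J) := by ring
  have hJ : J ≤ (2 * lam).size * J := Nat.le_mul_of_pos_left _ hb
  have h2 : 2 * lam < 2 ^ W := (Nat.lt_size_self _).trans_le
    (Nat.pow_le_pow_right (by norm_num) (by omega))
  have h16 : 16 < 2 ^ W := (show 16 < 2 ^ 5 by norm_num).trans_le
    (Nat.pow_le_pow_right (by norm_num) (by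
      have : 2 ≤ (2 * lam).size := Nat.lt_size.2 (by omega)
      omega))
  have hls : lam.size < 2 ^ W := by
    have : lam.size ≤ (2 * lam).size := Nat.size_le_size (by omega)
    exact (show lam.size ≤ W by omega).trans_lt Nat.lt_two_pow_self
  rw [randomPrime]
  refine (sat_len hB (by omega)).bind (by omega) ?_
  rintro _ rfl
  refine (sat_mul hB hls (by omega)).bind (by omega) ?_
  rintro _ rfl
  refine (sat_mul hB h16 (by omega)).bind (by omega) ?_
  rintro _ rfl
  refine (sat_len hB (by omega)).bind (by omega) ?_
  rintro _ rfl
  have hsz : (16 * (lam.size * w)).size ≤ 16 * (lam.size * w) := Nat.size_le.2 Nat.lt_two_pow_self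
  refine (sat_add hB (by omega) (by omega)).bind (by omega) ?_
  rintro _ rfl
  refine (sat_add hB (by omega) (by omega)).bind (by omega) ?_
  rintro _ rfl
  refine (sat_candidate hB (by omega) hW).bind (by omega) ?_
  rintro M ⟨q, h1, h2, hM⟩
  exact (sat_primeLoop hB (by omega) hW (by omega) _ (by omega) M 0 (by omega) h1 h2 hM).mono
    (by omega) fun M' hM' => hM'.1

/-- The first candidate is returned if it is prime; otherwise the expectation is bounded by `u0`. -/
theorem mean_randomPrime_le (hB : Budget I W J) (hlam : 3 ≤ lam) (hW : 4 * (2 * lam).size ≤ W)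
    {w : ℕ} (hR : 16 * (lam.size * w) + w + 2 < 2 ^ W) (f : Modulus → ℝ) (g : ℕ → ℝ)
    (hfg : ∀ q M, lam ≤ q → ModSetup I W J q M → q.Prime → f M = g q) {u0 : ℝ}
    (hu0 : ∀ q M, lam ≤ q → q ≤ 2 * lam → ModSetup I W J q M → ¬q.Prime →
      mean (primeLoop I lam ((16 * (lam.size * w)).size + w + 1) (16 * (lam.size * w)) M 0) f
        ≤ u0) :
    mean (randomPrime I lam w) f ≤
      (∑ q ∈ Finset.Icc lam (2 * lam), if q.Prime then g q else u0) / (lam + 1) := by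
  have hb : 0 < (2 * lam).size := Nat.size_pos.2 (by omega)
  have h2 : 2 * lam < 2 ^ W := (Nat.lt_size_self _).trans_le
    (Nat.pow_le_pow_right (by norm_num) (by omega))
  have h16 : 16 < 2 ^ W := (show 16 < 2 ^ 5 by norm_num).trans_le
    (Nat.pow_le_pow_right (by norm_num) (by
      have : 2 ≤ (2 * lam).size := Nat.lt_size.2 (by omega)
      omega))
  have hls : lam.size < 2 ^ W := by
    have : lam.size ≤ (2 * lam).size := Nat.size_le_size (by omega)
    exact (show lam.size ≤ W by omega).trans_lt Nat.lt_two_pow_self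
  rw [randomPrime]
  simp only [mean_bind]
  refine mean_le (sat_len hB (by omega)) ?_
  rintro _ rfl
  refine mean_le (sat_mul hB hls (by omega)) ?_
  rintro _ rfl
  refine mean_le (sat_mul hB h16 (by omega)) ?_
  rintro _ rfl
  refine mean_le (sat_len hB (by omega)) ?_
  rintro _ rfl
  have hsz : (16 * (lam.size * w)).size ≤ 16 * (lam.size * w) := Nat.size_le.2 Nat.lt_two_pow_self
  refine mean_le (sat_add hB (by omega) (by omega)) ?_
  rintro _ rfl
  refine mean_le (sat_add hB (by omega) (by omega)) ?_
  rintro _ rfl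
  refine mean_candidate_le hB (by omega) hW _ _ fun q M h1 h2 hM => ?_
  split_ifs with hqp
  · rw [← hfg q M h1 hM hqp]
    exact mean_le (sat_primeLoop hB (by omega) hW (by omega) _ (by omega) M 0 (by omega) h1 h2 hM)
      fun M' hM' => by rw [hM'.2 hqp]
  · exact hu0 q M h1 h2 hM hqp

open Classical in
/-- With `t = R.size + w + 1` required rounds and `R = 16 * lam.size * w` rounds in all, the drawn
number is composite with probability at most `2 ^ (-w)`: the hypothesis on the number of primes says
that the proportion of primes is about `1 / (2 * lam.size)` at least, so that `R` rounds are likely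
to meet a prime. -/
theorem mean_randomPrime_composite_le (hB : Budget I W J) (hlam : 21 ≤ lam)
    (hW : 4 * (2 * lam).size ≤ W) {w : ℕ} (hw : 1 ≤ w)
    (hR : 16 * (lam.size * w) + w + 2 < 2 ^ W)
    (hπ : 8 * lam ≤ 15 * (primesIn lam).card * Nat.log 2 lam) :
    mean (randomPrime I lam w) (fun M => if M.q.Prime then 0 else 1) ≤ 1 / 2 ^ w := by
  set R := 16 * (lam.size * w) with hRdef
  set ρ : ℝ := (primesIn lam).card / (lam + 1) with hρ
  have hρ0 : 0 ≤ ρ := by positivity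
  have hρ1 : ρ ≤ 1 := by
    rw [hρ, div_le_one (by positivity)]
    exact_mod_cast card_primesIn_le lam
  have hsz : R.size ≤ R := Nat.size_le.2 Nat.lt_two_pow_self
  have hU : 0 ≤ (2 : ℝ) ^ 0 / 2 ^ (R.size + w + 1) + R / 2 ^ (R.size + w + 1)
      + (1 - ρ / 2) ^ R := by
    have : 0 ≤ 1 - ρ / 2 := by linarith
    positivity
  refine (mean_randomPrime_le hB (by omega) hW hR _ (fun _ => 0)
    (fun q M _ hM hqp => by rw [hM.hq, if_pos hqp])
    fun q M h1 _ hM hqp => mean_primeLoop_composite_le hB (by omega) hW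
      (t := R.size + w + 1) (by omega) R (by omega) M 0
      (by omega) h1 hM hqp).trans ?_
  rw [sum_Icc_ite_prime, ← hρ]
  have hl : (0 : ℝ) < lam + 1 := by positivity
  -- The number `t` of required rounds makes it unlikely that one of at most `R + 1` composite
  -- candidates is accepted.
  have h1 : (2 : ℝ) ^ 0 / 2 ^ (R.size + w + 1) + R / 2 ^ (R.size + w + 1) ≤ 1 / 2 ^ w / 2 := by
    rw [← add_div, pow_zero, add_assoc, pow_add, div_div, ← pow_succ,
      div_le_div_iff₀ (by positivity) (by positivity)]
    have : (1 : ℝ) + R ≤ 2 ^ R.size := by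
      have := Nat.lt_size_self R
      exact_mod_cast (show 1 + R ≤ 2 ^ R.size by omega)
    have h3 : (0 : ℝ) < 2 ^ (w + 1) := by positivity
    nlinarith
  -- The number `R` of rounds makes it unlikely that no prime is met, since `R * ρ / 2 ≥ 4 * w`.
  have h2 : (1 - ρ / 2) ^ R ≤ 1 / 2 ^ w / 2 := by
    have hbρ : 1 / 2 ≤ lam.size * ρ := by
      have h3 : Nat.log 2 lam ≤ lam.size := by
        rcases Nat.eq_zero_or_pos lam with h | h
        · omega
        · exact (Nat.lt_size.2 (Nat.pow_log_le_self 2 h.ne')).le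
      have h4 : 8 * lam ≤ 15 * (primesIn lam).card * lam.size :=
        hπ.trans (Nat.mul_le_mul_left _ h3)
      have h5 : (8 : ℝ) * lam ≤ 15 * (primesIn lam).card * lam.size := by exact_mod_cast h4
      have h6 : (21 : ℝ) ≤ lam := by exact_mod_cast hlam
      rw [hρ, ← mul_div_assoc, le_div_iff₀ hl]
      nlinarith
    calc (1 - ρ / 2) ^ R ≤ Real.exp (-(ρ / 2)) ^ R := by
          gcongr
          · linarith
          · have := Real.add_one_le_exp (-(ρ / 2)); linarith
      _ = Real.exp (-(8 * (lam.size * ρ) * w)) := by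
          rw [← Real.exp_nat_mul, hRdef]
          congr 1
          push_cast
          ring
      _ ≤ Real.exp (-((w : ℝ) + 1)) := by
          gcongr
          have : (1 : ℝ) ≤ w := by exact_mod_cast hw
          nlinarith
      _ = 1 / Real.exp 1 ^ (w + 1) := by
          rw [← Real.exp_nat_mul, Real.exp_neg, one_div]
          push_cast
          rw [mul_one]
      _ ≤ 1 / 2 ^ (w + 1) := by
          gcongr
          have := Real.add_one_le_exp 1
          linarith
      _ = 1 / 2 ^ w / 2 := by rw [div_div, ← pow_succ]
  rw [div_le_iff₀ hl]
  have h3 : (1 : ℝ) / 2 ^ w / 2 + 1 / 2 ^ w / 2 = 1 / 2 ^ w := by ring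
  have h4 : ((lam : ℝ) + 1 - (primesIn lam).card) ≤ lam + 1 := by
    have : (0 : ℝ) ≤ (primesIn lam).card := by positivity
    linarith
  simp only [Finset.sum_const_zero, zero_add]
  rw [mul_comm (1 / 2 ^ w)]
  exact mul_le_mul h4 (by linarith) hU hl.le

open Classical in
theorem mean_randomPrime_mem_le (hB : Budget I W J) (hlam : 3 ≤ lam)
    (hW : 4 * (2 * lam).size ≤ W) {w : ℕ} (hR : 16 * (lam.size * w) + w + 2 < 2 ^ W)
    (s : Finset ℕ) (hs : s ⊆ primesIn lam) (hne : 0 < (primesIn lam).card) :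
    mean (randomPrime I lam w) (fun M => if M.q ∈ s then 1 else 0) ≤
      s.card / (primesIn lam).card := by
  have hsz : (16 * (lam.size * w)).size ≤ 16 * (lam.size * w) := Nat.size_le.2 Nat.lt_two_pow_self
  refine (mean_randomPrime_le hB hlam hW hR _ (fun q => if q ∈ s then 1 else 0)
    (fun q M _ hM hqp => by rw [hM.hq])
    fun q M h1 _ hM hqp => mean_primeLoop_mem_le hB hlam hW (by omega) s hs hne _ (by omega) M 0
      (by omega) h1 hM hqp).trans (le_of_eq ?_)
  rw [sum_Icc_ite_prime]
  have : (lam : ℝ) + 1 ≠ 0 := by positivity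
  have : ((primesIn lam).card : ℝ) ≠ 0 := by positivity
  have h3 : ∑ q ∈ primesIn lam, (if q ∈ s then (1 : ℝ) else 0) = s.card := by
    rw [← Finset.sum_filter, Finset.filter_mem_eq_inter, Finset.inter_eq_right.2 hs]
    simp
  rw [h3]
  field_simp
  ring

end RandomPrime

/-! ### The number of primes between `n` and `2 n` -/

/-- Only small primes, primes up to `2 n / 3` and primes between `n` and `2 n` divide the central
binomial coefficient, and a prime above `√(2 n)` divides it at most once. -/
theorem centralBinom_le_mul_pow_card_primesIn {n : ℕ} (hn : 2 < n) :
    n.centralBinom ≤ (2 * n) ^ (Nat.primeCounting (2 * n).sqrt) * 4 ^ (2 * n / 3) *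
      (2 * n) ^ (primesIn n).card := by
  have h2n : 1 ≤ 2 * n := by omega
  set T := (Finset.range (2 * n + 1)).filter Nat.Prime with hT
  have hprod : n.centralBinom = ∏ p ∈ T, p ^ n.centralBinom.factorization p := by
    conv_lhs => rw [← n.prod_pow_factorization_centralBinom]
    rw [hT, Finset.prod_filter_of_ne]
    intro p _ h
    by_contra hp
    exact h (by rw [Nat.factorization_eq_zero_of_not_prime _ hp, pow_zero])
  have hle : ∀ p ∈ T, p ^ n.centralBinom.factorization p ≤
      (if p ≤ (2 * n).sqrt then 2 * n else 1) * (if p ≤ 2 * n / 3 then p else 1) *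
        (if n ≤ p then 2 * n else 1) := by
    intro p hp
    rw [hT, Finset.mem_filter, Finset.mem_range] at hp
    have hpos := hp.2.pos
    have h1 : 1 ≤ (if p ≤ (2 * n).sqrt then 2 * n else 1) := by split_ifs <;> omega
    have h2 : 1 ≤ (if p ≤ 2 * n / 3 then p else 1) := by split_ifs <;> omega
    have h3 : 1 ≤ (if n ≤ p then 2 * n else 1) := by split_ifs <;> omega
    have hpow : p ^ n.centralBinom.factorization p ≤ 2 * n :=
      Nat.pow_factorization_choose_le (by omega)
    by_cases hs : p ≤ (2 * n).sqrt
    · rw [if_pos hs, mul_assoc]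
      exact hpow.trans (Nat.le_mul_of_pos_right _ (Nat.mul_pos h2 h3))
    by_cases hn' : n ≤ p
    · rw [if_pos hn']
      exact hpow.trans (Nat.le_mul_of_pos_left _ (Nat.mul_pos h1 h2))
    by_cases h4 : p ≤ 2 * n / 3
    · rw [if_pos h4]
      have hone : n.centralBinom.factorization p ≤ 1 :=
        Nat.factorization_choose_le_one (by rw [not_le, Nat.sqrt_lt'] at hs; exact hs)
      calc p ^ n.centralBinom.factorization p ≤ p ^ 1 := Nat.pow_le_pow_right hpos hone
        _ = p := pow_one p
        _ ≤ _ := (Nat.le_mul_of_pos_left _ h1).trans (Nat.le_mul_of_pos_right _ h3)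
    · rw [Nat.factorization_centralBinom_of_two_mul_self_lt_three_mul hn (by omega) (by omega),
        pow_zero]
      exact Nat.mul_pos (Nat.mul_pos h1 h2) h3
  rw [hprod]
  refine (Finset.prod_le_prod' hle).trans ?_
  rw [Finset.prod_mul_distrib, Finset.prod_mul_distrib, ← Finset.prod_filter, ← Finset.prod_filter,
    ← Finset.prod_filter, Finset.prod_const, Finset.prod_const]
  gcongr
  · rw [← Nat.primesLE_card_eq_primeCounting]
    refine Finset.card_le_card fun p hp => ?_
    simp only [hT, Finset.mem_filter] at hp
    exact Nat.mem_primesLE.2 ⟨hp.2, hp.1.2⟩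
  · refine le_trans ?_ (primorial_le_four_pow (2 * n / 3))
    rw [primorial_eq_prod_primesLE]
    refine Finset.prod_le_prod_of_subset_of_one_le' (fun p hp => ?_) fun p hp _ => ?_
    · simp only [hT, Finset.mem_filter] at hp
      exact Nat.mem_primesLE.2 ⟨hp.2, hp.1.2⟩
    · exact (Nat.mem_primesLE.1 hp).2.one_lt.le
  · intro p hp
    simp only [hT, Finset.mem_filter, Finset.mem_range] at hp
    rw [primesIn, Finset.mem_filter, Finset.mem_Icc]
    exact ⟨⟨hp.2, by omega⟩, hp.1.2⟩

/-- Primes above `6` are prime to `6`. -/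
theorem primeCounting_le_div_three_add {s : ℕ} (hs : 6 ≤ s) : Nat.primeCounting s ≤ s / 3 + 3 := by
  obtain ⟨m, rfl⟩ := Nat.exists_eq_add_of_le hs
  have h1 := Nat.primeCounting_add_le (a := 6) (k := 6) (by norm_num) le_rfl m
  have h2 : Nat.primeCounting 6 = 3 := by decide
  have h3 : Nat.totient 6 = 2 := by decide
  rw [h2, h3] at h1
  omega

/-- The bound for the central binomial coefficient, compared with `4 ^ n < n * centralBinom n` in
terms of base-2 logarithms, with `n < 2 ^ (k + 1)` and `s = ⌊√(2 n)⌋`. -/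
theorem card_primesIn_of_large {n : ℕ} (hn : 2 ^ 15 ≤ n) :
    8 * n ≤ 15 * (primesIn n).card * Nat.log 2 n := by
  set k := Nat.log 2 n with hk
  set s := (2 * n).sqrt with hs
  set c := (primesIn n).card
  set r := Nat.primeCounting s
  have hk15 : 15 ≤ k := Nat.le_log_of_pow_le (by norm_num) hn
  have hkn : 2 ^ k ≤ n := Nat.pow_log_le_self 2 (by omega)
  have hnk : n < 2 ^ (k + 1) := Nat.lt_pow_succ_log_self (by norm_num) n
  have hs1 : s * s ≤ 2 * n := Nat.sqrt_le _
  have hs2 : 2 * n < (s + 1) * (s + 1) := Nat.lt_succ_sqrt _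
  have hpow : 289 * (k * k) ≤ 2 ^ (k + 1) := by
    clear_value k
    clear hk hkn hnk
    induction k, hk15 using Nat.le_induction with
    | base => norm_num
    | succ k hk ih => rw [pow_succ]; nlinarith
  have hs17 : 17 * k ≤ s := by
    by_contra! h
    have h1 : (s + 1) * (s + 1) ≤ (17 * k) * (17 * k) := Nat.mul_le_mul h h
    have h2 : 2 ^ (k + 1) ≤ 2 * n := by rw [pow_succ]; omega
    have h3 : (17 * k) * (17 * k) = 289 * (k * k) := by ring
    omega
  have hr : r ≤ s / 3 + 3 := primeCounting_le_div_three_add (by omega)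
  have hmain : 2 * n < (k + 1) + (k + 2) * r + 2 * (2 * n / 3) + (k + 2) * c := by
    have h1 := Nat.four_pow_lt_mul_centralBinom n (by omega)
    have h2 := centralBinom_le_mul_pow_card_primesIn (n := n) (by omega)
    have h3 : 2 * n ≤ 2 ^ (k + 2) := by rw [pow_succ]; omega
    have h4 : 2 ^ (2 * n) < 2 ^ ((k + 1) + (k + 2) * r + 2 * (2 * n / 3) + (k + 2) * c) := by
      calc 2 ^ (2 * n) = 4 ^ n := by rw [pow_mul]; norm_num
        _ < n * n.centralBinom := h1
        _ ≤ 2 ^ (k + 1) * ((2 ^ (k + 2)) ^ r * (2 ^ 2) ^ (2 * n / 3) * (2 ^ (k + 2)) ^ c) := by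
            refine Nat.mul_le_mul hnk.le (h2.trans ?_)
            gcongr
            norm_num
        _ = _ := by
            rw [← pow_mul, ← pow_mul, ← pow_mul, ← pow_add, ← pow_add, ← pow_add]
            congr 1
            ring
    exact (Nat.pow_lt_pow_iff_right (by norm_num)).1 h4
  have h1 : 2 * n ≤ 3 * ((k + 1) + (k + 2) * r + (k + 2) * c) := by omega
  have h2 : 3 * r ≤ s + 9 := by omega
  -- Everything is now a polynomial inequality in `k ≥ 15` and `s ≥ 17 k`.
  have h3 : 85 * (k * (s + 12)) ≤ 7 * (s * s) := by nlinarith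
  have h4 : 5 * (k * (k + 2) * (s + 12)) ≤ (k - 8) * (s * s) := by
    clear_value k
    clear hk hkn hnk hpow hmain h1
    obtain ⟨j, rfl⟩ := Nat.exists_eq_add_of_le hk15
    have h5 : 15 + j - 8 = 7 + j := by omega
    rw [h5]
    nlinarith [Nat.zero_le (j * (s * s)), Nat.zero_le (j * ((15 + j) * (s + 12)))]
  have h5 : (k - 8) * (s * s) ≤ (k - 8) * (2 * n) := Nat.mul_le_mul_left _ hs1
  have h6 : 8 * n * (k + 2) ≤ 15 * c * k * (k + 2) := by
    obtain ⟨j, hj⟩ := Nat.exists_eq_add_of_le (show 8 ≤ k by omega)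
    have h7 : k - 8 = j := by omega
    rw [h7] at h4 h5
    have h8 : (5 * k) * (2 * n) ≤ (5 * k) * (3 * ((k + 1) + (k + 2) * r + (k + 2) * c)) :=
      Nat.mul_le_mul_left _ h1
    have h9 : (5 * k * (k + 2)) * (3 * r) ≤ (5 * k * (k + 2)) * (s + 9) :=
      Nat.mul_le_mul_left _ h2
    have h10 : 8 * n * (k + 2) + j * (2 * n) = 10 * (k * n) := by rw [hj]; ring
    nlinarith
  exact Nat.le_of_mul_le_mul_right h6 (by omega)

/-- The number of `x ≤ hi` among `s, s + 2, …, s + 2 (2 ^ d - 1)` that are prime to `F`. -/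
def coprimeCount (F hi : ℕ) : (d : ℕ) → (s : ℕ) → ℕ
  | 0, s => cond (Nat.ble s hi) (cond (Nat.beq (Nat.gcd s F) 1) 1 0) 0
  | d + 1, s => cond (Nat.ble s hi)
      (coprimeCount F hi d s + coprimeCount F hi d (s + 2 * 2 ^ d)) 0

theorem coprimeCount_le (F hi d s : ℕ) : coprimeCount F hi d s ≤
    ((Finset.Ico s (s + 2 * 2 ^ d)).filter fun x => x ≤ hi ∧ Nat.gcd x F = 1).card := by
  induction d generalizing s with
  | zero =>
    rw [coprimeCount]
    rcases h : Nat.ble s hi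
    · exact Nat.zero_le _
    rcases h' : Nat.beq (Nat.gcd s F) 1
    · exact Nat.zero_le _
    · refine Finset.card_pos.2 ⟨s, ?_⟩
      rw [Finset.mem_filter, Finset.mem_Ico]
      exact ⟨by omega, Nat.le_of_ble_eq_true h, Nat.eq_of_beq_eq_true h'⟩
  | succ d ih =>
    rw [coprimeCount]
    rcases h : Nat.ble s hi
    · exact Nat.zero_le _
    · refine (Nat.add_le_add (ih _) (ih _)).trans ?_
      rw [← Finset.card_union_of_disjoint, ← Finset.filter_union]
      · refine Finset.card_le_card (Finset.filter_subset_filter _ fun x hx => ?_)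
        rw [Finset.mem_union, Finset.mem_Ico, Finset.mem_Ico] at hx
        rw [Finset.mem_Ico, pow_succ]
        omega
      · refine Finset.disjoint_filter_filter (Finset.disjoint_left.2 fun x hx hx' => ?_)
        rw [Finset.mem_Ico] at hx hx'
        omega

/-- The product of the primes below `256`. -/
def primorial256 : ℕ :=
  64266330917908644872330635228106713310880186591609208114244758680898150367880703152525200743234420230

theorem prime_of_gcd_eq_one {F m x : ℕ} (hF : ∀ p < m, p.Prime → p ∣ F) (h1 : 1 < x)
    (h2 : x < m ^ 2) (hx : Nat.gcd x F = 1) : x.Prime := by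
  by_contra hp
  have h3 : x.minFac ^ 2 ≤ x := Nat.minFac_sq_le_self (by omega) hp
  have h4 : x.minFac < m := lt_of_pow_lt_pow_left₀ 2 (Nat.zero_le _) (h3.trans_lt h2)
  have h6 := Nat.minFac_prime (show x ≠ 1 by omega)
  have h7 := Nat.dvd_gcd (Nat.minFac_dvd x) (hF _ h4 h6)
  rw [hx] at h7
  exact h6.one_lt.ne' (Nat.dvd_one.1 h7)

/-- If the condition holds, then for every `n` of `[a, b]` the primes of `[b, 2 a]` suffice, where
primality is tested by the greatest common divisor with `F`. -/
def intervalCheck (F a b : ℕ) : Bool :=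
  Nat.ble (8 * b) (15 * coprimeCount F (2 * a) 15 (2 * (b / 2) + 1) * Nat.log2 a)

theorem card_primesIn_of_intervalCheck {F m a b n : ℕ} (hF : ∀ p < m, p.Prime → p ∣ F)
    (h : intervalCheck F a b = true) (ha : 2 ≤ a) (hb : 2 * a < m ^ 2) (han : a ≤ n)
    (hnb : n ≤ b) : 8 * n ≤ 15 * (primesIn n).card * Nat.log 2 n := by
  have h1 := Nat.le_of_ble_eq_true h
  refine (Nat.mul_le_mul_left 8 hnb).trans (h1.trans ?_)
  rw [Nat.log2_eq_log_two]
  refine Nat.mul_le_mul (Nat.mul_le_mul_left _ ?_) (Nat.log_mono_right han)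
  refine (coprimeCount_le _ _ _ _).trans (Finset.card_le_card fun x hx => ?_)
  rw [Finset.mem_filter, Finset.mem_Ico] at hx
  rw [primesIn, Finset.mem_filter, Finset.mem_Icc]
  exact ⟨by omega, prime_of_gcd_eq_one hF (by omega) (by omega) hx.2.2⟩

/-- Intervals that cover the numbers from `21` to `196`. -/
def smallGrid : List (ℕ × ℕ) :=
  [(21, 29), (30, 37), (38, 53), (54, 73), (74, 101), (102, 139), (140, 196)]

/-- Intervals that cover the numbers from `197` to `2 ^ 15 - 1`. -/
def largeGrid : List (ℕ × ℕ) :=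
  [(197, 269), (270, 375), (376, 523), (524, 742), (743, 1033), (1034, 1471), (1472, 2081),
    (2082, 2971), (2972, 4211), (4212, 6029), (6030, 8539), (8540, 12263), (12264, 17443),
    (17444, 25087), (25088, 32767)]

/-- The remaining cases are checked on intervals, by counting primes. -/
theorem card_primesIn_of_small {n : ℕ} (h1 : 21 ≤ n) (h2 : n < 2 ^ 15) :
    8 * n ≤ 15 * (primesIn n).card * Nat.log 2 n := by
  rcases lt_or_ge n 197 with hn | hn
  · -- `30030` is the product of the primes below `17`.
    have hF : ∀ p < 17, p.Prime → p ∣ 30030 := by decide +kernel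
    have hcheck : ∀ c ∈ smallGrid,
        intervalCheck 30030 c.1 c.2 = true ∧ 2 ≤ c.1 ∧ 2 * c.1 < 17 ^ 2 := by decide +kernel
    obtain ⟨c, hc, hc1, hc2⟩ : ∃ c ∈ smallGrid, c.1 ≤ n ∧ n ≤ c.2 := by
      by_contra! hcon
      simp only [smallGrid, List.forall_mem_cons] at hcon
      omega
    have := hcheck c hc
    exact card_primesIn_of_intervalCheck hF this.1 this.2.1 this.2.2 hc1 hc2
  · have hF : ∀ p < 256, p.Prime → p ∣ primorial256 := by decide +kernel
    have hcheck : ∀ c ∈ largeGrid,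
        intervalCheck primorial256 c.1 c.2 = true ∧ 2 ≤ c.1 ∧ 2 * c.1 < 256 ^ 2 := by
      decide +kernel
    obtain ⟨c, hc, hc1, hc2⟩ : ∃ c ∈ largeGrid, c.1 ≤ n ∧ n ≤ c.2 := by
      by_contra! hcon
      simp only [largeGrid, List.forall_mem_cons] at hcon
      omega
    have := hcheck c hc
    exact card_primesIn_of_intervalCheck hF this.1 this.2.1 this.2.2 hc1 hc2

/-- A bound of Chebyshev's type for the number of primes between `n` and `2 n`. -/
theorem le_card_primesIn_mul_log {n : ℕ} (hn : 21 ≤ n) :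
    8 * n ≤ 15 * (primesIn n).card * Nat.log 2 n := by
  rcases lt_or_ge n (2 ^ 15) with h | h
  · exact card_primesIn_of_small hn h
  · exact card_primesIn_of_large h

/-! ### The residues of `X ^ i F` modulo `P` -/

section ShiftMod

variable {R : Type*} [CommRing R]

/-- The remainder of `X ^ i F` modulo `P`. -/
noncomputable def shiftMod (P F : R[X]) (i : ℕ) : R[X] := (X ^ i * F) %ₘ P

/-- The coefficient of degree `n - 1` of `X ^ i F` modulo the polynomial `P` of degree `n`. -/
noncomputable def leadCoef (P F : R[X]) (i : ℕ) : R := (shiftMod P F i).coeff (P.natDegree - 1)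

/-- The contributions of the first `i` steps of the recursion for `leadCoef P F j`. -/
noncomputable def partialLead (P F : R[X]) (i j : ℕ) : R :=
  F.coeff (P.natDegree - 1 - j) -
    ∑ l ∈ Finset.range (min i j), leadCoef P F l * P.coeff (P.natDegree - j + l)

variable {P F G : R[X]}

theorem shiftMod_zero (hP : P.Monic) (hF : F.degree < P.natDegree) : shiftMod P F 0 = F := by
  nontriviality R
  rw [shiftMod, pow_zero, one_mul, modByMonic_eq_self_iff hP,
    degree_eq_natDegree hP.ne_zero]
  exact hF

theorem shiftMod_succ (hP : P.Monic) (hn : 0 < P.natDegree) (i : ℕ) :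
    shiftMod P F (i + 1) = X * shiftMod P F i - C (leadCoef P F i) * P := by
  nontriviality R
  have hS : (shiftMod P F i).degree < P.degree := degree_modByMonic_lt _ hP
  refine (div_modByMonic_unique (X * ((X ^ i * F) /ₘ P) + C (leadCoef P F i)) _ hP ⟨?_, ?_⟩).2
  · have h1 := modByMonic_add_div (X ^ i * F) P
    rw [shiftMod, pow_succ]
    linear_combination X * h1
  · rw [degree_eq_natDegree hP.ne_zero] at hS ⊢
    rw [degree_lt_iff_coeff_zero] at hS ⊢
    intro m hm
    obtain ⟨m, rfl⟩ := Nat.exists_eq_add_of_lt (show 0 < m by omega)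
    rw [zero_add] at hm ⊢
    rw [coeff_sub, coeff_X_mul, coeff_C_mul]
    rcases hm.lt_or_eq with h | h
    · rw [hS m (by omega), coeff_eq_zero_of_natDegree_lt h]
      simp
    · rw [← h, hP.coeff_natDegree, leadCoef, h, Nat.add_sub_cancel]
      simp

/-- The recursion of `shiftMod_succ`, unrolled. -/
theorem shiftMod_eq_sub_sum (hP : P.Monic) (hn : 0 < P.natDegree) (hF : F.degree < P.natDegree)
    (i : ℕ) : shiftMod P F i =
      X ^ i * F - ∑ j ∈ Finset.range i, C (leadCoef P F j) * (X ^ (i - 1 - j) * P) := by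
  induction i with
  | zero => simp [shiftMod_zero hP hF]
  | succ i ih =>
    rw [shiftMod_succ hP hn, ih, Finset.sum_range_succ, mul_sub, Finset.mul_sum]
    have : ∀ j ∈ Finset.range i, X * (C (leadCoef P F j) * (X ^ (i - 1 - j) * P)) =
        C (leadCoef P F j) * (X ^ (i + 1 - 1 - j) * P) := by
      intro j hj
      rw [Finset.mem_range] at hj
      have h1 : i + 1 - 1 - j = (i - 1 - j) + 1 := by omega
      rw [h1, pow_succ]
      ring
    rw [Finset.sum_congr rfl this]
    simp only [Nat.add_sub_cancel, Nat.sub_self, pow_zero, one_mul, pow_succ]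
    ring

/-- The sum defining `leadCoef P F j` is complete after `j` steps, since later residues contribute only
to larger indices. -/
theorem partialLead_of_le (hP : P.Monic) (hF : F.degree < P.natDegree) {i j : ℕ}
    (hij : j ≤ i) (hj : j < P.natDegree) : partialLead P F i j = leadCoef P F j := by
  conv_rhs => rw [leadCoef, shiftMod_eq_sub_sum hP (by omega) hF]
  rw [partialLead, min_eq_right hij, coeff_sub, finsetSum_coeff, coeff_X_pow_mul',
    if_pos (by omega)]
  congr 1
  refine Finset.sum_congr rfl fun l hl => ?_
  rw [Finset.mem_range] at hl
  rw [coeff_C_mul, coeff_X_pow_mul', if_pos (by omega)]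
  congr 2
  omega

theorem partialLead_succ (i j : ℕ) : partialLead P F (i + 1) j =
    partialLead P F i j - if i < j then leadCoef P F i * P.coeff (P.natDegree - j + i) else 0 := by
  rw [partialLead, partialLead]
  split_ifs with h
  · rw [min_eq_left (by omega), min_eq_left (by omega), Finset.sum_range_succ]
    ring
  · rw [min_eq_right (by omega), min_eq_right (by omega), sub_zero]

theorem partialLead_zero (j : ℕ) : partialLead P F 0 j = F.coeff (P.natDegree - 1 - j) := by
  simp [partialLead]

theorem eval_shiftMod_succ (hP : P.Monic) (hn : 0 < P.natDegree) (a : R) (i : ℕ) :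
    eval a (shiftMod P F (i + 1)) =
      a * eval a (shiftMod P F i) - leadCoef P F i * eval a P := by
  rw [shiftMod_succ hP hn]
  simp

/-- The product modulo `P` is evaluated without being computed: it is a combination of the residues
`X ^ i F` modulo `P`, whose values satisfy the recursion of `eval_shiftMod_succ`. -/
theorem eval_mul_modByMonic (hG : G.degree < P.natDegree) (a : R) :
    eval a ((F * G) %ₘ P) =
      ∑ i ∈ Finset.range P.natDegree, G.coeff i * eval a (shiftMod P F i) := by
  rcases eq_or_ne G 0 with rfl | h0
  · simp
  have hsum : F * G = ∑ i ∈ Finset.range P.natDegree, G.coeff i • (X ^ i * F) := by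
    conv_lhs => rw [G.as_sum_range' P.natDegree ((natDegree_lt_iff_degree_lt h0).2 hG)]
    rw [Finset.mul_sum]
    refine Finset.sum_congr rfl fun i _ => ?_
    rw [← C_mul_X_pow_eq_monomial, smul_eq_C_mul]
    ring
  rw [hsum, ← modByMonicHom_apply, map_sum, eval_finsetSum]
  refine Finset.sum_congr rfl fun i _ => ?_
  rw [map_smul, eval_smul, smul_eq_mul, modByMonicHom_apply, shiftMod]

end ShiftMod

/-! ### Reduction of the inputs and evaluation at a point -/

/-- The terms of the list are those of `F`, with reduced coefficients. -/
structure SparseRep (q : ℕ) (l : List (ℕ × ℕ)) (F : (ZMod q)[X]) : Prop where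
  nodup : (l.map Prod.fst).Nodup
  mem_iff : ∀ e c, (e, c) ∈ l ↔ F.coeff e ≠ 0 ∧ Rep q c (F.coeff e)

/-- The coefficient of degree `k` of a polynomial that is given by the list of its terms. -/
def coefAt (q : ℕ) (l : List (ℕ × ℕ)) (k : ℕ) : ZMod q :=
  (l.map fun t => if t.1 = k then (t.2 : ZMod q) else 0).sum

section SparseRep

variable {q : ℕ} {l : List (ℕ × ℕ)} {F : (ZMod q)[X]}

theorem SparseRep.toFinset (h : SparseRep q l F) (hq : 0 < q) :
    (l.map Prod.fst).toFinset = F.support := by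
  ext e
  simp only [List.mem_toFinset, List.mem_map, Prod.exists, exists_and_right, exists_eq_right,
    mem_support_iff]
  constructor
  · rintro ⟨c, hc⟩
    exact ((h.mem_iff e c).1 hc).1
  · intro he
    have : NeZero q := ⟨hq.ne'⟩
    exact ⟨(F.coeff e).val, (h.mem_iff e _).2 ⟨he, ZMod.val_lt _, by simp⟩⟩

theorem SparseRep.length_eq (h : SparseRep q l F) (hq : 0 < q) : l.length = F.support.card := by
  rw [← h.toFinset hq, List.toFinset_card_of_nodup h.nodup, List.length_map]

theorem SparseRep.sum_map (h : SparseRep q l F) (hq : 0 < q) {A : Type*} [AddCommMonoid A]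
    (g : ℕ → ZMod q → A) :
    (l.map fun t => g t.1 (t.2 : ZMod q)).sum = ∑ e ∈ F.support, g e (F.coeff e) := by
  rw [← h.toFinset hq, List.sum_toFinset _ h.nodup, List.map_map]
  congr 1
  refine List.map_congr_left fun t ht => ?_
  rw [((h.mem_iff t.1 t.2).1 ht).2.2]
  rfl

theorem SparseRep.coefAt_eq (h : SparseRep q l F) (hq : 0 < q) (k : ℕ) :
    coefAt q l k = F.coeff k := by
  rw [coefAt, h.sum_map hq (fun e z => if e = k then z else 0)]
  simp only [Finset.sum_ite_eq', mem_support_iff, ite_not, ite_eq_right_iff]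
  exact fun h => h.symm

theorem SparseRep.sum_eval (h : SparseRep q l F) (hq : 0 < q) (a : ZMod q) :
    (l.map fun t => (t.2 : ZMod q) * a ^ t.1).sum = eval a F := by
  rw [h.sum_map hq (fun e z => z * a ^ e), eval_eq_sum, Polynomial.sum]

theorem SparseRep.lt (h : SparseRep q l F) {t : ℕ × ℕ} (ht : t ∈ l) : t.2 < q :=
  ((h.mem_iff t.1 t.2).1 ht).2.1

theorem SparseRep.coeff_ne_zero (h : SparseRep q l F) {t : ℕ × ℕ} (ht : t ∈ l) :
    F.coeff t.1 ≠ 0 :=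
  ((h.mem_iff t.1 t.2).1 ht).1

theorem coefAt_cons (t : ℕ × ℕ) (k : ℕ) :
    coefAt q (t :: l) k = (if t.1 = k then (t.2 : ZMod q) else 0) + coefAt q l k := by
  simp [coefAt]

theorem coefAt_eq_zero {k : ℕ} (h : ∀ t ∈ l, t.1 ≠ k) : coefAt q l k = 0 := by
  rw [coefAt]
  refine List.sum_eq_zero fun z hz => ?_
  obtain ⟨t, ht, rfl⟩ := List.mem_map.1 hz
  rw [if_neg (h t ht)]

/-- The list of a monic polynomial by decreasing exponents starts with its leading term. -/
theorem SparseRep.eq_cons {P : (ZMod q)[X]} (h : SparseRep q l P) (hq : 2 ≤ q)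
    (hs : (l.map Prod.fst).Pairwise (· > ·)) (hP : P.Monic) :
    ∃ c Pt, l = (P.natDegree, c) :: Pt ∧ (∀ t ∈ Pt, t.1 < P.natDegree ∧ t.2 < q) ∧
      (Pt.map Prod.fst).Pairwise (· > ·) ∧ ∀ k < P.natDegree, coefAt q Pt k = P.coeff k := by
  have : Fact (1 < q) := ⟨by omega⟩
  have h1 : (P.natDegree, 1) ∈ l := by
    rw [h.mem_iff, hP.coeff_natDegree]
    exact ⟨one_ne_zero, Rep.one hq⟩
  cases l with
  | nil => simp at h1
  | cons t Pt =>
    rw [List.map_cons, List.pairwise_cons] at hs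
    have ht : t.1 = P.natDegree := by
      have h2 := le_natDegree_of_ne_zero (h.coeff_ne_zero (t := t) (by simp))
      rcases List.mem_cons.1 h1 with h3 | h3
      · rw [← h3]
      · have := hs.1 _ (List.mem_map_of_mem h3)
        simp only at this
        omega
    refine ⟨t.2, Pt, by rw [← ht], fun s hs' => ⟨?_, h.lt (by simp [hs'])⟩, hs.2, fun k hk => ?_⟩
    · rw [← ht]; exact hs.1 _ (List.mem_map_of_mem hs')
    · rw [← h.coefAt_eq (by omega), coefAt_cons, if_neg (by omega), zero_add]

end SparseRep

section Evaluation

variable {I : ℕ → ℕ} {W J q : ℕ} {M : Modulus}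

theorem sat_reduceDense (hM : ModSetup I W J q M) {S : ℕ} (cs : List ℤ)
    (hcs : ∀ c ∈ cs, c.natAbs.size ≤ S) :
    Sat (reduceDense I M cs) (fun rs => List.Forall₂ (fun r (c : ℤ) => Rep q r (c : ZMod q)) rs cs)
      (cs.length * (14 * (S / q.size + 1) * J)) := by
  induction cs with
  | nil => exact List.Forall₂.nil
  | cons c cs ih =>
    rw [reduceDense, List.length_cons, Nat.succ_mul]
    refine (sat_reduceInt hM (hcs c (by simp))).bind (by omega) fun r hr => ?_
    refine (ih fun c hc => hcs c (by simp [hc])).bind (by omega) fun rs hrs => ?_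
    rw [sat_pure]
    exact List.Forall₂.cons hr hrs

theorem sat_reduceSparse (hM : ModSetup I W J q M) {S : ℕ} (l : List (ℕ × ℤ))
    (hl : ∀ t ∈ l, t.1 < 2 ^ W ∧ t.2.natAbs.size ≤ S) :
    Sat (reduceSparse I M l) (fun rs => (rs.map Prod.fst).Sublist (l.map Prod.fst) ∧
        ∀ e c, (e, c) ∈ rs ↔ ∃ z : ℤ, (e, z) ∈ l ∧ (z : ZMod q) ≠ 0 ∧ Rep q c (z : ZMod q))
      (l.length * (16 * (S / q.size + 1) * J)) := by
  induction l with
  | nil => simp [reduceSparse]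
  | cons t l ih =>
    obtain ⟨e, c⟩ := t
    have he := hl (e, c) (by simp)
    simp only at he
    have hB := hM.toBudget
    have hc : 16 * (S / q.size + 1) * J =
      14 * (S / q.size + 1) * J + 2 * ((S / q.size + 1) * J) := by ring
    have hJ : J ≤ (S / q.size + 1) * J := Nat.le_mul_of_pos_left _ (Nat.succ_pos _)
    rw [reduceSparse, List.length_cons, Nat.succ_mul]
    refine (sat_reduceInt hM he.2).bind (by omega) fun r hr => ?_
    refine (ih fun t ht => hl t (by simp [ht])).bind (by omega) fun rs hrs => ?_
    have hr0 := hr.eq_iff (Rep.zero hM.pos)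
    refine Sat.bind_ite (sat_eq hB (hM.lt hr.1) (hM.lt hM.pos)) (by omega)
      (fun h => ?_) (fun h => ?_)
    · rw [sat_pure]
      refine ⟨hrs.1.cons _, fun e' c' => ?_⟩
      rw [hrs.2]
      constructor
      · rintro ⟨z, hz, h1⟩
        exact ⟨z, List.mem_cons_of_mem _ hz, h1⟩
      · rintro ⟨z, hz, h1, h2⟩
        rcases List.mem_cons.1 hz with h3 | h3
        · obtain ⟨rfl, rfl⟩ := Prod.mk.inj h3
          exact absurd (hr0.1 h) h1
        · exact ⟨z, h3, h1, h2⟩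
    · have hes := Nat.size_le.2 he.1
      have := hB.lin
      refine ⟨by omega, hrs.1.cons_cons _, fun e' c' => ?_⟩
      rw [List.mem_cons, hrs.2]
      constructor
      · rintro (h1 | ⟨z, hz, h1⟩)
        · obtain ⟨rfl, rfl⟩ := Prod.mk.inj h1
          exact ⟨c, by simp, fun h0 => h (hr0.2 h0), hr⟩
        · exact ⟨z, List.mem_cons_of_mem _ hz, h1⟩
      · rintro ⟨z, hz, h1, h2⟩
        rcases List.mem_cons.1 hz with h3 | h3
        · obtain ⟨rfl, rfl⟩ := Prod.mk.inj h3
          exact Or.inl (by rw [(h2.eq_iff hr).2 rfl])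
        · exact Or.inr ⟨z, h3, h1, h2⟩

theorem sat_evalDense (hM : ModSetup I W J q M) {x : ℕ} {a : ZMod q} (hx : Rep q x a) (cs : List ℕ)
    (zs : List (ZMod q)) (h : List.Forall₂ (Rep q) cs zs) :
    Sat (evalDense I M x cs) (Rep q · (zs.foldr (fun z r => a * r + z) 0))
      (cs.length * (10 * J)) := by
  induction h with
  | nil => exact Rep.zero hM.pos
  | cons hcz _ ih =>
    rw [evalDense, List.length_cons, Nat.succ_mul, List.foldr_cons]
    refine ih.bind (by omega) fun r hr => ?_
    refine (sat_mulMod hM hx hr).bind (by omega) fun r hr => ?_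
    exact (sat_addMod hM hr hcz).mono_cost (by omega)

theorem foldr_map_range {R : Type*} [CommRing R] (f : ℕ → R) (a : R) (n : ℕ) :
    ((List.range n).map f).foldr (fun z r => a * r + z) 0 = ∑ i ∈ Finset.range n, f i * a ^ i := by
  induction n generalizing f with
  | zero => simp
  | succ n ih =>
    rw [List.range_succ_eq_map, List.map_cons, List.foldr_cons, List.map_map, ih,
      Finset.sum_range_succ', Finset.mul_sum]
    simp only [Function.comp, pow_zero, mul_one, Nat.succ_eq_add_one, pow_succ]
    congr 1
    exact Finset.sum_congr rfl fun i _ => by ring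

theorem foldr_coeff_eq_eval {R : Type*} [CommRing R] {F : R[X]} {n : ℕ} (hF : F.degree < n)
    (a : R) : ((List.range n).map F.coeff).foldr (fun z r => a * r + z) 0 = eval a F := by
  rw [foldr_map_range]
  by_cases h0 : F = 0
  · simp [h0]
  · rw [eval_eq_sum_range' ((natDegree_lt_iff_degree_lt h0).2 hF)]

theorem sat_evalSparse (hM : ModSetup I W J q M) {x d : ℕ} {a : ZMod q} (hx : Rep q x a)
    (l : List (ℕ × ℕ)) (hl : ∀ t ∈ l, t.1 < 2 ^ W ∧ t.1.size ≤ d ∧ t.2 < q) :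
    Sat (evalSparse I M x l) (Rep q · ((l.map fun t => (t.2 : ZMod q) * a ^ t.1).sum))
      (l.length * ((14 * d + 11) * J)) := by
  induction l with
  | nil => exact Rep.zero hM.pos
  | cons t l ih =>
    obtain ⟨e, c⟩ := t
    obtain ⟨h1, h2, h3⟩ := hl (e, c) (by simp)
    simp only at h1 h2 h3
    have hc : (14 * d + 11) * J = (14 * d + 1) * J + 10 * J := by ring
    have hd : (14 * e.size + 1) * J ≤ (14 * d + 1) * J := Nat.mul_le_mul_right _ (by omega)
    rw [evalSparse, List.length_cons, Nat.succ_mul, List.map_cons, List.sum_cons, add_comm (_ * _)]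
    refine (ih fun t ht => hl t (by simp [ht])).bind (by omega) fun r hr => ?_
    refine (sat_powMod hM hx h1).bind (by omega) fun y hy => ?_
    refine (sat_mulMod hM ⟨h3, rfl⟩ hy).bind (by omega) fun y hy => ?_
    exact (sat_addMod hM hr hy).mono_cost (by omega)

end Evaluation

/-! ### Modular evaluation of a product of dense polynomials -/

section Dense

variable {I : ℕ → ℕ} {W J q : ℕ} {M : Modulus}

theorem sat_storeDown (hM : ModSetup I W J q M) (cs : List ℕ) (f : ℕ → ZMod q) (i : ℕ) (V : Mem)
    (hi : i < 2 ^ W) (hlen : cs.length ≤ i + 1)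
    (hcs : ∀ t (ht : t < cs.length), Rep q cs[t] (f (i - t))) :
    Sat (storeDown cs i V)
      (fun V' => (∀ j, j ≤ i → i < j + cs.length → Rep q (V' j) (f j)) ∧
        ∀ j, i < j ∨ j + cs.length ≤ i → V' j = V j)
      (cs.length * (2 * J)) := by
  have hB := hM.toBudget
  induction cs generalizing i V with
  | nil => exact ⟨fun j h1 h2 => by simp at h2; omega, fun _ _ => rfl⟩
  | cons c cs ih =>
    rw [storeDown, List.length_cons, Nat.succ_mul]
    rw [List.length_cons] at hlen
    have hc := hcs 0 (by simp)
    simp only [List.getElem_cons_zero, Nat.sub_zero] at hc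
    have h1W : 1 < 2 ^ W := hM.lt (by have := hM.two_le; omega)
    refine (sat_store hB V hi (hM.lt hc.1)).bind (by omega) ?_
    rintro _ rfl
    refine (sat_sub hB hi h1W).bind (by omega) ?_
    rintro _ rfl
    refine (ih (i - 1) _ (by omega) (by omega) fun t ht => ?_).mono (by omega) ?_
    · have := hcs (t + 1) (by simpa using ht)
      rw [List.getElem_cons_succ] at this
      rwa [show i - 1 - t = i - (t + 1) by omega]
    · rintro V' ⟨h1, h2⟩
      refine ⟨fun j hj1 hj2 => ?_, fun j hj => ?_⟩
      · by_cases hji : j = i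
        · rw [hji, h2 i (by omega), Function.update_self]
          exact hc
        · exact h1 j (by omega) (by omega)
      · rw [h2 j (by omega), Function.update_of_ne (by omega)]

theorem sat_updateDense (hM : ModSetup I W J q M) {n i v : ℕ} {z : ZMod q} (hn : 2 * n < 2 ^ W)
    (hi : i < n) (hv : Rep q v z) (ts : List (ℕ × ℕ)) (hts : ∀ t ∈ ts, t.1 < n ∧ t.2 < q)
    (hs : (ts.map Prod.fst).Pairwise (· > ·)) (f : ℕ → ZMod q) (V : Mem)
    (hV : ∀ j < n, Rep q (V j) (f j)) :
    Sat (updateDense I M n i v ts V)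
      (fun V' => ∀ j < n, Rep q (V' j) (f j - coefAt q ts (i + n - j) * z))
      (ts.length * (16 * J)) := by
  have hB := hM.toBudget
  induction ts generalizing f V with
  | nil => simpa [updateDense, coefAt] using hV
  | cons t ts ih =>
    obtain ⟨k, p⟩ := t
    have hk := hts (k, p) (by simp)
    simp only at hk
    rw [List.map_cons, List.pairwise_cons] at hs
    rw [updateDense, List.length_cons, Nat.succ_mul]
    refine Sat.bind_ite (sat_lt hB (by omega) (by omega)) (by omega) (fun h => ?_) (fun h => ?_)
    · refine (sat_add hB (by omega) (by omega)).bind (by omega) ?_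
      rintro _ rfl
      refine (sat_sub hB (by omega) (by omega)).bind (by omega) ?_
      rintro _ rfl
      have hj : i + n - k < n := by omega
      refine (sat_mulMod hM ⟨hk.2, rfl⟩ hv).bind (by omega) fun x hx => ?_
      refine (sat_load hB (by omega) (hM.lt (hV _ hj).1)).bind (by omega) ?_
      rintro _ rfl
      refine (sat_subMod hM (hV _ hj) hx).bind (by omega) fun y hy => ?_
      refine (sat_store hB V (by omega) (hM.lt hy.1)).bind (by omega) ?_
      rintro _ rfl
      refine (ih (fun t ht => hts t (by simp [ht])) hs.2
        (Function.update f (i + n - k) (f (i + n - k) - p * z)) _ fun j hj' => ?_).mono (by omega)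
        fun V' hV' j hj' => ?_
      · by_cases h1 : j = i + n - k
        · subst h1
          simpa using hy
        · rw [Function.update_of_ne h1, Function.update_of_ne h1]
          exact hV j hj'
      · have h2 := hV' j hj'
        rw [coefAt_cons]
        by_cases h1 : j = i + n - k
        · rw [h1, Function.update_self] at h2
          rw [h1, if_pos (by omega)]
          convert h2 using 1
          ring
        · rw [Function.update_of_ne h1] at h2
          rwa [if_neg (by simp only; omega), zero_add]
    · rw [sat_pure]
      intro j hj
      rw [coefAt_eq_zero, zero_mul, sub_zero]
      · exact hV j hj
      · intro t ht
        rcases List.mem_cons.1 ht with rfl | ht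
        · simp only; omega
        · have := hs.1 _ (List.mem_map_of_mem ht)
          simp only at this
          omega

variable {P F G : (ZMod q)[X]} {Pt : List (ℕ × ℕ)}

theorem sat_leadingLoop (hM : ModSetup I W J q M) (hn : 2 * P.natDegree < 2 ^ W) (hP : P.Monic)
    (hF : F.degree < P.natDegree) (hts : ∀ t ∈ Pt, t.1 < P.natDegree ∧ t.2 < q)
    (hs : (Pt.map Prod.fst).Pairwise (· > ·)) (hc : ∀ k < P.natDegree, coefAt q Pt k = P.coeff k)
    (m i : ℕ) (him : i + m ≤ P.natDegree) (V : Mem)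
    (hV : ∀ j < P.natDegree, Rep q (V j) (partialLead P F i j)) :
    Sat (leadingLoop I M P.natDegree Pt m i V)
      (fun V' => ∀ j < P.natDegree, Rep q (V' j) (partialLead P F (i + m) j))
      (m * (Pt.length * (16 * J) + 2 * J)) := by
  have hB := hM.toBudget
  induction m generalizing i V with
  | zero => exact hV
  | succ m ih =>
    have h1W : 1 < 2 ^ W := hM.lt (by have := hM.two_le; omega)
    have hi := hV i (by omega)
    rw [leadingLoop, Nat.succ_mul]
    refine (sat_load hB (by omega) (hM.lt hi.1)).bind (by omega) ?_
    rintro _ rfl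
    rw [partialLead_of_le hP hF le_rfl (by omega)] at hi
    refine (sat_updateDense hM hn (by omega) hi Pt hts hs _ V hV).bind (by omega) fun V' hV' => ?_
    refine (sat_add hB (by omega) h1W).bind (by omega) ?_
    rintro _ rfl
    rw [show i + (m + 1) = i + 1 + m by omega]
    refine (ih (i + 1) (by omega) V' fun j hj => ?_).mono_cost (by omega)
    have h1 := hV' j hj
    rw [partialLead_succ]
    split_ifs with h
    · rw [hc _ (by omega), show i + P.natDegree - j = P.natDegree - j + i by omega, mul_comm] at h1
      exact h1
    · rw [coefAt_eq_zero, zero_mul] at h1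
      · exact h1
      · intro t ht
        have := (hts t ht).1
        omega

theorem sat_modularEvalLoop (hM : ModSetup I W J q M) (hn : 2 * P.natDegree < 2 ^ W) (hP : P.Monic)
    {x Px : ℕ} {a : ZMod q} (hx : Rep q x a) (hPx : Rep q Px (eval a P)) {V : Mem}
    (hV : ∀ j < P.natDegree, Rep q (V j) (leadCoef P F j)) (g : ℕ → ZMod q) (gs : List ℕ)
    (i Fx res : ℕ) (r : ZMod q) (hi : i + gs.length < P.natDegree)
    (hgs : ∀ t (ht : t < gs.length), Rep q gs[t] (g (i + 1 + t)))
    (hFx : Rep q Fx (eval a (shiftMod P F i))) (hres : Rep q res r) :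
    Sat (modularEvalLoop I M x Px V gs i Fx res)
      (Rep q · (r + ∑ t ∈ Finset.range gs.length,
        g (i + 1 + t) * eval a (shiftMod P F (i + 1 + t)))) (gs.length * (30 * J)) := by
  have hB := hM.toBudget
  induction gs generalizing i Fx res r with
  | nil => simpa [modularEvalLoop] using hres
  | cons c gs ih =>
    have h1W : 1 < 2 ^ W := hM.lt (by have := hM.two_le; omega)
    rw [List.length_cons] at hi
    have hvi := hV i (by omega)
    have hc := hgs 0 (by simp)
    simp only [List.getElem_cons_zero, Nat.add_zero] at hc
    rw [modularEvalLoop, List.length_cons, Nat.succ_mul, Finset.sum_range_succ']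
    refine (sat_load hB (by omega) (hM.lt hvi.1)).bind (by omega) ?_
    rintro _ rfl
    refine (sat_mulMod hM hx hFx).bind (by omega) fun y hy => ?_
    refine (sat_mulMod hM hvi hPx).bind (by omega) fun z hz => ?_
    refine (sat_subMod hM hy hz).bind (by omega) fun Fx' hFx' => ?_
    rw [← eval_shiftMod_succ hP (by omega)] at hFx'
    refine (sat_mulMod hM hFx' hc).bind (by omega) fun w hw => ?_
    refine (sat_addMod hM hres hw).bind (by omega) fun res' hres' => ?_
    refine (sat_add hB (by omega) h1W).bind (by omega) ?_
    rintro _ rfl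
    refine (ih (i + 1) Fx' res' _ (by omega) (fun t ht => ?_) hFx' hres').mono (by omega)
      fun u hu => ?_
    · have := hgs (t + 1) (by simpa using ht)
      rw [List.getElem_cons_succ] at this
      rwa [show i + 1 + 1 + t = i + 1 + (t + 1) by omega]
    · convert hu using 1
      have h1 : ∀ t, i + 1 + 1 + t = i + 1 + (t + 1) := fun t => by omega
      simp only [h1, Nat.add_zero]
      ring

/-- The list of the first `n` coefficients of a polynomial, in reduced form. -/
def DenseRep (q n : ℕ) (l : List ℕ) (F : (ZMod q)[X]) : Prop :=
  List.Forall₂ (Rep q) l ((List.range n).map F.coeff)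

theorem DenseRep.length_eq {n : ℕ} {l : List ℕ} (h : DenseRep q n l F) : l.length = n := by
  simpa using List.Forall₂.length_eq h

theorem DenseRep.getElem {n : ℕ} {l : List ℕ} (h : DenseRep q n l F) {t : ℕ} (ht : t < l.length) :
    Rep q l[t] (F.coeff t) := by
  have := List.Forall₂.get h ht (by simpa [← h.length_eq] using ht)
  simpa using this

/-- The value is computed in `O(#P n)` operations modulo `q`. -/
theorem sat_modularEval (hM : ModSetup I W J q M) (hn0 : 0 < P.natDegree)
    (hn : 2 * P.natDegree < 2 ^ W) (hP : P.Monic) (hF : F.degree < P.natDegree)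
    (hG : G.degree < P.natDegree) {Pl : List (ℕ × ℕ)} {Fl Gl : List ℕ} (hPl : SparseRep q Pl P)
    (hPs : (Pl.map Prod.fst).Pairwise (· > ·)) (hFl : DenseRep q P.natDegree Fl F)
    (hGl : DenseRep q P.natDegree Gl G) {x : ℕ} {a : ZMod q} (hx : Rep q x a) :
    Sat (modularEval I M Pl Fl Gl x) (Rep q · (eval a ((F * G) %ₘ P)))
      (100 * (Pl.length * P.natDegree) * J) := by
  have hB := hM.toBudget
  have : Fact (1 < q) := ⟨by have := hM.two_le; omega⟩
  have hd : P.natDegree.size ≤ P.natDegree := Nat.size_le.2 Nat.lt_two_pow_self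
  have hdeg : ∀ t ∈ Pl, t.1 < 2 ^ W ∧ t.1.size ≤ P.natDegree ∧ t.2 < q := fun t ht => by
    have h1 := le_natDegree_of_ne_zero (hPl.coeff_ne_zero ht)
    exact ⟨by omega, (Nat.size_le_size h1).trans hd, hPl.lt ht⟩
  have hPx := sat_evalSparse hM hx Pl hdeg
  rw [hPl.sum_eval hM.pos] at hPx
  obtain ⟨c, Pt, hPt, hts, hs, hcoef⟩ := hPl.eq_cons hM.two_le hPs hP
  have hFlen := hFl.length_eq
  have hGlen := hGl.length_eq
  obtain ⟨m, hm⟩ := Nat.exists_eq_add_of_lt hn0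
  rw [zero_add] at hm
  -- Every contribution to the cost is a multiple of one of the following products.
  have hlen : Pl.length = Pt.length + 1 := by rw [hPt, List.length_cons]
  set N := P.natDegree with hN
  have hcost : 100 * (Pl.length * N) * J = 100 * (Pt.length * N * J) + 100 * (N * J) := by
    rw [hlen]; ring
  have hNJ : N * J = m * J + J := by rw [hm]; ring
  have hcPx : Pl.length * ((14 * N + 11) * J) ≤ 25 * (Pt.length * N * J) + 25 * (N * J) := by
    calc Pl.length * ((14 * N + 11) * J) ≤ Pl.length * ((25 * N) * J) :=
          Nat.mul_le_mul_left _ (Nat.mul_le_mul_right _ (by omega))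
      _ = _ := by rw [hlen]; ring
  have hcloop : (N - 1) * (Pt.length * (16 * J) + 2 * J) ≤
      16 * (Pt.length * N * J) + 2 * (N * J) := by
    calc (N - 1) * (Pt.length * (16 * J) + 2 * J) ≤ N * (Pt.length * (16 * J) + 2 * J) :=
          Nat.mul_le_mul_right _ (by omega)
      _ = _ := by ring
  have hFJ : N * (10 * J) = 10 * (N * J) := by ring
  have hFJ2 : N * (2 * J) = 2 * (N * J) := by ring
  have h1W : 1 < 2 ^ W := hM.lt (by have := hM.two_le; omega)
  have hlead : Sat (leadingCoefficients I M N Pt Fl)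
      (fun V => ∀ j < N, Rep q (V j) (leadCoef P F j))
      (J + N * (2 * J) + (16 * (Pt.length * N * J) + 2 * (N * J))) := by
    rw [leadingCoefficients]
    refine (sat_sub hB (by omega) h1W).bind (by omega) ?_
    rintro _ rfl
    refine (sat_storeDown hM Fl (fun j => F.coeff (N - 1 - j)) (N - 1) _ (by omega) (by omega)
      fun t ht => ?_).bind (by rw [hFlen]; omega) fun V hV => ?_
    · have := hFl.getElem ht
      rwa [show N - 1 - (N - 1 - t) = t by omega]
    · refine ((sat_leadingLoop hM hn hP hF hts hs hcoef (N - 1) 0 (by omega) V fun j hj => ?_).mono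
        hcloop fun V' hV' j hj => ?_).mono_cost (by rw [hFlen]; omega)
      · rw [partialLead_zero]
        exact hV.1 j (by omega) (by omega)
      · have := hV' j hj
        rwa [partialLead_of_le hP hF (by omega) hj] at this
  have hhead : leadExp Pl = N := by rw [hPt]; rfl
  have htail : Pl.tail = Pt := by rw [hPt]; rfl
  rw [modularEval, hhead, htail]
  refine hlead.bind (by omega) fun V hV => ?_
  refine (hPx.mono_cost hcPx).bind (by omega) fun Px hPx => ?_
  have hFx := sat_evalDense hM hx Fl _ hFl
  rw [foldr_coeff_eq_eval hF, hFlen, ← shiftMod_zero hP hF] at hFx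
  refine hFx.bind (by omega) fun Fx hFx => ?_
  cases Gl with
  | nil => simp only [List.length_nil] at hGlen; omega
  | cons g gs =>
    rw [List.length_cons] at hGlen
    have hg0 := hGl.getElem (t := 0) (by simp)
    rw [List.getElem_cons_zero] at hg0
    refine (sat_mulMod hM hFx hg0).bind (by omega) fun res hres => ?_
    have hloop := sat_modularEvalLoop hM hn hP hx hPx hV G.coeff gs 0 Fx res _ (by omega)
      (fun t ht => by
        have := hGl.getElem (t := t + 1) (by simpa using ht)
        rw [List.getElem_cons_succ] at this
        rwa [show 0 + 1 + t = t + 1 by omega]) hFx hres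
    have hgm : gs.length = m := by omega
    have hmJ : m * (30 * J) = 30 * (m * J) := by ring
    rw [hgm] at hloop
    refine hloop.mono (by omega) fun r hr => ?_
    rw [eval_mul_modByMonic hG, ← hN, hm, Finset.sum_range_succ']
    convert hr using 1
    rw [add_comm, mul_comm (G.coeff 0)]
    congr 1
    exact Finset.sum_congr rfl fun t _ => by rw [show 0 + 1 + t = t + 1 by omega]

end Dense

/-! ### Sparse vectors -/

namespace Trie

/-- The tree of depth `d` represents the partial function `m` on `{0, …, 2 ^ d - 1}`, and it has no
empty nodes. -/
def Models : (d : ℕ) → Trie → (ℕ → Option ℕ) → Prop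
  | 0, t, m => (t = nil ∧ m 0 = none) ∨ ∃ v, t = leaf v ∧ m 0 = some v
  | d + 1, t, m => (t = nil ∧ ∀ i < 2 ^ (d + 1), m i = none) ∨
      ∃ l r, t = node l r ∧ Models d l m ∧ Models d r (fun i => m (i + 2 ^ d)) ∧
        ∃ i < 2 ^ (d + 1), m i ≠ none

theorem Models.congr {d : ℕ} {t : Trie} {m m' : ℕ → Option ℕ} (h : Models d t m)
    (hm : ∀ i < 2 ^ d, m' i = m i) : Models d t m' := by
  induction d generalizing t m m' with
  | zero => simpa only [Models, hm 0 (by norm_num)] using h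
  | succ d ih =>
    have hd : 2 ^ (d + 1) = 2 ^ d + 2 ^ d := by rw [pow_succ]; omega
    rcases h with ⟨rfl, h⟩ | ⟨l, r, rfl, hl, hr, i, hi, h⟩
    · exact Or.inl ⟨rfl, fun i hi => (hm i hi).trans (h i hi)⟩
    · exact Or.inr ⟨l, r, rfl, ih hl fun i hi => hm i (by omega),
        ih hr fun i hi => hm _ (by omega), i, hi, by rwa [hm i hi]⟩

theorem models_nil_iff {d : ℕ} {m : ℕ → Option ℕ} :
    Models d nil m ↔ ∀ i < 2 ^ d, m i = none := by
  cases d with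
  | zero =>
    simp only [Models, true_and, reduceCtorEq, false_and, exists_false, or_false, pow_zero]
    exact ⟨fun h i hi => by rwa [Nat.lt_one_iff.1 hi], fun h => h 0 (by norm_num)⟩
  | succ d => simp [Models]

theorem Models.eq_nil {d : ℕ} {t : Trie} {m : ℕ → Option ℕ} (h : Models d t m)
    (hm : ∀ i < 2 ^ d, m i = none) : t = nil := by
  cases d with
  | zero =>
    rcases h with ⟨rfl, -⟩ | ⟨v, -, h⟩
    · rfl
    · rw [hm 0 (by norm_num)] at h; simp at h
  | succ d =>
    rcases h with ⟨rfl, -⟩ | ⟨l, r, -, -, -, i, hi, h⟩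
    · rfl
    · exact absurd (hm i hi) h

theorem Models.left {d : ℕ} {t : Trie} {m : ℕ → Option ℕ} (h : Models (d + 1) t m) :
    Models d t.left m := by
  rcases h with ⟨rfl, h⟩ | ⟨l, r, rfl, hl, -⟩
  · rw [pow_succ] at h
    exact models_nil_iff.2 fun i hi => h i (by omega)
  · exact hl

theorem Models.right {d : ℕ} {t : Trie} {m : ℕ → Option ℕ} (h : Models (d + 1) t m) :
    Models d t.right (fun i => m (i + 2 ^ d)) := by
  rcases h with ⟨rfl, h⟩ | ⟨l, r, rfl, -, hr, -⟩
  · rw [pow_succ] at h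
    exact models_nil_iff.2 fun i hi => h _ (by omega)
  · exact hr

theorem Models.join {d : ℕ} {l r : Trie} {m : ℕ → Option ℕ} (hl : Models d l m)
    (hr : Models d r (fun i => m (i + 2 ^ d))) : Models (d + 1) (join l r) m := by
  have hd : 2 ^ (d + 1) = 2 ^ d + 2 ^ d := by rw [pow_succ]; omega
  by_cases hm : ∀ i < 2 ^ (d + 1), m i = none
  · have h1 := hl.eq_nil fun i hi => hm i (by omega)
    have h2 := hr.eq_nil fun i hi => hm _ (by omega)
    subst h1 h2
    exact Or.inl ⟨rfl, hm⟩
  · push Not at hm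
    have hne : l ≠ nil ∨ r ≠ nil := by
      by_contra! h
      obtain ⟨rfl, rfl⟩ := h
      obtain ⟨i, hi, h⟩ := hm
      rw [models_nil_iff] at hl hr
      rcases lt_or_ge i (2 ^ d) with h1 | h1
      · exact h (hl i h1)
      · have := hr (i - 2 ^ d) (by omega)
        rw [Nat.sub_add_cancel h1] at this
        exact h this
    have hj : Trie.join l r = node l r := by
      cases l <;> cases r <;> simp_all [Trie.join]
    exact Or.inr ⟨l, r, hj, hl, hr, hm⟩

end Trie

/-- The list of the `d` lowest binary digits of `j`. -/
def key (d j : ℕ) : List Bool := (List.range d).reverse.map j.testBit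

theorem key_succ_of_lt {d j : ℕ} (hj : j < 2 ^ d) : key (d + 1) j = false :: key d j := by
  rw [key, List.range_succ, List.reverse_append, List.map_append, key]
  simp [Nat.testBit_lt_two_pow hj]

theorem key_succ_of_add {d j : ℕ} (hj : j < 2 ^ d) : key (d + 1) (j + 2 ^ d) = true :: key d j := by
  rw [key, List.range_succ, List.reverse_append, List.map_append, key, add_comm]
  simp only [List.reverse_cons, List.reverse_nil, List.nil_append, List.map_cons, List.map_nil,
    List.singleton_append, Nat.testBit_two_pow_add_eq, Nat.testBit_lt_two_pow hj, Bool.not_false]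
  congr 1
  refine List.map_congr_left fun i hi => ?_
  rw [List.mem_reverse, List.mem_range] at hi
  exact Nat.testBit_two_pow_add_gt hi j

section Trie

variable {I : ℕ → ℕ} {W J q : ℕ} {M : Modulus}

theorem sat_addAt (hM : ModSetup I W J q M) {v : ℕ} {z : ZMod q} (hv : Rep q v z) (d : ℕ) (t : Trie)
    (m : ℕ → Option ℕ) (ht : t.Models d m) (hm : ∀ i u, m i = some u → u < q) (j : ℕ)
    (hj : j < 2 ^ d) :
    Sat (t.addAt M v (key d j))
      (fun t' => ∃ w, Rep q w (((m j).getD 0 : ℕ) + z) ∧ t'.Models d (Function.update m j (some w)))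
      ((d + 3) * J) := by
  have hJ := hM.lin
  induction d generalizing t m j with
  | zero =>
    obtain rfl : j = 0 := by simpa using hj
    have hkey : key 0 0 = [] := rfl
    rw [hkey]
    rcases ht with ⟨rfl, h⟩ | ⟨u, rfl, h⟩
    · rw [Trie.addAt]
      · have := Nat.size_le.2 (hM.lt hv.1)
        refine ⟨by omega, v, ?_, Or.inr ⟨v, rfl, by simp⟩⟩
        simpa [h] using hv
      · simp
    · rw [Trie.addAt]
      refine (sat_addMod hM ⟨hm _ _ h, rfl⟩ hv).bind (by omega) fun w hw => ?_
      rw [sat_pure]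
      exact ⟨w, by simpa [h] using hw, Or.inr ⟨w, rfl, by simp⟩⟩
  | succ d ih =>
    have hd : 2 ^ (d + 1) = 2 ^ d + 2 ^ d := by rw [pow_succ]; omega
    have hc : (d + 1 + 3) * J = (d + 3) * J + J := by ring
    rcases lt_or_ge j (2 ^ d) with h | h
    · rw [key_succ_of_lt h, Trie.addAt]
      refine ⟨by omega, (ih _ m ht.left hm j h).bind (by omega) ?_⟩
      rintro l ⟨w, hw, hl⟩
      rw [sat_pure]
      refine ⟨w, hw, Or.inr ⟨l, t.right, rfl, hl, ht.right.congr fun i hi => ?_, j, hj, by simp⟩⟩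
      rw [Function.update_of_ne (by omega)]
    · obtain ⟨k, rfl⟩ := Nat.exists_eq_add_of_le' h
      have hk : k < 2 ^ d := by omega
      rw [key_succ_of_add hk, Trie.addAt]
      refine ⟨by omega, (ih _ _ ht.right (fun i u => hm _ u) k hk).bind (by omega) ?_⟩
      rintro r ⟨w, hw, hr⟩
      rw [sat_pure]
      refine ⟨w, hw, Or.inr ⟨t.left, r, rfl, ht.left.congr fun i hi => ?_,
        hr.congr fun i hi => ?_, _, hj, by simp⟩⟩
      · rw [Function.update_of_ne (by omega)]
      · by_cases hik : i = k
        · subst hik; simp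
        · rw [Function.update_of_ne (by omega), Function.update_of_ne hik]

theorem sat_popMin (hM : ModSetup I W J q M) (d : ℕ) (t : Trie) (m : ℕ → Option ℕ)
    (ht : t.Models d m) (hm : ∀ i u, m i = some u → u < q) (i : ℕ) (hi : (i + 1) * 2 ^ d ≤ 2 ^ W) :
    Sat (t.popMin i)
      (fun o => (o = none ∧ t = Trie.nil) ∨ ∃ j v t', o = some (i * 2 ^ d + j, v, t') ∧
        j < 2 ^ d ∧ m j = some v ∧ (∀ k < j, m k = none) ∧ t'.Models d (Function.update m j none))
      ((3 * d + 1) * J) := by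
  have hJ := hM.lin
  have hB := hM.toBudget
  have hnil : ∀ {i c : ℕ}, J ≤ c → Sat (Trie.nil.popMin i) (fun o => o = none) c := fun hc =>
    ⟨by omega, rfl⟩
  induction d generalizing t m i with
  | zero =>
    rcases ht with ⟨rfl, h⟩ | ⟨v, rfl, h⟩
    · exact (hnil (by omega)).mono le_rfl fun o ho => Or.inl ⟨ho, rfl⟩
    · rw [Trie.popMin]
      have := Nat.size_le.2 (hM.lt (hm _ _ h))
      refine ⟨by omega, Or.inr ⟨0, v, Trie.nil, by simp, by simp, h, by simp, ?_⟩⟩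
      exact Trie.models_nil_iff.2 fun i hi => by
        obtain rfl : i = 0 := by simpa using hi
        simp
  | succ d ih =>
    have hd : 2 ^ (d + 1) = 2 ^ d + 2 ^ d := by rw [pow_succ]; omega
    have hc : (3 * (d + 1) + 1) * J = (3 * d + 1) * J + 3 * J := by ring
    rcases ht with ⟨rfl, h⟩ | ⟨l, r, rfl, hl, hr, hex⟩
    · exact (hnil (by omega)).mono le_rfl fun o ho => Or.inl ⟨ho, rfl⟩
    · have hpos : 0 < 2 ^ d := by positivity
      have hi2 : (2 * i + 1 + 1) * 2 ^ d ≤ 2 ^ W := by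
        calc (2 * i + 1 + 1) * 2 ^ d = (i + 1) * 2 ^ (d + 1) := by rw [pow_succ]; ring
          _ ≤ _ := hi
      have hiW : i < 2 ^ W := by
        have : i + 1 ≤ (i + 1) * 2 ^ (d + 1) := Nat.le_mul_of_pos_right _ (by positivity)
        omega
      rw [Trie.popMin]
      refine (sat_push hB false hiW).bind (by omega) ?_
      rintro _ rfl
      rw [Bool.toNat_false, add_zero]
      by_cases hln : l = Trie.nil
      · subst hln
        rw [Trie.models_nil_iff] at hl
        refine (hnil le_rfl).bind (by omega) ?_
        rintro _ rfl
        simp only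
        refine (sat_push hB true hiW).bind (by omega) ?_
        rintro _ rfl
        rw [Bool.toNat_true]
        refine (ih r _ hr (fun i u => hm _ u) (2 * i + 1) hi2).bind (by omega) ?_
        rintro _ (⟨rfl, rfl⟩ | ⟨j, v, r', rfl, hj, hv, hmin, hr'⟩)
        · -- A node is not empty.
          rw [Trie.models_nil_iff] at hr
          obtain ⟨k, hk, hne⟩ := hex
          exfalso
          rcases lt_or_ge k (2 ^ d) with h1 | h1
          · exact hne (hl k h1)
          · have := hr (k - 2 ^ d) (by omega)
            rw [Nat.sub_add_cancel h1] at this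
            exact hne this
        · simp only
          rw [sat_pure]
          refine Or.inr ⟨j + 2 ^ d, v, _, ?_, by omega, hv, fun k hk => ?_,
            Trie.Models.join (Trie.models_nil_iff.2 fun k hk => ?_) (hr'.congr fun k hk => ?_)⟩
          · congr 2
            rw [pow_succ]
            ring
          · rcases lt_or_ge k (2 ^ d) with h1 | h1
            · exact hl k h1
            · have := hmin (k - 2 ^ d) (by omega)
              rwa [Nat.sub_add_cancel h1] at this
          · rw [Function.update_of_ne (by omega)]
            exact hl k hk
          · by_cases hkj : k = j
            · subst hkj; simp
            · rw [Function.update_of_ne (by omega), Function.update_of_ne hkj]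
      · refine (ih l m hl hm (2 * i) (by nlinarith)).bind (by omega) ?_
        rintro _ (⟨-, h⟩ | ⟨j, v, l', rfl, hj, hv, hmin, hl'⟩)
        · exact absurd h hln
        · simp only
          rw [sat_pure]
          refine Or.inr ⟨j, v, _, ?_, by omega, hv, hmin,
            Trie.Models.join hl' (hr.congr fun k hk => ?_)⟩
          · congr 2
            rw [pow_succ]
            ring
          · rw [Function.update_of_ne (by omega)]

end Trie

/-! ### Leading coefficients of the residues for sparse polynomials -/

/-- The entry with index `j` of a sparse vector, as a residue. -/
def entry (q : ℕ) (m : ℕ → Option ℕ) (j : ℕ) : ZMod q := ((m j).getD 0 : ℕ)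

/-- The tree represents the partial function `m`, whose values are residues and whose indices are
less than `n`. -/
structure TrieRep (q n d : ℕ) (t : Trie) (m : ℕ → Option ℕ) : Prop where
  models : t.Models d m
  lt : ∀ j v, m j = some v → j < n ∧ v < q

/-- The total weight of the indices of a sparse vector. It bounds the work that remains to be done
on the vector. -/
def weight (n : ℕ) (u : ℕ → ℕ) (m : ℕ → Option ℕ) : ℕ :=
  ∑ j ∈ Finset.range n, if (m j).isSome then u j else 0

theorem weight_update_some_le (n : ℕ) (u : ℕ → ℕ) (m : ℕ → Option ℕ) (j w : ℕ) :
    weight n u (Function.update m j (some w)) ≤ weight n u m + u j := by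
  have h1 : u j = ∑ k ∈ Finset.range (max n (j + 1)), if k = j then u j else 0 := by
    rw [Finset.sum_ite_eq', if_pos (by simp)]
  have h2 : ∑ k ∈ Finset.range n, (if k = j then u j else 0) ≤ u j := by
    conv_rhs => rw [h1]
    exact Finset.sum_le_sum_of_subset (Finset.range_mono (le_max_left _ _))
  refine le_trans ?_ (Nat.add_le_add_left h2 _)
  rw [weight, weight, ← Finset.sum_add_distrib]
  refine Finset.sum_le_sum fun k _ => ?_
  by_cases hk : k = j
  · subst hk; simp
  · rw [Function.update_of_ne hk]; omega

theorem weight_update_none {n : ℕ} (u : ℕ → ℕ) {m : ℕ → Option ℕ} {j v : ℕ} (hj : j < n)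
    (hm : m j = some v) : weight n u (Function.update m j none) + u j = weight n u m := by
  rw [weight, weight, ← Finset.add_sum_erase _ _ (Finset.mem_range.2 hj),
    ← Finset.add_sum_erase (a := j) _ (fun k => if (m k).isSome then u k else 0)
      (Finset.mem_range.2 hj)]
  rw [Function.update_self, hm, Finset.sum_congr rfl fun k hk => by
    rw [Function.update_of_ne (Finset.ne_of_mem_erase hk)]]
  simp [add_comm]

section SparseVector

variable {I : ℕ → ℕ} {W J q n d : ℕ} {M : Modulus}

theorem TrieRep.erase {t t' : Trie} {m : ℕ → Option ℕ} (h : TrieRep q n d t m) {j : ℕ}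
    (ht : t'.Models d (Function.update m j none)) :
    TrieRep q n d t' (Function.update m j none) := by
  refine ⟨ht, fun k v hk => ?_⟩
  by_cases hkj : k = j
  · subst hkj; simp at hk
  · rw [Function.update_of_ne hkj] at hk
    exact h.lt k v hk

theorem sat_addAt_entry (hM : ModSetup I W J q M) (hnd : n ≤ 2 ^ d) {v : ℕ} {z : ZMod q}
    (hv : Rep q v z) {t : Trie} {m : ℕ → Option ℕ} (ht : TrieRep q n d t m) {j : ℕ} (hj : j < n)
    (u : ℕ → ℕ) :
    Sat (t.addAt M v (key d j))
      (fun t' => ∃ m', TrieRep q n d t' m' ∧ entry q m' j = entry q m j + z ∧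
        (∀ k, k ≠ j → m' k = m k) ∧ weight n u m' ≤ weight n u m + u j) ((d + 3) * J) := by
  refine (sat_addAt hM hv d t m ht.models (fun i w h => (ht.lt i w h).2) j (by omega)).mono le_rfl
    ?_
  rintro t' ⟨w, hw, ht'⟩
  refine ⟨_, ⟨ht', fun k x hk => ?_⟩, ?_, fun k hk => Function.update_of_ne hk _ _,
    weight_update_some_le n u m j w⟩
  · by_cases hkj : k = j
    · subst hkj
      rw [Function.update_self] at hk
      obtain rfl := Option.some.inj hk
      exact ⟨hj, hw.1⟩
    · rw [Function.update_of_ne hkj] at hk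
      exact ht.lt k x hk
  · rw [entry, Function.update_self, Option.getD_some, hw.2]
    rfl

theorem sat_sparseInit (hM : ModSetup I W J q M) (hn : 2 * n < 2 ^ W) (hnd : n ≤ 2 ^ d)
    (hdW : d ≤ W) (u : ℕ → ℕ) (hu : Antitone u) (ts : List (ℕ × ℕ))
    (hts : ∀ t ∈ ts, t.1 < n ∧ t.2 < q) (V : Trie) (m : ℕ → Option ℕ)
    (hV : TrieRep q n d V m) :
    Sat (sparseInit M n d ts V)
      (fun V' => ∃ m', TrieRep q n d V' m' ∧
        (∀ j < n, entry q m' j = entry q m j + coefAt q ts (n - 1 - j)) ∧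
        weight n u m' ≤ weight n u m + ts.length * u 0) (ts.length * ((d + 6) * J)) := by
  have hB := hM.toBudget
  induction ts generalizing V m with
  | nil => exact ⟨m, hV, fun j _ => by simp [coefAt], by simp⟩
  | cons t ts ih =>
    obtain ⟨e, c⟩ := t
    have he := hts (e, c) (by simp)
    simp only at he
    have h1W : 1 < 2 ^ W := hM.lt (by have := hM.two_le; omega)
    have hc : (d + 6) * J = (d + 3) * J + 3 * J := by ring
    rw [sparseInit, List.length_cons, Nat.succ_mul _ ((d + 6) * J)]
    refine (sat_sub hB (by omega) h1W).bind (by omega) ?_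
    rintro _ rfl
    refine (sat_sub hB (by omega) (by omega)).bind (by omega) ?_
    rintro _ rfl
    refine (sat_keyBits hB (by omega) hdW).bind (by omega) ?_
    rintro _ rfl
    have hj : n - 1 - e < n := by omega
    refine (sat_addAt_entry hM hnd ⟨he.2, rfl⟩ hV hj u).bind (by omega) ?_
    rintro V' ⟨m', hV', h1, h2, h3⟩
    refine (ih (fun t ht => hts t (by simp [ht])) V' m' hV').mono (by omega) ?_
    rintro V'' ⟨m'', hV'', h4, h5⟩
    refine ⟨m'', hV'', fun j hj' => ?_, ?_⟩
    · rw [h4 j hj', coefAt_cons]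
      by_cases hje : j = n - 1 - e
      · rw [if_pos (by simp only; omega), hje, h1, add_assoc]
      · rw [if_neg (by simp only; omega), zero_add, entry, h2 j hje]
        rfl
    · have := hu (Nat.zero_le (n - 1 - e))
      rw [Nat.succ_mul]
      omega

/-- All the exponents of the updating terms are at most `n - g`, so that only entries with indices
at least `i + g` are changed. -/
theorem sat_updateSparse (hM : ModSetup I W J q M) (hn : 2 * n < 2 ^ W) (hnd : n ≤ 2 ^ d)
    (hdW : d ≤ W) {u : ℕ → ℕ} (hu : Antitone u) {g i v : ℕ} {z : ZMod q} (hg : 0 < g) (hi : i < n)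
    (hv : Rep q v z) (ts : List (ℕ × ℕ)) (hts : ∀ t ∈ ts, t.1 + g ≤ n ∧ t.2 < q)
    (hs : (ts.map Prod.fst).Pairwise (· > ·)) (V : Trie) (m : ℕ → Option ℕ)
    (hV : TrieRep q n d V m) :
    Sat (updateSparse I M n d i v ts V)
      (fun V' => ∃ m', TrieRep q n d V' m' ∧ (∀ j ≤ i, m' j = m j) ∧
        (∀ j, i < j → j < n → entry q m' j = entry q m j - coefAt q ts (i + n - j) * z) ∧
        weight n u m' ≤ weight n u m + ts.length * u (i + g))
      (ts.length * ((d + 18) * J)) := by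
  have hB := hM.toBudget
  induction ts generalizing V m with
  | nil => exact ⟨m, hV, fun _ _ => rfl, fun j _ _ => by simp [coefAt], by simp⟩
  | cons t ts ih =>
    obtain ⟨k, p⟩ := t
    have hk := hts (k, p) (by simp)
    simp only at hk
    have hc : (d + 18) * J = (d + 3) * J + 15 * J := by ring
    rw [List.map_cons, List.pairwise_cons] at hs
    rw [updateSparse, List.length_cons, Nat.succ_mul _ ((d + 18) * J)]
    refine Sat.bind_ite (sat_lt hB (by omega) (by omega)) (by omega) (fun h => ?_) (fun h => ?_)
    · refine (sat_add hB (by omega) (by omega)).bind (by omega) ?_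
      rintro _ rfl
      refine (sat_sub hB (by omega) (by omega)).bind (by omega) ?_
      rintro _ rfl
      have hj : i + n - k < n := by omega
      refine (sat_mulMod hM ⟨hk.2, rfl⟩ hv).bind (by omega) fun x hx => ?_
      refine (sat_subMod hM (Rep.zero hM.pos) hx).bind (by omega) fun y hy => ?_
      refine (sat_keyBits hB (by omega) hdW).bind (by omega) ?_
      rintro _ rfl
      refine (sat_addAt_entry hM hnd hy hV hj u).bind (by omega) ?_
      rintro V' ⟨m', hV', h1, h2, h3⟩
      refine (ih (fun t ht => hts t (by simp [ht])) hs.2 V' m' hV').mono (by omega) ?_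
      rintro V'' ⟨m'', hV'', h4, h5, h6⟩
      refine ⟨m'', hV'', fun j hj' => (h4 j hj').trans (h2 j (by omega)), fun j hij hjn => ?_, ?_⟩
      · rw [h5 j hij hjn, coefAt_cons]
        by_cases hje : j = i + n - k
        · rw [if_pos (by simp only; omega), hje, h1]
          ring
        · rw [if_neg (by simp only; omega), zero_add, entry, h2 j hje]
          rfl
      · have := hu (show i + g ≤ i + n - k by omega)
        rw [Nat.succ_mul]
        omega
    · rw [sat_pure]
      refine ⟨m, hV, fun _ _ => rfl, fun j hij hjn => ?_, by omega⟩
      rw [coefAt_eq_zero, zero_mul, sub_zero]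
      intro t ht
      rcases List.mem_cons.1 ht with rfl | ht
      · simp only; omega
      · have := hs.1 _ (List.mem_map_of_mem ht)
        simp only at this
        omega

/-- Updates by an entry of large index stop at the first term. -/
theorem sat_updateSparse_of_le (hM : ModSetup I W J q M) (hn : 2 * n < 2 ^ W) {g i v : ℕ}
    (hi : i < n) (hig : n ≤ i + g) (ts : List (ℕ × ℕ)) (hts : ∀ t ∈ ts, t.1 + g ≤ n) (V : Trie) :
    Sat (updateSparse I M n d i v ts V) (· = V) J := by
  cases ts with
  | nil => exact rfl
  | cons t ts =>
    obtain ⟨k, p⟩ := t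
    have hk := hts (k, p) (by simp)
    simp only at hk
    rw [updateSparse]
    refine Sat.bind_ite (sat_lt hM.toBudget (by omega) (by omega)) le_rfl (fun h => ?_)
      (fun h => ?_)
    · omega
    · rw [sat_pure]

/-- While the contributions to the leading coefficients vanish, the recursion does not change
them. -/
theorem partialLead_eq_of_zero {R : Type*} [CommRing R] {P F : R[X]} (hP : P.Monic)
    (hF : F.degree < P.natDegree) {i₀ i : ℕ} (h : i₀ ≤ i) (hi : i ≤ P.natDegree)
    (h0 : ∀ j, i₀ ≤ j → j < i → partialLead P F i₀ j = 0) (j : ℕ) :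
    partialLead P F i j = partialLead P F i₀ j := by
  induction i, h using Nat.le_induction generalizing j with
  | base => rfl
  | succ i hi₀ ih =>
    have h1 := ih (by omega) fun j h2 h3 => h0 j h2 (by omega)
    have h2 : leadCoef P F i = 0 := by
      rw [← partialLead_of_le hP hF le_rfl (by omega), h1, h0 i hi₀ (by omega)]
    rw [partialLead_succ, h2, h1]
    simp

variable {P F G : (ZMod q)[X]} {Pt : List (ℕ × ℕ)}

/-- The loop finds the nonzero leading coefficients with indices from `i₀` on. The weight function `u`
is such that the weight of an index with updates exceeds the weights of all the entries that it may
create, so that the total weight decreases with each extraction and bounds the number of rounds. -/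
theorem sat_sparseLeadingLoop (hM : ModSetup I W J q M) (hn : 2 * P.natDegree < 2 ^ W)
    (hnd : P.natDegree ≤ 2 ^ d) (hdW : d ≤ W) (hP : P.Monic) (hF : F.degree < P.natDegree)
    {g : ℕ} (hg : 0 < g) (hts : ∀ t ∈ Pt, t.1 + g ≤ P.natDegree ∧ t.2 < q)
    (hs : (Pt.map Prod.fst).Pairwise (· > ·)) (hc : ∀ k < P.natDegree, coefAt q Pt k = P.coeff k)
    {u : ℕ → ℕ} (hu : Antitone u) (hu1 : ∀ i, 1 ≤ u i)
    (hug : ∀ i, i + g < P.natDegree → 1 + Pt.length + Pt.length * u (i + g) ≤ u i)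
    (rounds i₀ : ℕ) (hr : P.natDegree ≤ i₀ + rounds) (V : Trie) (m : ℕ → Option ℕ)
    (hV : TrieRep q P.natDegree d V m) (hm : ∀ j < i₀, m j = none)
    (hent : ∀ j, i₀ ≤ j → j < P.natDegree → entry q m j = partialLead P F i₀ j) :
    Sat (sparseLeadingLoop I M P.natDegree d Pt rounds V)
      (fun L => (L.map Prod.fst).Pairwise (· < ·) ∧
        (∀ l c, (l, c) ∈ L ↔ i₀ ≤ l ∧ l < P.natDegree ∧ leadCoef P F l ≠ 0 ∧
          Rep q c (leadCoef P F l)) ∧ L.length ≤ weight P.natDegree u m)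
      (weight P.natDegree u m * ((4 * d + 20) * J) + (3 * d + 1) * J) := by
  have hB := hM.toBudget
  induction rounds generalizing i₀ V m with
  | zero =>
    rw [sparseLeadingLoop, sat_pure]
    exact ⟨by simp, fun l c => by simp; omega, Nat.zero_le _⟩
  | succ rounds ih =>
    have hd2 : (0 + 1) * 2 ^ d ≤ 2 ^ W := by
      rw [zero_add, one_mul]; exact Nat.pow_le_pow_right (by norm_num) hdW
    rw [sparseLeadingLoop]
    refine (sat_popMin hM d V m hV.models (fun j v h => (hV.lt j v h).2) 0 hd2).bind (by omega) ?_
    rintro _ (⟨rfl, rfl⟩ | ⟨i, v, V', rfl, -, hv, hmin, hV'⟩)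
    · -- All the remaining leading coefficients vanish.
      have h1 : ∀ j, i₀ ≤ j → j < P.natDegree → partialLead P F i₀ j = 0 := fun j h1 h2 => by
        rw [← hent j h1 h2, entry, Trie.models_nil_iff.1 hV.models j (by omega)]
        simp
      simp only
      rw [sat_pure]
      refine ⟨by simp, fun l c => ?_, Nat.zero_le _⟩
      simp only [List.not_mem_nil, false_iff]
      rintro ⟨h2, h3, h4, -⟩
      refine h4 ?_
      rw [← partialLead_of_le hP hF le_rfl h3,
        partialLead_eq_of_zero hP hF h2 h3.le (fun j h5 h6 => h1 j h5 (by omega)), h1 l h2 h3]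
    · simp only [Nat.zero_mul, Nat.zero_add]
      obtain ⟨hin, hvq⟩ := hV.lt i v hv
      have hi₀ : i₀ ≤ i := by
        by_contra! h
        rw [hm i h] at hv
        simp at hv
      have hrun : ∀ j, i₀ ≤ j → j < i → partialLead P F i₀ j = 0 := fun j h1 h2 => by
        rw [← hent j h1 (by omega), entry, hmin j h2]
        simp
      have hpart := fun l (h : l ≤ i) (h' : i₀ ≤ l) => partialLead_eq_of_zero hP hF h' (by omega)
        fun j h5 h6 => hrun j h5 (by omega : j < i)
      have hzero : ∀ l, i₀ ≤ l → l < i → leadCoef P F l = 0 := fun l h1 h2 => by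
        rw [← partialLead_of_le hP hF le_rfl (by omega), hpart l h2.le h1, hrun l h1 h2]
      have hrep : Rep q v (leadCoef P F i) := by
        refine ⟨hvq, ?_⟩
        rw [← partialLead_of_le hP hF le_rfl (by omega), hpart i le_rfl hi₀, ← hent i hi₀ hin,
          entry, hv]
        rfl
      have hw := weight_update_none u hin hv
      set m₁ := Function.update m i none with hm₁
      have hV₁ := hV.erase hV'
      have hm₁0 : ∀ j < i + 1, m₁ j = none := fun j hj => by
        by_cases hji : j = i
        · rw [hji, hm₁, Function.update_self]
        · rw [hm₁, Function.update_of_ne hji]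
          exact hmin j (by omega)
      have hent₁ : ∀ j, i < j → j < P.natDegree → entry q m₁ j = partialLead P F i j :=
        fun j h1 h2 => by
          rw [hpart i le_rfl hi₀, ← hent j (by omega) h2, entry, hm₁,
            Function.update_of_ne (by omega)]
          rfl
      rw [← hw, Nat.add_mul]
      have hui := Nat.mul_le_mul_right ((4 * d + 20) * J) (hu1 i)
      have hc1 : (4 * d + 20) * J = (3 * d + 1) * J + d * J + 19 * J := by ring
      refine Sat.bind_ite (sat_eq hB (hM.lt hvq) (hM.lt hM.pos)) (by omega) (fun h => ?_)
        (fun h => ?_)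
      · have h0 : leadCoef P F i = 0 := (hrep.eq_iff (Rep.zero hM.pos)).1 h
        refine (ih (i + 1) (by omega) V' m₁ hV₁ hm₁0 fun j h1 h2 => ?_).mono (by omega) ?_
        · rw [hent₁ j h1 h2, partialLead_succ, h0]
          simp
        · rintro L ⟨h1, h2, h3⟩
          refine ⟨h1, fun l c => ?_, by omega⟩
          rw [h2]
          refine ⟨fun h => ⟨by omega, h.2⟩, fun h => ⟨?_, h.2⟩⟩
          by_contra! hl
          rcases Nat.lt_or_ge l i with h4 | h4
          · exact h.2.2.1 (hzero l h.1 h4)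
          · exact h.2.2.1 (by rwa [show l = i by omega])
      · have hne : leadCoef P F i ≠ 0 := fun h0 => h ((hrep.eq_iff (Rep.zero hM.pos)).2 h0)
        -- The weight set free by the extraction pays for the updates.
        have hupd : Sat (updateSparse I M P.natDegree d i v Pt V')
            (fun V'' => ∃ m', TrieRep q P.natDegree d V'' m' ∧ (∀ j ≤ i, m' j = m₁ j) ∧
              (∀ j, i < j → j < P.natDegree →
                entry q m' j = partialLead P F (i + 1) j) ∧
              (weight P.natDegree u m' + 1) * ((4 * d + 20) * J) ≤
                (weight P.natDegree u m₁ + u i) * ((4 * d + 20) * J) -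
                (if i + g < P.natDegree then Pt.length * ((d + 18) * J) else 0) ∧
              weight P.natDegree u m' + 1 ≤ weight P.natDegree u m₁ + u i)
            (if i + g < P.natDegree then Pt.length * ((d + 18) * J) else J) := by
          have hnext : ∀ j, i < j → j < P.natDegree → partialLead P F (i + 1) j =
              entry q m₁ j - coefAt q Pt (i + P.natDegree - j) * leadCoef P F i :=
            fun j h1 h2 => by
              rw [partialLead_succ, if_pos h1, hent₁ j h1 h2, hc _ (by omega), mul_comm]
              congr 3
              omega
          split_ifs with hig
          · refine (sat_updateSparse hM hn hnd hdW hu hg hin hrep Pt hts hs V' m₁ hV₁).mono le_rfl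
              ?_
            rintro V'' ⟨m', h1, h2, h3, h4⟩
            have h5 := hug i hig
            refine ⟨m', h1, h2, fun j h6 h7 => by rw [h3 j h6 h7, hnext j h6 h7], ?_, by omega⟩
            have h6 : (weight P.natDegree u m' + 1 + Pt.length) * ((4 * d + 20) * J) ≤
                (weight P.natDegree u m₁ + u i) * ((4 * d + 20) * J) :=
              Nat.mul_le_mul_right _ (by omega)
            have h7 : Pt.length * ((d + 18) * J) ≤ Pt.length * ((4 * d + 20) * J) :=
              Nat.mul_le_mul_left _ (Nat.mul_le_mul_right _ (by omega))
            rw [Nat.add_mul] at h6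
            omega
          · refine (sat_updateSparse_of_le hM hn hin (by omega) Pt (fun t ht => (hts t ht).1)
              V').mono le_rfl ?_
            rintro _ rfl
            have h5 := hu1 i
            refine ⟨m₁, hV₁, fun _ _ => rfl, fun j h6 h7 => ?_, ?_, by omega⟩
            · rw [hnext j h6 h7, coefAt_eq_zero, zero_mul, sub_zero]
              intro t ht
              have := (hts t ht).1
              omega
            · exact Nat.mul_le_mul_right _ (by omega)
        have h7 : (if i + g < P.natDegree then Pt.length * ((d + 18) * J) else 0) +
            (4 * d + 20) * J ≤ u i * ((4 * d + 20) * J) := by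
          split_ifs with hig
          · have h5 := Nat.mul_le_mul_right ((4 * d + 20) * J) (hug i hig)
            have h6 : Pt.length * ((d + 18) * J) ≤ Pt.length * ((4 * d + 20) * J) :=
              Nat.mul_le_mul_left _ (Nat.mul_le_mul_right _ (by omega))
            rw [Nat.add_mul, Nat.add_mul] at h5
            omega
          · omega
        have h8 : (if i + g < P.natDegree then Pt.length * ((d + 18) * J) else J) ≤
            (if i + g < P.natDegree then Pt.length * ((d + 18) * J) else 0) + J := by
          split_ifs <;> omega
        refine hupd.bind (by omega) ?_
        rintro V'' ⟨m', h1, h2, h3, h4, h5⟩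
        rw [Nat.add_mul _ 1, Nat.add_mul _ (u i), one_mul] at h4
        refine (ih (i + 1) (by omega) V'' m' h1 (fun j hj => (h2 j (by omega)).trans (hm₁0 j hj))
          h3).bind (by omega) ?_
        rintro L ⟨g1, g2, g3⟩
        rw [sat_pure]
        refine ⟨?_, fun l c => ?_, by rw [List.length_cons]; omega⟩
        · rw [List.map_cons, List.pairwise_cons]
          refine ⟨fun l hl => ?_, g1⟩
          obtain ⟨⟨l, c⟩, ht, rfl⟩ := List.mem_map.1 hl
          exact ((g2 l c).1 ht).1
        · rw [List.mem_cons, g2]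
          constructor
          · rintro (h | h)
            · obtain ⟨rfl, rfl⟩ := Prod.mk.inj h
              exact ⟨hi₀, hin, hne, hrep⟩
            · exact ⟨by omega, h.2⟩
          · rintro ⟨f1, f2, f3, f4⟩
            rcases Nat.lt_trichotomy l i with h | rfl | h
            · exact absurd (hzero l f1 h) f3
            · exact Or.inl (by rw [(f4.eq_iff hrep).2 rfl])
            · exact Or.inr ⟨h, f2, f3, f4⟩

end SparseVector

/-! ### Modular evaluation of a product of sparse polynomials -/

section SparseEvaluation

variable {I : ℕ → ℕ} {W J q : ℕ} {M : Modulus}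

theorem sat_mergeTerms (hM : ModSetup I W J q M) (f g : ℕ → ZMod q) (L G : List (ℕ × ℕ))
    (hL : ∀ t ∈ L, t.1 < 2 ^ W ∧ Rep q t.2 (f t.1)) (hG : ∀ t ∈ G, t.1 < 2 ^ W ∧ Rep q t.2 (g t.1))
    (hf : ∀ t ∈ G, t.1 ∉ L.map Prod.fst → f t.1 = 0)
    (hg : ∀ t ∈ L, t.1 ∉ G.map Prod.fst → g t.1 = 0)
    (hLs : (L.map Prod.fst).Pairwise (· < ·)) (hGs : (G.map Prod.fst).Pairwise (· < ·)) :
    Sat (mergeTerms L G)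
      (fun R => (R.map Prod.fst).Pairwise (· < ·) ∧
        (∀ l, l ∈ R.map Prod.fst ↔ l ∈ L.map Prod.fst ∨ l ∈ G.map Prod.fst) ∧
        (∀ t ∈ R, Rep q t.2.1 (f t.1) ∧ Rep q t.2.2 (g t.1)) ∧ R.length ≤ L.length + G.length)
      ((L.length + G.length) * (2 * J)) := by
  have hB := hM.toBudget
  have hJ := hB.lin
  induction L, G using mergeTerms.induct with
  | case1 => simp [mergeTerms]
  | case2 i v L ih =>
    rw [List.map_cons, List.pairwise_cons] at hLs
    rw [mergeTerms]
    simp only [List.length_cons, List.length_nil, Nat.add_zero, Nat.succ_mul _ (2 * J)] at ih ⊢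
    refine (ih (fun t ht => hL t (by simp [ht])) hG (by simp) (fun t ht => hg t (by simp [ht]))
      hLs.2 hGs).bind (by omega) ?_
    rintro R ⟨h1, h2, h3, h4⟩
    refine ⟨by omega, ?_, fun l => ?_, ?_, ?_⟩
    · rw [List.map_cons, List.pairwise_cons]
      exact ⟨fun l hl => hLs.1 l (by simpa using (h2 l).1 hl), h1⟩
    · rw [List.map_cons, List.mem_cons, h2]; simp
    · refine List.forall_mem_cons.2 ⟨⟨(hL (i, v) (by simp)).2, ?_⟩, h3⟩
      rw [hg (i, v) (by simp) (by simp)]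
      exact Rep.zero hM.pos
    · rw [List.length_cons]; omega
  | case3 j c G ih =>
    rw [List.map_cons, List.pairwise_cons] at hGs
    rw [mergeTerms]
    simp only [List.length_cons, List.length_nil, Nat.zero_add, Nat.succ_mul _ (2 * J)] at ih ⊢
    refine (ih hL (fun t ht => hG t (by simp [ht])) (fun t ht => hf t (by simp [ht])) (by simp)
      hLs hGs.2).bind (by omega) ?_
    rintro R ⟨h1, h2, h3, h4⟩
    refine ⟨by omega, ?_, fun l => ?_, ?_, ?_⟩
    · rw [List.map_cons, List.pairwise_cons]
      exact ⟨fun l hl => hGs.1 l (by simpa using (h2 l).1 hl), h1⟩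
    · rw [List.map_cons, List.mem_cons, h2]; simp
    · refine List.forall_mem_cons.2 ⟨⟨?_, (hG (j, c) (by simp)).2⟩, h3⟩
      rw [hf (j, c) (by simp) (by simp)]
      exact Rep.zero hM.pos
    · rw [List.length_cons]; omega
  | case4 i v L j c G ih1 ih2 ih3 =>
    have hi := hL (i, v) (by simp)
    have hj := hG (j, c) (by simp)
    have hLs' := hLs
    have hGs' := hGs
    rw [List.map_cons, List.pairwise_cons] at hLs' hGs'
    simp only at hi hj hLs' hGs'
    rw [mergeTerms]
    simp only [List.length_cons] at ih1 ih2 ih3 ⊢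
    have hc : (L.length + 1 + (G.length + 1)) * (2 * J) =
      (L.length + G.length) * (2 * J) + 4 * J := by ring
    have hc1 : (L.length + (G.length + 1)) * (2 * J) =
      (L.length + G.length) * (2 * J) + 2 * J := by ring
    have hc2 : (L.length + 1 + G.length) * (2 * J) =
      (L.length + G.length) * (2 * J) + 2 * J := by ring
    refine Sat.bind_ite (sat_lt hB hi.1 hj.1) (by omega) (fun h => ?_) (fun h => ?_)
    · refine (ih1 (fun t ht => hL t (by simp [ht])) hG (fun t ht h' => hf t ht ?_)
        (fun t ht => hg t (by simp [ht])) hLs'.2 hGs).bind (by omega) ?_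
      · rw [List.map_cons, List.mem_cons, not_or]
        refine ⟨?_, h'⟩
        rcases List.mem_cons.1 ht with rfl | ht
        · simp only; omega
        · have := hGs'.1 _ (List.mem_map_of_mem ht)
          simp only; omega
      rintro R ⟨h1, h2, h3, h4⟩
      have hlt : ∀ l ∈ G.map Prod.fst, i < l := fun l hl => h.trans (hGs'.1 l hl)
      rw [sat_pure]
      refine ⟨?_, fun l => ?_, ?_, ?_⟩
      · rw [List.map_cons, List.pairwise_cons]
        refine ⟨fun l hl => ?_, h1⟩
        rcases (h2 l).1 hl with h5 | h5
        · exact hLs'.1 l h5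
        · rw [List.map_cons, List.mem_cons] at h5
          rcases h5 with rfl | h5
          · exact h
          · exact hlt l h5
      · simp only [List.map_cons, List.mem_cons, h2, or_assoc]
      · refine List.forall_mem_cons.2 ⟨⟨hi.2, ?_⟩, h3⟩
        rw [hg (i, v) (by simp)]
        · exact Rep.zero hM.pos
        · rw [List.map_cons, List.mem_cons, not_or]
          exact ⟨h.ne, fun h5 => (hlt i h5).false⟩
      · rw [List.length_cons]; omega
    refine Sat.bind_ite (sat_lt hB hj.1 hi.1) (by omega) (fun h' => ?_) (fun h' => ?_)
    · refine (ih2 hL (fun t ht => hG t (by simp [ht])) (fun t ht => hf t (by simp [ht]))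
        (fun t ht h' => hg t ht ?_) hLs hGs'.2).bind (by omega) ?_
      · rw [List.map_cons, List.mem_cons, not_or]
        refine ⟨?_, h'⟩
        rcases List.mem_cons.1 ht with rfl | ht
        · simp only; omega
        · have := hLs'.1 _ (List.mem_map_of_mem ht)
          simp only; omega
      rintro R ⟨h1, h2, h3, h4⟩
      have hlt : ∀ l ∈ L.map Prod.fst, j < l := fun l hl => h'.trans (hLs'.1 l hl)
      rw [sat_pure]
      refine ⟨?_, fun l => ?_, ?_, ?_⟩
      · rw [List.map_cons, List.pairwise_cons]
        refine ⟨fun l hl => ?_, h1⟩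
        rcases (h2 l).1 hl with h5 | h5
        · rw [List.map_cons, List.mem_cons] at h5
          rcases h5 with rfl | h5
          · exact h'
          · exact hlt l h5
        · exact hGs'.1 l h5
      · simp only [List.map_cons, List.mem_cons, h2, or_left_comm]
      · refine List.forall_mem_cons.2 ⟨⟨?_, hj.2⟩, h3⟩
        rw [hf (j, c) (by simp)]
        · exact Rep.zero hM.pos
        · rw [List.map_cons, List.mem_cons, not_or]
          exact ⟨h'.ne, fun h5 => (hlt j h5).false⟩
      · rw [List.length_cons]; omega
    · obtain rfl : i = j := by omega
      refine (ih3 (fun t ht => hL t (by simp [ht])) (fun t ht => hG t (by simp [ht]))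
        (fun t ht h' => hf t (by simp [ht]) ?_) (fun t ht h' => hg t (by simp [ht]) ?_)
        hLs'.2 hGs'.2).bind (by omega) ?_
      · rw [List.map_cons, List.mem_cons, not_or]
        exact ⟨(hGs'.1 _ (List.mem_map_of_mem ht)).ne', h'⟩
      · rw [List.map_cons, List.mem_cons, not_or]
        exact ⟨(hLs'.1 _ (List.mem_map_of_mem ht)).ne', h'⟩
      rintro R ⟨h1, h2, h3, h4⟩
      rw [sat_pure]
      refine ⟨?_, fun l => ?_, List.forall_mem_cons.2 ⟨⟨hi.2, hj.2⟩, h3⟩, ?_⟩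
      · rw [List.map_cons, List.pairwise_cons]
        exact ⟨fun l hl => ((h2 l).1 hl).elim (hLs'.1 l) (hGs'.1 l), h1⟩
      · rw [List.map_cons, List.mem_cons, h2, List.map_cons, List.map_cons, List.mem_cons,
          List.mem_cons]
        exact or_or_distrib_left
      · rw [List.length_cons]; omega

variable {P F G : (ZMod q)[X]}

/-- A run of vanishing leading coefficients is passed by a power of the evaluation point. -/
theorem eval_shiftMod_add (hP : P.Monic) (hn : 0 < P.natDegree) (a : ZMod q) (i t : ℕ)
    (h0 : ∀ l, i < l → l ≤ i + t → leadCoef P F l = 0) :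
    eval a (shiftMod P F (i + 1 + t)) =
      a ^ t * (a * eval a (shiftMod P F i) - leadCoef P F i * eval a P) := by
  induction t with
  | zero => simp [eval_shiftMod_succ hP hn]
  | succ t ih =>
    rw [← add_assoc, eval_shiftMod_succ hP hn, ih fun l h1 h2 => h0 l h1 (by omega),
      h0 (i + 1 + t) (by omega) (by omega), pow_succ]
    ring

theorem sat_sparseEvalLoop (hM : ModSetup I W J q M) (hn : 2 * P.natDegree < 2 ^ W) (hP : P.Monic)
    {x Px d : ℕ} {a : ZMod q} (hd : P.natDegree.size ≤ d) (hx : Rep q x a)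
    (hPx : Rep q Px (eval a P)) (ts : List (ℕ × ℕ × ℕ)) (i v Fx res : ℕ) (r : ZMod q)
    (hs : (ts.map Prod.fst).Pairwise (· < ·))
    (hts : ∀ t ∈ ts, i ≤ t.1 ∧ t.1 < P.natDegree ∧ Rep q t.2.1 (leadCoef P F t.1) ∧
      Rep q t.2.2 (G.coeff t.1))
    (hmiss : ∀ l, i < l → l < P.natDegree → l ∉ ts.map Prod.fst → leadCoef P F l = 0)
    (hv : i ∈ ts.map Prod.fst ∨ Rep q v (leadCoef P F i))
    (hFx : Rep q Fx (eval a (shiftMod P F i))) (hres : Rep q res r) :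
    Sat (sparseEvalLoop I M x Px ts i v Fx res)
      (Rep q · (r + (ts.map fun t => G.coeff t.1 * eval a (shiftMod P F t.1)).sum))
      (ts.length * ((14 * d + 39) * J)) := by
  have hB := hM.toBudget
  induction ts generalizing i v Fx res r with
  | nil => simpa [sparseEvalLoop] using hres
  | cons t ts ih =>
    obtain ⟨j, vj, g⟩ := t
    have hj := hts (j, vj, g) (by simp)
    rw [List.map_cons, List.pairwise_cons] at hs
    simp only at hj hs
    have h1W : 1 < 2 ^ W := hM.lt (by have := hM.two_le; omega)
    have hc : (14 * d + 39) * J = (14 * d + 1) * J + 38 * J := by ring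
    rw [sparseEvalLoop, List.length_cons, Nat.succ_mul, List.map_cons, List.sum_cons, ← add_assoc]
    have hnext : ∀ Fx res, Rep q Fx (eval a (shiftMod P F j)) →
        Rep q res (r + G.coeff j * eval a (shiftMod P F j)) →
        Sat (sparseEvalLoop I M x Px ts j vj Fx res)
          (Rep q · (r + G.coeff j * eval a (shiftMod P F j) +
            (ts.map fun t => G.coeff t.1 * eval a (shiftMod P F t.1)).sum))
          (ts.length * ((14 * d + 39) * J)) := by
      intro Fx res hFx hres
      refine ih j vj Fx res _ hs.2 (fun t ht => ?_) (fun l h1 h2 h3 => ?_) (Or.inr hj.2.2.1) hFx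
        hres
      · exact ⟨(hs.1 _ (List.mem_map_of_mem ht)).le, (hts t (by simp [ht])).2⟩
      · refine hmiss l (by omega) h2 ?_
        rw [List.map_cons, List.mem_cons, not_or]
        exact ⟨h1.ne', h3⟩
    refine Sat.bind_ite (sat_eq hB (by omega) (by omega)) (by omega) (fun h => ?_) (fun h => ?_)
    · subst h
      refine (sat_mulMod hM hFx hj.2.2.2).bind (by omega) fun w hw => ?_
      refine (sat_addMod hM hres hw).bind (by omega) fun res' hres' => ?_
      rw [mul_comm] at hres'
      exact (hnext Fx res' hFx hres').mono_cost (by omega)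
    · have hv' : Rep q v (leadCoef P F i) := by
        refine hv.resolve_left ?_
        rw [List.map_cons, List.mem_cons, not_or]
        exact ⟨h, fun h' => by have := hs.1 i h'; omega⟩
      refine (sat_sub hB (by omega) (by omega)).bind (by omega) ?_
      rintro _ rfl
      refine (sat_sub hB (by omega) h1W).bind (by omega) ?_
      rintro _ rfl
      refine (sat_mulMod hM hx hFx).bind (by omega) fun y hy => ?_
      refine (sat_mulMod hM hv' hPx).bind (by omega) fun z hz => ?_
      refine (sat_subMod hM hy hz).bind (by omega) fun y' hy' => ?_
      have hes : (14 * (j - i - 1).size + 1) * J ≤ (14 * d + 1) * J := by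
        have := (Nat.size_le_size (show j - i - 1 ≤ P.natDegree by omega)).trans hd
        exact Nat.mul_le_mul_right _ (by omega)
      refine (sat_powMod hM hx (by omega)).bind (by omega) fun u hu => ?_
      refine (sat_mulMod hM hu hy').bind (by omega) fun Fx' hFx' => ?_
      rw [← eval_shiftMod_add hP (by omega), show i + 1 + (j - i - 1) = j by omega] at hFx'
      · refine (sat_mulMod hM hFx' hj.2.2.2).bind (by omega) fun w hw => ?_
        refine (sat_addMod hM hres hw).bind (by omega) fun res' hres' => ?_
        rw [mul_comm] at hres'
        exact (hnext Fx' res' hFx' hres').mono_cost (by omega)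
      · intro l h1 h2
        refine hmiss l h1 (by omega) ?_
        rw [List.map_cons, List.mem_cons, not_or]
        exact ⟨by simp only; omega, fun h' => by have := hs.1 l h'; omega⟩

/-- Up to a factor, the number of entries that an entry with index `j` can give rise to: each entry
changes at most `r` others, whose indices exceed its own by at least `g`. -/
def growth (n g r j : ℕ) : ℕ := 2 * (r + 1) ^ ((n - 1 - j) / g) - 1

theorem one_le_growth (n g r j : ℕ) : 1 ≤ growth n g r j := by
  have : 0 < (r + 1) ^ ((n - 1 - j) / g) := by positivity
  rw [growth]
  omega

theorem growth_antitone (n g r : ℕ) : Antitone (growth n g r) := fun i j h =>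
  Nat.sub_le_sub_right (Nat.mul_le_mul_left _ (Nat.pow_le_pow_right (by omega)
    (Nat.div_le_div_right (by omega)))) _

theorem growth_step {n g r i : ℕ} (hg : 0 < g) (h : i + g < n) :
    1 + r + r * growth n g r (i + g) ≤ growth n g r i := by
  have h1 : (n - 1 - i) / g = (n - 1 - (i + g)) / g + 1 := by
    rw [show n - 1 - i = n - 1 - (i + g) + g by omega, Nat.add_div_right _ hg]
  rw [growth, growth, h1, pow_succ]
  set y := (r + 1) ^ ((n - 1 - (i + g)) / g) with hy
  have hpos : 0 < y := by positivity
  rw [Nat.mul_sub, mul_one]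
  have h2 : 2 * (y * (r + 1)) = r * (2 * y) + 2 * y := by ring
  have h3 : r ≤ r * (2 * y) := Nat.le_mul_of_pos_right _ (by omega)
  omega

/-- The exponent counts how often an index can be raised by the gap `g` before it reaches the degree
of `P`. -/
theorem sat_sparseModularEval (hM : ModSetup I W J q M) (hn0 : 0 < P.natDegree)
    (hn : 2 * P.natDegree < 2 ^ W) (hP : P.Monic) (hF : F.degree < P.natDegree)
    (hG : G.degree < P.natDegree) {Pl Fl Gl : List (ℕ × ℕ)} (hPl : SparseRep q Pl P)
    (hPs : (Pl.map Prod.fst).Pairwise (· > ·)) (hFl : SparseRep q Fl F) (hGl : SparseRep q Gl G)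
    (hGs : (Gl.map Prod.fst).Pairwise (· < ·)) {g : ℕ} (hg : 0 < g)
    (hgap : ∀ t ∈ Pl.tail, t.1 + g ≤ P.natDegree) {T : ℕ} (hFT : Fl.length ≤ T)
    (hGT : Gl.length ≤ T) {x : ℕ} {a : ZMod q} (hx : Rep q x a) :
    Sat (sparseModularEval I M Pl Fl Gl x) (Rep q · (eval a ((F * G) %ₘ P)))
      (170 * (T * (2 * Pl.length ^ ((P.natDegree - 1) / g)) + Pl.length) *
        (P.natDegree.size * J)) := by
  have hB := hM.toBudget
  have : Fact (1 < q) := ⟨by have := hM.two_le; omega⟩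
  obtain ⟨c, Pt, hPt, hts, hs, hcoef⟩ := hPl.eq_cons hM.two_le hPs hP
  have hhead : leadExp Pl = P.natDegree := by rw [hPt]; rfl
  have htail : Pl.tail = Pt := by rw [hPt]; rfl
  have hlen : Pl.length = Pt.length + 1 := by rw [hPt, List.length_cons]
  rw [htail] at hgap
  have hdeg : ∀ {A : (ZMod q)[X]} {l : List (ℕ × ℕ)}, SparseRep q l A → A.natDegree ≤ P.natDegree →
      ∀ t ∈ l, t.1 < 2 ^ W ∧ t.1.size ≤ P.natDegree.size ∧ t.2 < q := fun hl hA t ht => by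
    have h1 := (le_natDegree_of_ne_zero (hl.coeff_ne_zero ht)).trans hA
    exact ⟨by omega, Nat.size_le_size h1, hl.lt ht⟩
  have hlt : ∀ {A : (ZMod q)[X]} {l : List (ℕ × ℕ)}, SparseRep q l A → A.degree < P.natDegree →
      ∀ t ∈ l, t.1 < P.natDegree := fun hl hA t ht => by
    by_contra! h
    exact hl.coeff_ne_zero ht (coeff_eq_zero_of_degree_lt (hA.trans_le (by exact_mod_cast h)))
  have hPx := sat_evalSparse hM hx Pl (hdeg hPl le_rfl)
  have hFx := sat_evalSparse hM hx Fl (hdeg hFl (natDegree_le_of_degree_le hF.le))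
  rw [hPl.sum_eval hM.pos] at hPx
  rw [hFl.sum_eval hM.pos, ← shiftMod_zero hP hF] at hFx
  have hdW : P.natDegree.size ≤ W := Nat.size_le.2 (by omega)
  have hd1 : 1 ≤ P.natDegree.size := Nat.size_pos.2 hn0
  have hnd : P.natDegree ≤ 2 ^ P.natDegree.size := (Nat.lt_size_self _).le
  set N := P.natDegree with hN
  set d := N.size with hd
  set u := growth N g Pt.length with hu
  have hU : u 0 ≤ 2 * Pl.length ^ ((N - 1) / g) := by
    rw [hu, growth, hlen, Nat.sub_zero]
    omega
  set U := 2 * Pl.length ^ ((N - 1) / g) with hU'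
  have hU1 : 1 ≤ U := (one_le_growth _ _ _ _).trans hU
  -- Every contribution to the cost is bounded by multiples of the following products.
  have hTU : T ≤ T * U := Nat.le_mul_of_pos_right _ hU1
  have hFU : Fl.length * u 0 ≤ T * U := Nat.mul_le_mul hFT hU
  have hcost : 170 * (T * U + Pl.length) * (d * J) =
      170 * ((T * U) * (d * J)) + 170 * (Pl.length * (d * J)) := by ring
  have hJ1 : J ≤ d * J := Nat.le_mul_of_pos_left _ hd1
  have hP1 : d * J ≤ Pl.length * (d * J) := Nat.le_mul_of_pos_left _ (by omega)
  have key : ∀ {s b e : ℕ}, s ≤ b → e ≤ 170 * d → ∀ k, e ≤ k * d → s * (e * J) ≤ k * (b * (d * J)) :=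
    fun {s b e} h1 _ k h3 => by
      calc s * (e * J) ≤ b * ((k * d) * J) :=
            Nat.mul_le_mul h1 (Nat.mul_le_mul_right _ h3)
        _ = _ := by ring
  have hc1 : Fl.length * ((d + 6) * J) ≤ 7 * ((T * U) * (d * J)) :=
    key (hFT.trans hTU) (by omega) 7 (by omega)
  have hc2 : (Fl.length * u 0) * ((4 * d + 20) * J) ≤ 24 * ((T * U) * (d * J)) :=
    key hFU (by omega) 24 (by omega)
  have hc3 : (3 * d + 1) * J ≤ 4 * (Pl.length * (d * J)) := by
    have : (3 * d + 1) * J = 3 * (d * J) + J := by ring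
    omega
  have hc4 : Pl.length * ((14 * d + 11) * J) ≤ 25 * (Pl.length * (d * J)) :=
    key le_rfl (by omega) 25 (by omega)
  have hc5 : Fl.length * ((14 * d + 11) * J) ≤ 25 * ((T * U) * (d * J)) :=
    key (hFT.trans hTU) (by omega) 25 (by omega)
  rw [sparseModularEval, hhead, htail]
  have hlead : Sat (sparseLeadingCoefficients I M N Pt Fl)
      (fun L => (L.map Prod.fst).Pairwise (· < ·) ∧
        (∀ l c, (l, c) ∈ L ↔ l < N ∧ leadCoef P F l ≠ 0 ∧ Rep q c (leadCoef P F l)) ∧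
        L.length ≤ T * U)
      (31 * ((T * U) * (d * J)) + 5 * (Pl.length * (d * J))) := by
    rw [sparseLeadingCoefficients]
    refine (sat_len hB (by omega)).bind (by omega) ?_
    rintro _ rfl
    refine (sat_sparseInit hM hn hnd hdW u (growth_antitone _ _ _) Fl
      (fun t ht => ⟨hlt hFl hF t ht, hFl.lt ht⟩) Trie.nil (fun _ => none)
      ⟨Trie.models_nil_iff.2 fun _ _ => rfl, by simp⟩).bind (by omega) ?_
    rintro V ⟨m, hV, hm, hw⟩
    have hw0 : weight N u (fun _ => none) = 0 := by simp [weight]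
    rw [hw0, zero_add] at hw
    have hw' : weight N u m * ((4 * d + 20) * J) ≤ 24 * ((T * U) * (d * J)) :=
      (Nat.mul_le_mul_right _ hw).trans hc2
    refine (sat_sparseLeadingLoop hM hn hnd hdW hP hF hg
      (fun t ht => ⟨hgap t ht, (hts t ht).2⟩) hs hcoef (u := u)
      (growth_antitone _ _ _) (one_le_growth _ _ _) (fun i => growth_step hg) N 0 (by omega) V m hV (by omega)
      fun j _ hj => ?_).mono (by rw [← hN]; omega) ?_
    · rw [hm j hj, partialLead_zero, hFl.coefAt_eq hM.pos]
      simp [entry]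
      rfl
    · rintro L ⟨h1, h2, h3⟩
      refine ⟨h1, fun l c => by rw [h2, ← hN]; simp, h3.trans (hw.trans hFU)⟩
  refine hlead.bind (by omega) ?_
  rintro L ⟨hLs, hLmem, hLlen⟩
  refine hPx.bind (by omega) fun Px hPx => ?_
  refine hFx.bind (by omega) fun Fx hFx => ?_
  have hLG : L.length + Gl.length ≤ 2 * (T * U) := by omega
  have hc6 : (L.length + Gl.length) * (2 * J) ≤ 4 * ((T * U) * (d * J)) := by
    refine (key hLG (by omega) 2 (by omega)).trans_eq ?_
    ring
  have hmemL : ∀ l < N, l ∉ L.map Prod.fst → leadCoef P F l = 0 := fun l hl h => by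
    by_contra h0
    have : NeZero q := ⟨hM.pos.ne'⟩
    exact h (List.mem_map.2 ⟨(l, (leadCoef P F l).val),
      (hLmem l _).2 ⟨hl, h0, ZMod.val_lt _, by simp⟩, rfl⟩)
  have hmemG : ∀ l, l ∉ Gl.map Prod.fst → G.coeff l = 0 := fun l h => by
    rw [← List.mem_toFinset, hGl.toFinset hM.pos] at h
    exact notMem_support_iff.1 h
  refine (sat_mergeTerms hM (leadCoef P F) G.coeff L Gl (fun t ht => ?_) (fun t ht => ?_)
    (fun t ht h => hmemL _ (hlt hGl hG t ht) h) (fun t ht h => hmemG _ h) hLs hGs).bind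
    (by omega) ?_
  · have := (hLmem t.1 t.2).1 ht
    exact ⟨by omega, this.2.2⟩
  · have := hlt hGl hG t ht
    exact ⟨by omega, ((hGl.mem_iff t.1 t.2).1 ht).2⟩
  rintro R ⟨hRs, hRmem, hR, hRlen⟩
  have hRlt : ∀ t ∈ R, t.1 < N := fun t ht => by
    rcases (hRmem t.1).1 (List.mem_map_of_mem ht) with h | h
    · obtain ⟨s, hs, h⟩ := List.mem_map.1 h
      rw [← h]
      exact ((hLmem s.1 s.2).1 hs).1
    · obtain ⟨s, hs, h⟩ := List.mem_map.1 h
      rw [← h]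
      exact hlt hGl hG s hs
  have hc7 : R.length * ((14 * d + 39) * J) ≤ 106 * ((T * U) * (d * J)) := by
    refine (key (hRlen.trans hLG) (by omega) 53 (by omega)).trans_eq ?_
    ring
  refine (sat_sparseEvalLoop hM hn hP hd.ge hx hPx R 0 0 Fx 0 0 hRs
    (fun t ht => ⟨Nat.zero_le _, hRlt t ht, hR t ht⟩) (fun l _ h2 h3 => hmemL l h2 fun h =>
      h3 ((hRmem l).2 (Or.inl h))) ?_ hFx (Rep.zero hM.pos)).mono (by omega) fun r hr => ?_
  · by_cases h : 0 ∈ R.map Prod.fst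
    · exact Or.inl h
    · rw [hmemL 0 hn0 fun h' => h ((hRmem 0).2 (Or.inl h'))]
      exact Or.inr (Rep.zero hM.pos)
  · have hnodup : (R.map Prod.fst).Nodup := hRs.imp fun h => h.ne
    have hsum : (R.map fun t => G.coeff t.1 * eval a (shiftMod P F t.1)).sum =
        ∑ i ∈ Finset.range N, G.coeff i * eval a (shiftMod P F i) := by
      have h1 := List.sum_toFinset (fun i => G.coeff i * eval a (shiftMod P F i)) hnodup
      rw [List.map_map] at h1
      refine h1.symm.trans (Finset.sum_subset (fun i hi => ?_) fun i _ hi => ?_)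
      · obtain ⟨t, ht, rfl⟩ := List.mem_map.1 (List.mem_toFinset.1 hi)
        exact Finset.mem_range.2 (hRlt t ht)
      · rw [hmemG i fun h => hi (List.mem_toFinset.2 ((hRmem i).2 (Or.inr h))), zero_mul]
    rw [eval_mul_modByMonic hG, ← hsum]
    simpa using hr

end SparseEvaluation

/-! ### Sparsity and norm of a product modulo `P` -/

section FoldStep

variable {R : Type*} [CommRing R] {P : R[X]}

/-- One step of the reduction of `A` modulo a polynomial `P` of degree `n`: the powers `X ^ (n + i)`
in `A` are replaced by `-X ^ i * (P - X ^ n)`. -/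
noncomputable def foldStep (P A : R[X]) : R[X] :=
  A %ₘ X ^ P.natDegree - (A /ₘ X ^ P.natDegree) * (P - X ^ P.natDegree)

theorem foldStep_modByMonic (hP : P.Monic) (A : R[X]) : foldStep P A %ₘ P = A %ₘ P := by
  refine modByMonic_eq_of_dvd_sub hP ⟨-(A /ₘ X ^ P.natDegree), ?_⟩
  have h := modByMonic_add_div A (X ^ P.natDegree)
  rw [foldStep]
  linear_combination h

theorem natDegree_foldStep_lt [Nontrivial R] {g e : ℕ} (hn : 0 < P.natDegree)
    (hg : 0 < g)
    (hgap : (P - X ^ P.natDegree).natDegree + g ≤ P.natDegree) {A : R[X]}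
    (hA : A.natDegree < P.natDegree + (e + 1) * g) :
    (foldStep P A).natDegree < P.natDegree + e * g := by
  rw [Nat.succ_mul] at hA
  refine (natDegree_sub_le _ _).trans_lt (max_lt ?_ ?_)
  · have := natDegree_modByMonic_lt A (monic_X_pow P.natDegree)
      (fun h => by have := congrArg natDegree h; simp at this; omega)
    rw [natDegree_X_pow] at this
    omega
  · have h1 := natDegree_mul_le (p := A /ₘ X ^ P.natDegree) (q := P - X ^ P.natDegree)
    rw [natDegree_divByMonic _ (monic_X_pow _), natDegree_X_pow] at h1
    omega

/-- A measure of polynomials that grows at most by a factor `c` in each step of the reduction grows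
at most by `c ^ e` if `e` steps reduce the polynomial completely. -/
theorem le_mul_pow_of_foldStep [Nontrivial R] (hP : P.Monic) (hn : 0 < P.natDegree) {g : ℕ}
    (hg : 0 < g) (hgap : (P - X ^ P.natDegree).natDegree + g ≤ P.natDegree) {φ : R[X] → ℕ} {c : ℕ}
    (hφ : ∀ A, φ (foldStep P A) ≤ φ A * c) (e : ℕ) (A : R[X])
    (hA : A.natDegree < P.natDegree + e * g) : φ (A %ₘ P) ≤ φ A * c ^ e := by
  induction e generalizing A with
  | zero =>
    rw [(modByMonic_eq_self_iff hP).2 (degree_lt_degree (by omega)), pow_zero, mul_one]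
  | succ e ih =>
    rw [← foldStep_modByMonic hP]
    calc _ ≤ φ (foldStep P A) * c ^ e := ih _ (natDegree_foldStep_lt hn hg hgap hA)
      _ ≤ φ A * c * c ^ e := Nat.mul_le_mul_right _ (hφ A)
      _ = _ := by rw [pow_succ]; ring

theorem coeff_divByMonic_X_pow (A : R[X]) (n j : ℕ) : (A /ₘ X ^ n).coeff j = A.coeff (j + n) := by
  nontriviality R
  have h := congrArg (coeff · (j + n)) (modByMonic_add_div A (X ^ n))
  simp only [coeff_add] at h
  rw [coeff_eq_zero_of_degree_lt, zero_add, mul_comm, coeff_mul_X_pow] at h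
  · exact h
  · refine (degree_modByMonic_lt A (monic_X_pow n)).trans_le ?_
    rw [degree_X_pow]
    exact_mod_cast Nat.le_add_left _ _

theorem coeff_modByMonic_X_pow (A : R[X]) (n j : ℕ) :
    (A %ₘ X ^ n).coeff j = if j < n then A.coeff j else 0 := by
  nontriviality R
  split_ifs with hj
  · have h := congrArg (coeff · j) (modByMonic_add_div A (X ^ n))
    simp only [coeff_add] at h
    rwa [coeff_X_pow_mul', if_neg (by omega), add_zero] at h
  · refine coeff_eq_zero_of_degree_lt ((degree_modByMonic_lt A (monic_X_pow n)).trans_le ?_)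
    rw [degree_X_pow]
    exact_mod_cast not_lt.1 hj

theorem card_support_foldStep_le (hP : P - X ^ P.natDegree ≠ 0) (A : R[X]) :
    (foldStep P A).support.card ≤ A.support.card * (P - X ^ P.natDegree).support.card := by
  classical
  set n := P.natDegree
  have hr : 1 ≤ (P - X ^ n).support.card := Finset.card_pos.2 (nonempty_support_iff.2 hP)
  have h1 : (A %ₘ X ^ n).support.card + (A /ₘ X ^ n).support.card ≤ A.support.card := by
    rw [← Finset.card_map (s := (A /ₘ X ^ n).support) (addRightEmbedding n), ← Finset.card_union_of_disjoint]
    · refine Finset.card_le_card fun j hj => ?_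
      rcases Finset.mem_union.1 hj with h | h
      · rw [mem_support_iff, coeff_modByMonic_X_pow] at h
        exact mem_support_iff.2 fun h0 => h (by simp [h0])
      · obtain ⟨i, hi, rfl⟩ := Finset.mem_map.1 h
        rw [mem_support_iff, coeff_divByMonic_X_pow] at hi
        exact mem_support_iff.2 hi
    · refine Finset.disjoint_left.2 fun j h h' => ?_
      obtain ⟨i, -, rfl⟩ := Finset.mem_map.1 h'
      rw [mem_support_iff, coeff_modByMonic_X_pow, addRightEmbedding_apply,
        if_neg (by omega)] at h
      exact h rfl
  calc _ ≤ ((A %ₘ X ^ n).support ∪ ((A /ₘ X ^ n) * (P - X ^ n)).support).card :=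
        Finset.card_le_card (by
          rw [foldStep, sub_eq_add_neg, ← support_neg (p := (A /ₘ X ^ n) * _)]
          exact support_add)
    _ ≤ (A %ₘ X ^ n).support.card + ((A /ₘ X ^ n) * (P - X ^ n)).support.card :=
        Finset.card_union_le _ _
    _ ≤ (A %ₘ X ^ n).support.card * (P - X ^ n).support.card +
        (A /ₘ X ^ n).support.card * (P - X ^ n).support.card :=
        Nat.add_le_add (Nat.le_mul_of_pos_right _ hr) card_support_mul_le
    _ ≤ _ := by rw [← Nat.add_mul]; exact Nat.mul_le_mul_right _ h1

theorem natDegree_mul_lt_add {F G : R[X]} {n e g : ℕ} (hn : 0 < n) (hF : F.degree < n)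
    (hG : G.degree < n) (he : n ≤ e * g) : (F * G).natDegree < n + e * g := by
  have h1 := natDegree_mul_le (p := F) (q := G)
  have h2 : F.natDegree < n := by
    rcases eq_or_ne F 0 with rfl | h
    · simpa using hn
    · exact (natDegree_lt_iff_degree_lt h).2 hF
  have h3 : G.natDegree < n := by
    rcases eq_or_ne G 0 with rfl | h
    · simpa using hn
    · exact (natDegree_lt_iff_degree_lt h).2 hG
  omega

/-- The inequality that is tested before the evaluation: a true identity passes. -/
theorem card_support_mul_modByMonic_le [Nontrivial R] (hP : P.Monic)
    (hn : 0 < P.natDegree) (hP0 : P - X ^ P.natDegree ≠ 0) {g e : ℕ} (hg : 0 < g)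
    (hgap : (P - X ^ P.natDegree).natDegree + g ≤ P.natDegree) (he : P.natDegree ≤ e * g)
    {F G : R[X]} (hF : F.degree < P.natDegree) (hG : G.degree < P.natDegree) :
    ((F * G) %ₘ P).support.card ≤
      F.support.card * G.support.card * (P - X ^ P.natDegree).support.card ^ e :=
  (le_mul_pow_of_foldStep hP hn hg hgap (φ := fun A => A.support.card)
    (card_support_foldStep_le hP0) e (F * G) (natDegree_mul_lt_add hn hF hG he)).trans
    (Nat.mul_le_mul_right _ card_support_mul_le)

/-- The leading term of a monic polynomial is one of its terms. -/
theorem support_sub_X_pow [Nontrivial R] (hP : P.Monic) :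
    (P - X ^ P.natDegree).support = P.support.erase P.natDegree := by
  ext i
  rw [mem_support_iff, Finset.mem_erase, mem_support_iff, coeff_sub, coeff_X_pow]
  by_cases h : i = P.natDegree
  · rw [h, hP.coeff_natDegree]; simp
  · simp [h]

theorem card_support_sub_X_pow [Nontrivial R] (hP : P.Monic) :
    (P - X ^ P.natDegree).support.card + 1 = P.support.card := by
  rw [support_sub_X_pow hP]
  exact Finset.card_erase_add_one (natDegree_mem_support_of_nonzero hP.ne_zero)

theorem natDegree_sub_X_pow_lt [Nontrivial R] (hP : P.Monic) (hn : 0 < P.natDegree) :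
    (P - X ^ P.natDegree).natDegree < P.natDegree := by
  by_cases h : P - X ^ P.natDegree = 0
  · rw [h]; simpa using hn
  refine lt_of_le_of_ne ((natDegree_sub_le _ _).trans (by simp)) fun h1 => ?_
  have h2 := natDegree_mem_support_of_nonzero h
  rw [support_sub_X_pow hP, h1] at h2
  exact absurd rfl (Finset.ne_of_mem_erase h2)

end FoldStep

theorem norm_le_iff {F : ℤ[X]} {b : ℕ} : norm F ≤ b ↔ ∀ i, (F.coeff i).natAbs ≤ b := by
  rw [norm, Finset.sup_le_iff]
  refine ⟨fun h i => ?_, fun h i _ => h i⟩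
  by_cases hi : F.coeff i = 0
  · simp [hi]
  · exact h i (mem_support_iff.2 hi)

theorem natAbs_coeff_le_norm (F : ℤ[X]) (i : ℕ) : (F.coeff i).natAbs ≤ norm F :=
  norm_le_iff.1 le_rfl i

theorem norm_mul_le (A B : ℤ[X]) : norm (A * B) ≤ sparsity B * (norm A * norm B) := by
  refine norm_le_iff.2 fun m => ?_
  conv_lhs => rw [B.as_sum_support, Finset.mul_sum, finsetSum_coeff]
  rw [sparsity, ← smul_eq_mul, ← Finset.sum_const]
  refine (Int.natAbs_sum_le _ _).trans (Finset.sum_le_sum fun j _ => ?_)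
  rw [← C_mul_X_pow_eq_monomial, ← mul_assoc, coeff_mul_X_pow']
  split_ifs
  · rw [coeff_mul_C, Int.natAbs_mul]
    exact Nat.mul_le_mul (natAbs_coeff_le_norm A _) (natAbs_coeff_le_norm B _)
  · simp

theorem norm_foldStep_le {P : ℤ[X]} (hP : P.Monic) (A : ℤ[X]) :
    norm (foldStep P A) ≤ norm A * (sparsity P * norm P) := by
  set n := P.natDegree with hn
  have h1 : 1 ≤ norm P := by
    have := natAbs_coeff_le_norm P n
    rwa [hP.coeff_natDegree] at this
  have h2 : norm (P - X ^ n) ≤ norm P := norm_le_iff.2 fun i => by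
    rw [coeff_sub, coeff_X_pow]
    split_ifs with h
    · rw [h, hP.coeff_natDegree]; simp
    · rw [sub_zero]; exact natAbs_coeff_le_norm P i
  have h3 : norm (A /ₘ X ^ n) ≤ norm A := norm_le_iff.2 fun i => by
    rw [coeff_divByMonic_X_pow]
    exact natAbs_coeff_le_norm A _
  have h4 := card_support_sub_X_pow hP
  have h5 : sparsity (P - X ^ n) + 1 = sparsity P := h4
  refine norm_le_iff.2 fun i => ?_
  rw [foldStep, coeff_sub]
  have h6 : ((A %ₘ X ^ n).coeff i).natAbs ≤ norm A := by
    rw [coeff_modByMonic_X_pow]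
    split_ifs
    · exact natAbs_coeff_le_norm A i
    · simp
  have h7 : (((A /ₘ X ^ n) * (P - X ^ n)).coeff i).natAbs ≤
      sparsity (P - X ^ n) * (norm A * norm P) :=
    (natAbs_coeff_le_norm _ i).trans ((norm_mul_le _ _).trans
      (Nat.mul_le_mul_left _ (Nat.mul_le_mul h3 h2)))
  calc _ ≤ norm A + sparsity (P - X ^ n) * (norm A * norm P) :=
        (Int.natAbs_sub_le _ _).trans (Nat.add_le_add h6 h7)
    _ ≤ norm A * norm P + sparsity (P - X ^ n) * (norm A * norm P) :=
        Nat.add_le_add_right (Nat.le_mul_of_pos_right _ h1) _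
    _ = _ := by rw [← h5]; ring

/-- The bound for the coefficients that determines the size of the prime. -/
theorem norm_mul_modByMonic_le {P : ℤ[X]} (hP : P.Monic) (hn : 0 < P.natDegree) {g e : ℕ}
    (hg : 0 < g) (hgap : (P - X ^ P.natDegree).natDegree + g ≤ P.natDegree)
    (he : P.natDegree ≤ e * g) {F G : ℤ[X]} (hF : F.degree < P.natDegree)
    (hG : G.degree < P.natDegree) :
    norm ((F * G) %ₘ P) ≤
      min (sparsity F) (sparsity G) * (norm F * norm G) * (sparsity P * norm P) ^ e := by
  refine (le_mul_pow_of_foldStep hP hn hg hgap (norm_foldStep_le hP) e (F * G)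
    (natDegree_mul_lt_add hn hF hG he)).trans (Nat.mul_le_mul_right _ ?_)
  rcases le_total (sparsity F) (sparsity G) with h | h
  · rw [min_eq_left h, mul_comm F, mul_comm (norm F)]
    exact norm_mul_le G F
  · rw [min_eq_right h]
    exact norm_mul_le F G

/-! ### Verification modulo `q` -/

section Lists

variable {R : Type*} [CommRing R] {α : Type}

theorem leadExp_eq_natDegree {l : List (ℕ × α)} {Q : R[X]}
    (hs : (l.map Prod.fst).Pairwise (· > ·)) (h : (l.map Prod.fst).toFinset = Q.support) :
    leadExp l = Q.natDegree := by
  cases l with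
  | nil =>
    have : Q = 0 := by rw [← support_eq_empty, ← h]; rfl
    rw [this]; rfl
  | cons t l =>
    rw [List.map_cons, List.pairwise_cons] at hs
    have ht : t.1 ∈ Q.support := by rw [← h]; simp
    have hQ : Q ≠ 0 := fun h0 => by simp [h0] at ht
    refine le_antisymm (le_natDegree_of_mem_supp _ ht) ?_
    have h1 := natDegree_mem_support_of_nonzero hQ
    rw [← h, List.mem_toFinset, List.map_cons, List.mem_cons] at h1
    rcases h1 with h1 | h1
    · exact h1.le
    · exact (hs.1 _ h1).le

theorem toFinset_tail {l : List (ℕ × α)} {P : R[X]} [Nontrivial R] (hP : P.Monic)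
    (hs : (l.map Prod.fst).Pairwise (· > ·)) (h : (l.map Prod.fst).toFinset = P.support) :
    (l.tail.map Prod.fst).toFinset = (P - X ^ P.natDegree).support := by
  rw [support_sub_X_pow hP, ← h, ← leadExp_eq_natDegree hs h]
  cases l with
  | nil => rfl
  | cons t l =>
    rw [List.map_cons, List.pairwise_cons] at hs
    rw [List.map_cons, List.toFinset_cons]
    refine (Finset.erase_insert fun h' => ?_).symm
    exact (hs.1 _ (List.mem_toFinset.1 h')).false

theorem leadExp_tail {l : List (ℕ × α)} {P : R[X]} [Nontrivial R] (hP : P.Monic)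
    (hs : (l.map Prod.fst).Pairwise (· > ·)) (h : (l.map Prod.fst).toFinset = P.support) :
    leadExp l.tail = (P - X ^ P.natDegree).natDegree :=
  leadExp_eq_natDegree (by rw [List.map_tail]; exact hs.tail) (toFinset_tail hP hs h)

end Lists

section Statistics

variable {I : ℕ → ℕ} {W J : ℕ}

theorem sat_countTerms (hB : Budget I W J) (l : List (ℕ × ℕ)) (m : ℕ)
    (h : m + l.length < 2 ^ W) : Sat (countTerms l m) (· = m + l.length) (l.length * J) := by
  induction l generalizing m with
  | nil => rfl
  | cons t l ih =>
    rw [List.length_cons] at h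
    rw [countTerms, List.length_cons, Nat.succ_mul]
    refine (sat_add hB (by omega) (by omega)).bind (by omega) ?_
    rintro _ rfl
    exact (ih (m + 1) (by omega)).mono (by omega) fun r hr => by omega

theorem sat_ceilInvGap (hB : Budget I W J) {n k : ℕ} (hk : k < n) (hn : 2 * n < 2 ^ W) :
    Sat (ceilInvGap n k) (· = (n - 1) / (n - k) + 1) ((4 * n.size + 8) * J) := by
  have hc : (4 * n.size + 8) * J = (4 * (n.size + 1) + 1) * J + 3 * J := by ring
  have hsz : (n + (n - k) - 1).size ≤ n.size + 1 := by
    refine Nat.size_le.2 ?_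
    have := Nat.lt_size_self n
    rw [pow_succ]
    omega
  have h1 : (4 * (n + (n - k) - 1).size + 1) * J ≤ (4 * (n.size + 1) + 1) * J :=
    Nat.mul_le_mul_right _ (by omega)
  rw [ceilInvGap]
  refine (sat_sub hB (by omega) (by omega)).bind (by omega) ?_
  rintro _ rfl
  refine (sat_add hB (by omega) (by omega)).bind (by omega) ?_
  rintro _ rfl
  refine (sat_sub hB (by omega) (by omega)).bind (by omega) ?_
  rintro _ rfl
  refine (sat_divMod hB (by omega) (by omega) (by omega)).bind (by omega) ?_
  rintro _ rfl
  rw [sat_pure]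
  simp only
  rw [show n + (n - k) - 1 = n - 1 + (n - k) by omega, Nat.add_div_right _ (by omega)]

theorem le_ceil_mul {n d : ℕ} (hd : 0 < d) : n ≤ ((n - 1) / d + 1) * d := by
  have h1 := Nat.div_add_mod (n - 1) d
  have h2 := Nat.mod_lt (n - 1) hd
  rw [Nat.add_mul, mul_comm _ d]
  omega

/-- Every `a` that is multiplied is less than `h`, hence the numbers stay small. -/
theorem sat_atMostPow (hB : Budget I W J) {h r : ℕ} (hh : h < 2 ^ W) (hr : r < 2 ^ W)
    (hhr : h * r < 2 ^ W) (e a : ℕ) (he : e < 2 ^ W) (ha : a < 2 ^ W) :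
    Sat (atMostPow I h r e a) (fun b => h ≤ a * r ^ e → b = true) ((3 * e + 1) * J) := by
  induction e generalizing a with
  | zero =>
    rw [atMostPow]
    refine (sat_le hB hh ha).mono (by omega) fun b hb h' => hb.2 (by simpa using h')
  | succ e ih =>
    have hc : (3 * (e + 1) + 1) * J = (3 * e + 1) * J + 3 * J := by ring
    rw [atMostPow]
    refine (sat_sub hB he (by omega)).bind (by omega) fun _ _ => ?_
    refine Sat.bind_ite (sat_le hB hh ha) (by omega) (fun _ => ?_) (fun h' => ?_)
    · rw [sat_pure]; exact fun _ => rfl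
    · refine (sat_mul hB ha hr).bind (by omega) ?_
      rintro _ rfl
      refine (ih (a * r) (by omega) ((Nat.mul_le_mul_right r (by omega)).trans_lt hhr)).mono
        (by omega) fun b hb h1 => hb ?_
      rwa [mul_assoc, ← pow_succ']

theorem sat_sparsityTest (hB : Budget I W J) {P F G H : List (ℕ × ℕ)} {n T : ℕ} (hn0 : 0 < n)
    (hn : leadExp P = n) (hk : leadExp P.tail < n) (hW : (n + 1) * (n + 1) < 2 ^ W)
    (hP : P.length ≤ n + 1) (hFn : F.length ≤ n) (hGn : G.length ≤ n) (hHn : H.length ≤ n)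
    (hF : F.length ≤ T) (hG : G.length ≤ T) (hH : H.length ≤ T) :
    Sat (sparsityTest I P F G H) (fun b => (2 ≤ P.length → H.length ≤ F.length * G.length *
        (P.length - 1) ^ ((n - 1) / (n - leadExp P.tail) + 1)) → b = true)
      ((P.length + 3 * T + 4 * n.size + 3 * ((n - 1) / (n - leadExp P.tail)) + 15) * J) := by
  have hc : (P.length + 3 * T + 4 * n.size + 3 * ((n - 1) / (n - leadExp P.tail)) + 15) * J =
      P.length * J + 3 * (T * J) + (4 * n.size + 8) * J +
        (3 * ((n - 1) / (n - leadExp P.tail) + 1) + 1) * J + 3 * J := by ring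
  have hFJ := Nat.mul_le_mul_right J hF
  have hGJ := Nat.mul_le_mul_right J hG
  have hHJ := Nat.mul_le_mul_right J hH
  have hn2 : (n + 1) * (n + 1) = n * n + 2 * n + 1 := by ring
  have he : (n - 1) / (n - leadExp P.tail) ≤ n - 1 := Nat.div_le_self _ _
  have hFG : F.length * G.length ≤ n * n := Nat.mul_le_mul hFn hGn
  rw [sparsityTest]
  refine (sat_countTerms hB P 0 (by omega)).bind (by omega) ?_
  rintro _ rfl
  rw [zero_add]
  refine Sat.bind_ite (sat_le hB (by omega) (by omega)) (by omega) (fun _ => ?_) (fun h' => ?_)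
  · rw [sat_pure]; exact fun _ => rfl
  refine (sat_countTerms hB F 0 (by omega)).bind (by omega) ?_
  rintro _ rfl
  refine (sat_countTerms hB G 0 (by omega)).bind (by omega) ?_
  rintro _ rfl
  refine (sat_countTerms hB H 0 (by omega)).bind (by omega) ?_
  rintro _ rfl
  simp only [zero_add]
  rw [hn]
  refine (sat_ceilInvGap hB hk (by omega)).bind (by omega) ?_
  rintro _ rfl
  refine (sat_sub hB (by omega) (by omega)).bind (by omega) ?_
  rintro _ rfl
  refine (sat_mul hB (by omega) (by omega)).bind (by omega) ?_
  rintro _ rfl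
  have hHr : H.length * (P.length - 1) ≤ n * n := Nat.mul_le_mul hHn (by omega)
  exact (sat_atMostPow hB (by omega) (by omega) (by omega) _ _ (by omega) (by omega)).mono
    (by omega) fun b hb h1 => hb (h1 (by omega))

end Statistics

section Verify

variable {I : ℕ → ℕ} {W J q : ℕ} {M : Modulus} {P F G H A B : (ZMod q)[X]}

theorem sat_randomPoint (hM : ModSetup I W J q M) {body : ℕ → Prog Bool} {c : ℕ}
    (h : ∀ x < q, Sat (body x) (fun b => b = true ↔ eval (x : ZMod q) A = eval (x : ZMod q) B) c) :
    Sat (do let x ← uniform (← sub M.q 1); body x) (fun b => A = B → b = true) (c + 2 * J) := by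
  have hB := hM.toBudget
  have hq := hM.two_le
  have hqW := hM.two_mul_lt (x := q) (by omega)
  rw [hM.hq]
  refine (sat_sub hB hqW (by omega)).bind (by omega) ?_
  rintro _ rfl
  refine (sat_uniform hB (by omega)).bind (by omega) fun x hx => ?_
  exact (h x (by omega)).mono (by omega) fun b hb hAB => hb.2 (by rw [hAB])

/-- Different polynomials of degree less than `n` over a field of `q` elements agree at a random
point with probability less than `n / q`. -/
theorem mean_randomPoint_le (hM : ModSetup I W J q M) (hq : q.Prime) {n : ℕ}
    (hA : A.degree < n) (hB : B.degree < n) (hAB : A ≠ B) {body : ℕ → Prog Bool} {c : ℕ}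
    (h : ∀ x < q, Sat (body x) (fun b => b = true ↔ eval (x : ZMod q) A = eval (x : ZMod q) B) c) :
    mean (do let x ← uniform (← sub M.q 1); body x) (fun b => if b = true then 1 else 0) ≤
      (n : ℝ) / q := by
  classical
  have : Fact q.Prime := ⟨hq⟩
  have hq2 := hM.two_le
  have hqW := hM.two_mul_lt (x := q) (by omega)
  rw [mean_bind]
  refine mean_le (sat_sub hM.toBudget (by rwa [hM.hq]) (by omega)) ?_
  rintro _ rfl
  rw [mean_bind, mean_uniform, hM.hq]
  have hq1 : ((q - 1 : ℕ) : ℝ) + 1 = q := by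
    rw [Nat.cast_sub (by omega)]; simp
  rw [hq1, Nat.sub_add_cancel (by omega)]
  gcongr
  have hcard : ((Finset.range q).filter fun x : ℕ =>
      eval (x : ZMod q) A = eval (x : ZMod q) B).card ≤ n := by
    have hne : A - B ≠ 0 := sub_ne_zero.2 hAB
    have hdeg : (A - B).natDegree ≤ n := natDegree_le_of_degree_le
      ((degree_sub_le _ _).trans (max_le hA.le hB.le))
    refine le_trans ?_ ((Multiset.toFinset_card_le _).trans ((card_roots' (A - B)).trans hdeg))
    refine Finset.card_le_card_of_injOn (fun x : ℕ => (x : ZMod q)) (fun x hx => ?_)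
      (fun x hx y hy hxy => ?_)
    · simp only [Finset.coe_filter, Set.mem_ofPred_eq] at hx
      simp only [SetLike.mem_coe, Multiset.mem_toFinset, mem_roots hne, IsRoot.def, eval_sub,
        sub_eq_zero]
      exact hx.2
    · simp only [Finset.coe_filter, Set.mem_ofPred_eq, Finset.mem_range] at hx hy
      have := (ZMod.natCast_eq_natCast_iff' _ _ _).1 hxy
      rwa [Nat.mod_eq_of_lt hx.1, Nat.mod_eq_of_lt hy.1] at this
  calc _ ≤ ∑ x ∈ Finset.range q, (if eval (x : ZMod q) A = eval (x : ZMod q) B then 1 else 0 : ℝ) :=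
        Finset.sum_le_sum fun x hx => mean_le (h x (Finset.mem_range.1 hx)) fun b hb => by
          split_ifs with h1 h2 h2
          · exact le_rfl
          · exact absurd (hb.1 h1) h2
          · exact zero_le_one
          · exact le_rfl
    _ = (((Finset.range q).filter fun x : ℕ =>
          eval (x : ZMod q) A = eval (x : ZMod q) B).card : ℝ) := by
        rw [Finset.sum_boole]
    _ ≤ n := by exact_mod_cast hcard

theorem sat_verifyDense (hM : ModSetup I W J q M) (hn0 : 0 < P.natDegree)
    (hn : 2 * P.natDegree < 2 ^ W) (hP : P.Monic) (hF : F.degree < P.natDegree)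
    (hG : G.degree < P.natDegree) (hH : H.degree < P.natDegree) {Pl : List (ℕ × ℕ)}
    {Fl Gl Hl : List ℕ} (hPl : SparseRep q Pl P) (hPs : (Pl.map Prod.fst).Pairwise (· > ·))
    (hFl : DenseRep q P.natDegree Fl F) (hGl : DenseRep q P.natDegree Gl G)
    (hHl : DenseRep q P.natDegree Hl H) :
    Sat (verifyDense I M Pl Fl Gl Hl) (fun b => (F * G) %ₘ P = H → b = true)
        (113 * (Pl.length * P.natDegree) * J) ∧
      (q.Prime → (F * G) %ₘ P ≠ H →
        mean (verifyDense I M Pl Fl Gl Hl) (fun b => if b = true then 1 else 0) ≤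
          (P.natDegree : ℝ) / q) := by
  have : Fact (1 < q) := ⟨by have := hM.two_le; omega⟩
  have hbody : ∀ x < q, Sat (do
        let y ← modularEval I M Pl Fl Gl x
        let z ← evalDense I M x Hl
        eq y z)
      (fun b => b = true ↔ eval (x : ZMod q) ((F * G) %ₘ P) = eval (x : ZMod q) H)
      (100 * (Pl.length * P.natDegree) * J + P.natDegree * (10 * J) + J) := by
    intro x hx
    have hx' : Rep q x (x : ZMod q) := ⟨hx, rfl⟩
    have hHx := sat_evalDense hM hx' Hl _ hHl
    rw [foldr_coeff_eq_eval hH, hHl.length_eq] at hHx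
    refine (sat_modularEval hM hn0 hn hP hF hG hPl hPs hFl hGl hx').bind (by omega) fun y hy => ?_
    refine hHx.bind (by omega) fun z hz => ?_
    refine (sat_eq hM.toBudget (hM.lt hy.1) (hM.lt hz.1)).mono (by omega) fun b hb => ?_
    rw [hb, hy.eq_iff hz]
  have hdeg : ((F * G) %ₘ P).degree < P.natDegree := by
    rw [← degree_eq_natDegree hP.ne_zero]
    exact degree_modByMonic_lt _ hP
  refine ⟨(sat_randomPoint hM hbody).mono_cost ?_, fun hq hne =>
    mean_randomPoint_le hM hq hdeg hH hne hbody⟩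
  have hl : 1 ≤ Pl.length := by
    obtain ⟨c, Pt, h, -⟩ := hPl.eq_cons hM.two_le hPs hP
    rw [h]; simp
  have h1 : P.natDegree ≤ Pl.length * P.natDegree := Nat.le_mul_of_pos_left _ hl
  calc _ = (100 * (Pl.length * P.natDegree) + 10 * P.natDegree + 3) * J := by ring
    _ ≤ _ := Nat.mul_le_mul_right _ (by omega)

theorem SparseRep.length_le (hq : 0 < q) {l : List (ℕ × ℕ)} (h : SparseRep q l A) {n : ℕ}
    (hA : A.degree < n) : l.length ≤ n := by
  rw [h.length_eq hq]
  have : A.support ⊆ Finset.range n := fun i hi => by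
    rw [Finset.mem_range]
    by_contra! h
    exact mem_support_iff.1 hi (coeff_eq_zero_of_degree_lt (hA.trans_le (by exact_mod_cast h)))
  simpa using Finset.card_le_card this

theorem sat_verifySparse (hM : ModSetup I W J q M) (hn0 : 0 < P.natDegree)
    (hn : (P.natDegree + 1) * (P.natDegree + 1) < 2 ^ W) (hP : P.Monic)
    (hF : F.degree < P.natDegree) (hG : G.degree < P.natDegree) (hH : H.degree < P.natDegree)
    {Pl Fl Gl Hl : List (ℕ × ℕ)} (hPl : SparseRep q Pl P)
    (hPs : (Pl.map Prod.fst).Pairwise (· > ·)) (hFl : SparseRep q Fl F) (hGl : SparseRep q Gl G)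
    (hGs : (Gl.map Prod.fst).Pairwise (· < ·)) (hHl : SparseRep q Hl H) {g : ℕ} (hg : 0 < g)
    (hgap : (P - X ^ P.natDegree).natDegree + g ≤ P.natDegree) {T : ℕ} (hFT : Fl.length ≤ T)
    (hGT : Gl.length ≤ T) (hHT : Hl.length ≤ T) :
    Sat (verifySparse I M Pl Fl Gl Hl) (fun b => (F * G) %ₘ P = H → b = true)
        (222 * (T * (2 * Pl.length ^ ((P.natDegree - 1) / g)) + Pl.length) *
          (P.natDegree.size * J) + 3 * ((P.natDegree - 1) / g) * J) ∧
      (q.Prime → (F * G) %ₘ P ≠ H →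
        mean (verifySparse I M Pl Fl Gl Hl) (fun b => if b = true then 1 else 0) ≤
          (P.natDegree : ℝ) / q) := by
  have hB := hM.toBudget
  have : Fact (1 < q) := ⟨by have := hM.two_le; omega⟩
  have hn2 : (P.natDegree + 1) * (P.natDegree + 1) =
    P.natDegree * P.natDegree + 2 * P.natDegree + 1 := by ring
  have hsupp := hPl.toFinset hM.pos
  have hlead := leadExp_eq_natDegree hPs hsupp
  have htail := leadExp_tail hP hPs hsupp
  have hgap' : ∀ t ∈ Pl.tail, t.1 + g ≤ P.natDegree := fun t ht => by
    have h1 : t.1 ∈ (P - X ^ P.natDegree).support := by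
      rw [← toFinset_tail hP hPs hsupp]
      exact List.mem_toFinset.2 (List.mem_map_of_mem ht)
    have := le_natDegree_of_mem_supp _ h1
    omega
  set d := P.natDegree.size with hd
  have hl : 1 ≤ Pl.length := by
    obtain ⟨c, Pt, h, -⟩ := hPl.eq_cons hM.two_le hPs hP
    rw [h]; simp
  have hd1 : 1 ≤ d := Nat.size_pos.2 hn0
  -- The comparison at a fixed point `x`.
  have hbody : ∀ x < q, Sat (do
        let y ← sparseModularEval I M Pl Fl Gl x
        let z ← evalSparse I M x Hl
        eq y z)
      (fun b => b = true ↔ eval (x : ZMod q) ((F * G) %ₘ P) = eval (x : ZMod q) H)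
      (170 * (T * (2 * Pl.length ^ ((P.natDegree - 1) / g)) + Pl.length) * (d * J) +
        T * ((14 * d + 11) * J) + J) := by
    intro x hx
    have hx' : Rep q x (x : ZMod q) := ⟨hx, rfl⟩
    have hHx := sat_evalSparse (d := d) hM hx' Hl fun t ht => by
      have h1 : t.1 ≤ P.natDegree := (le_natDegree_of_ne_zero (hHl.coeff_ne_zero ht)).trans
        (natDegree_le_of_degree_le hH.le)
      exact ⟨by omega, Nat.size_le_size h1, hHl.lt ht⟩
    rw [hHl.sum_eval hM.pos] at hHx
    have hc : Hl.length * ((14 * d + 11) * J) ≤ T * ((14 * d + 11) * J) :=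
      Nat.mul_le_mul_right _ hHT
    have heval := sat_sparseModularEval hM hn0 (by omega) hP hF hG hPl hPs hFl hGl hGs hg hgap' hFT
      hGT hx'
    rw [← hd] at heval
    refine heval.bind (by omega) fun y hy => ?_
    refine hHx.bind (by omega) fun z hz => ?_
    refine (sat_eq hM.toBudget (hM.lt hy.1) (hM.lt hz.1)).mono (by omega) fun b hb => ?_
    rw [hb, hy.eq_iff hz]
  have hdeg : ((F * G) %ₘ P).degree < P.natDegree := by
    rw [← degree_eq_natDegree hP.ne_zero]
    exact degree_modByMonic_lt _ hP
  have hk := natDegree_sub_X_pow_lt hP hn0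
  have hPlen : Pl.length ≤ P.natDegree + 1 := by
    refine hPl.length_le hM.pos (degree_le_natDegree.trans_lt ?_)
    exact_mod_cast Nat.lt_succ_self _
  have htest := sat_sparsityTest hB hn0 hlead (by rwa [htail]) hn hPlen (hFl.length_le hM.pos hF)
    (hGl.length_le hM.pos hG) (hHl.length_le hM.pos hH) hFT hGT hHT
  rw [htail, ← hd] at htest
  set N := P.natDegree with hN
  have hdiv : (N - 1) / (N - (P - X ^ N).natDegree) ≤ (N - 1) / g :=
    Nat.div_le_div_left (by omega) hg
  -- A true identity is not rejected by the sparsity test.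
  have hpass : (F * G) %ₘ P = H → 2 ≤ Pl.length → Hl.length ≤ Fl.length * Gl.length *
      (Pl.length - 1) ^ ((N - 1) / (N - (P - X ^ N).natDegree) + 1) := by
    rintro rfl h2
    have h3 := card_support_sub_X_pow hP
    rw [← hPl.length_eq hM.pos] at h3
    rw [hHl.length_eq hM.pos, hFl.length_eq hM.pos, hGl.length_eq hM.pos, ← h3,
      Nat.add_sub_cancel]
    refine card_support_mul_modByMonic_le hP hn0 (fun h0 => ?_) (Nat.sub_pos_of_lt hk)
      (by rw [← hN]; omega) (le_ceil_mul (by omega)) hF hG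
    rw [h0] at h3
    simp at h3
    omega
  refine ⟨?_, fun hq hne => ?_⟩
  · -- Every contribution to the cost is bounded by multiples of the following products.
    set U := 2 * Pl.length ^ ((N - 1) / g) with hU
    have hU1 : 1 ≤ U := by
      have : 0 < Pl.length ^ ((N - 1) / g) := by positivity
      omega
    have hTU : T ≤ T * U := Nat.le_mul_of_pos_right _ hU1
    have hcost : 222 * (T * U + Pl.length) * (d * J) + 3 * ((N - 1) / g) * J =
      170 * (T * U + Pl.length) * (d * J) + 52 * ((T * U + Pl.length) * (d * J)) +
        3 * ((N - 1) / g) * J := by ring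
    have hX : (T + Pl.length) * (d * J) ≤ (T * U + Pl.length) * (d * J) :=
      Nat.mul_le_mul_right _ (by omega)
    have hTd : T * J ≤ T * (d * J) := Nat.mul_le_mul_left _ (Nat.le_mul_of_pos_left _ hd1)
    have hJd : J ≤ d * J := Nat.le_mul_of_pos_left _ hd1
    have hPJ : Pl.length * J ≤ Pl.length * (d * J) := Nat.mul_le_mul_left _ hJd
    have hdP : d * J ≤ Pl.length * (d * J) := Nat.le_mul_of_pos_left _ hl
    rw [Nat.add_mul] at hX
    have hH' : T * ((14 * d + 11) * J) = 14 * (T * (d * J)) + 11 * (T * J) := by ring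
    have ht : (Pl.length + 3 * T + 4 * d + 3 * ((N - 1) / (N - (P - X ^ N).natDegree)) + 15) * J ≤
        Pl.length * J + 3 * (T * J) + 4 * (d * J) + 3 * ((N - 1) / g) * J + 15 * J := by
      calc _ ≤ (Pl.length + 3 * T + 4 * d + 3 * ((N - 1) / g) + 15) * J :=
            Nat.mul_le_mul_right _ (by omega)
        _ = _ := by ring
    rw [verifySparse]
    refine htest.bind (by omega) fun b hb => ?_
    cases b with
    | true =>
      rw [if_pos rfl]
      exact (sat_randomPoint hM hbody).mono_cost (by omega)
    | false =>
      rw [if_neg (by simp), sat_pure]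
      exact fun h => absurd (hb (hpass h)) (by simp)
  · rw [verifySparse, mean_bind]
    refine mean_le htest fun b _ => ?_
    cases b with
    | true =>
      rw [if_pos rfl]
      exact mean_randomPoint_le hM hq hdeg hH hne hbody
    | false =>
      rw [if_neg (by simp), pure_eq, mean_ret, if_neg (by simp)]
      positivity

end Verify

/-! ### Reduction of integral polynomials -/

theorem mem_sparseRep {F : ℤ[X]} {e : ℕ} {z : ℤ} :
    (e, z) ∈ sparseRep F ↔ F.coeff e ≠ 0 ∧ z = F.coeff e := by
  rw [sparseRep, List.mem_map]
  constructor
  · rintro ⟨i, hi, h⟩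
    obtain ⟨rfl, rfl⟩ := Prod.mk.inj h
    rw [Finset.mem_sort] at hi
    exact ⟨mem_support_iff.1 hi, rfl⟩
  · rintro ⟨h1, rfl⟩
    exact ⟨e, (Finset.mem_sort _).2 (mem_support_iff.2 h1), rfl⟩

theorem map_fst_sparseRep (F : ℤ[X]) :
    (sparseRep F).map Prod.fst = F.support.sort (· ≤ ·) := by
  rw [sparseRep, List.map_map]
  exact List.map_id _

theorem pairwise_sparseRep (F : ℤ[X]) : ((sparseRep F).map Prod.fst).Pairwise (· < ·) := by
  rw [map_fst_sparseRep]
  exact (Finset.sortedLT_sort _).pairwise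

theorem pairwise_reverse_sparseRep (F : ℤ[X]) :
    ((sparseRep F).reverse.map Prod.fst).Pairwise (· > ·) := by
  rw [List.map_reverse, List.pairwise_reverse]
  exact pairwise_sparseRep F

theorem toFinset_reverse_sparseRep (F : ℤ[X]) :
    ((sparseRep F).reverse.map Prod.fst).toFinset = F.support := by
  rw [List.map_reverse, List.toFinset_reverse, map_fst_sparseRep, Finset.sort_toFinset]

theorem length_sparseRep (F : ℤ[X]) : (sparseRep F).length = sparsity F := by
  rw [sparseRep, List.length_map, Finset.length_sort, sparsity]

theorem length_denseRep (n : ℕ) (F : ℤ[X]) : (denseRep n F).length = n := by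
  simp [denseRep]

section Reduction

variable {I : ℕ → ℕ} {W J q : ℕ} {M : Modulus} {S : ℕ}

theorem sat_reduceDense_denseRep (hM : ModSetup I W J q M) (n : ℕ) (F : ℤ[X])
    (hF : (norm F).size ≤ S) :
    Sat (reduceDense I M (denseRep n F))
      (fun l => DenseRep q n l (F.map (Int.castRingHom (ZMod q))))
      (n * (14 * (S / q.size + 1) * J)) := by
  have h := sat_reduceDense hM (S := S) (denseRep n F) fun c hc => by
    obtain ⟨i, -, rfl⟩ := List.mem_map.1 hc
    exact (Nat.size_le_size (natAbs_coeff_le_norm F i)).trans hF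
  rw [length_denseRep] at h
  refine h.mono le_rfl fun l hl => ?_
  rw [denseRep, List.forall₂_map_right_iff] at hl
  rw [DenseRep, List.forall₂_map_right_iff]
  refine List.Forall₂.imp (fun r i hr => ?_) hl
  simpa using hr

/-- The reduction of a list that has the terms of `F` in some order. -/
theorem sat_reduceSparse_of_perm (hM : ModSetup I W J q M) {F : ℤ[X]} {l : List (ℕ × ℤ)}
    (hl : l.Perm (sparseRep F)) (hW : F.natDegree < 2 ^ W) (hF : (norm F).size ≤ S) :
    Sat (reduceSparse I M l)
      (fun rs => (rs.map Prod.fst).Sublist (l.map Prod.fst) ∧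
        SparseRep q rs (F.map (Int.castRingHom (ZMod q))) ∧ rs.length ≤ sparsity F)
      (sparsity F * (16 * (S / q.size + 1) * J)) := by
  have h := sat_reduceSparse hM (S := S) l fun t ht => by
    obtain ⟨h1, h2⟩ := mem_sparseRep.1 (show (t.1, t.2) ∈ _ from hl.mem_iff.1 ht)
    rw [h2]
    exact ⟨(le_natDegree_of_ne_zero h1).trans_lt hW,
      (Nat.size_le_size (natAbs_coeff_le_norm F _)).trans hF⟩
  rw [hl.length_eq, length_sparseRep] at h
  refine h.mono le_rfl fun rs hrs => ⟨hrs.1, ⟨?_, fun e c => ?_⟩, ?_⟩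
  · refine hrs.1.nodup ((hl.map Prod.fst).nodup_iff.2 ?_)
    exact (pairwise_sparseRep F).imp fun h => h.ne
  · rw [hrs.2, coeff_map, eq_intCast]
    constructor
    · rintro ⟨z, hz, h1, h2⟩
      obtain ⟨-, rfl⟩ := mem_sparseRep.1 (hl.mem_iff.1 hz)
      exact ⟨h1, h2⟩
    · rintro ⟨h1, h2⟩
      exact ⟨_, hl.mem_iff.2 (mem_sparseRep.2 ⟨fun h0 => h1 (by rw [h0]; simp), rfl⟩), h1, h2⟩
  · have := hrs.1.length_le
    rwa [List.length_map, List.length_map, hl.length_eq, length_sparseRep] at this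

variable {P F G H : ℤ[X]}

theorem sat_reduceVerifyDense (hM : ModSetup I W J q M) (hadm : Admissible P F G H)
    (hW : 2 * P.natDegree < 2 ^ W) (hPS : (norm P).size ≤ S) (hFS : (norm F).size ≤ S)
    (hGS : (norm G).size ≤ S) (hHS : (norm H).size ≤ S) :
    Sat (do
        let Fq ← reduceDense I M (denseRep P.natDegree F)
        let Gq ← reduceDense I M (denseRep P.natDegree G)
        let Hq ← reduceDense I M (denseRep P.natDegree H)
        let Pq ← reduceSparse I M (sparseRep P).reverse
        verifyDense I M Pq Fq Gq Hq) (fun b => H = (F * G) %ₘ P → b = true)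
      (42 * (P.natDegree * ((S / q.size + 1) * J)) + 16 * (sparsity P * ((S / q.size + 1) * J)) +
        113 * (sparsity P * P.natDegree) * J) ∧
    (q.Prime → H.map (Int.castRingHom (ZMod q)) ≠ ((F * G) %ₘ P).map (Int.castRingHom (ZMod q)) →
      mean (do
        let Fq ← reduceDense I M (denseRep P.natDegree F)
        let Gq ← reduceDense I M (denseRep P.natDegree G)
        let Hq ← reduceDense I M (denseRep P.natDegree H)
        let Pq ← reduceSparse I M (sparseRep P).reverse
        verifyDense I M Pq Fq Gq Hq) (fun b => if b = true then 1 else 0) ≤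
          (P.natDegree : ℝ) / q) := by
  obtain ⟨hP, hn0, hF, hG, hH⟩ := hadm
  have : Fact (1 < q) := ⟨by have := hM.two_le; omega⟩
  set φ := Int.castRingHom (ZMod q) with hφ
  set n := P.natDegree with hn
  have hdeg : (P.map φ).natDegree = n := hP.natDegree_map φ
  have hlt : ∀ {A : ℤ[X]}, A.degree < n → (A.map φ).degree < ((P.map φ).natDegree : ℕ) :=
    fun hA => by rw [hdeg]; exact degree_map_le.trans_lt hA
  have hmod : ((F * G) %ₘ P).map φ = (F.map φ * G.map φ) %ₘ P.map φ := by
    rw [map_modByMonic φ hP, Polynomial.map_mul]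
  have hrF := sat_reduceDense_denseRep hM n F hFS
  have hrG := sat_reduceDense_denseRep hM n G hGS
  have hrH := sat_reduceDense_denseRep hM n H hHS
  have hrP := sat_reduceSparse_of_perm hM (List.reverse_perm _) (by omega) hPS
  have hver : ∀ {Fq Gq Hq Pq}, DenseRep q n Fq (F.map φ) → DenseRep q n Gq (G.map φ) →
      DenseRep q n Hq (H.map φ) →
      (Pq.map Prod.fst).Sublist ((sparseRep P).reverse.map Prod.fst) ∧
        SparseRep q Pq (P.map φ) ∧ Pq.length ≤ sparsity P →
      Sat (verifyDense I M Pq Fq Gq Hq) (fun b => (F.map φ * G.map φ) %ₘ P.map φ = H.map φ → b = true)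
          (113 * (sparsity P * n) * J) ∧
        (q.Prime → (F.map φ * G.map φ) %ₘ P.map φ ≠ H.map φ →
          mean (verifyDense I M Pq Fq Gq Hq) (fun b => if b = true then 1 else 0) ≤
            (n : ℝ) / q) := fun {Fq Gq Hq Pq} h1 h2 h3 h4 => by
    have := sat_verifyDense hM (by rwa [hdeg]) (by rwa [hdeg]) (hP.map φ) (hlt hF) (hlt hG)
      (hlt hH) h4.2.1 ((pairwise_reverse_sparseRep P).sublist h4.1) (by rwa [hdeg])
      (by rwa [hdeg]) (by rwa [hdeg] : DenseRep q _ Hq _)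
    rw [hdeg] at this
    exact ⟨this.1.mono_cost (Nat.mul_le_mul_right _ (Nat.mul_le_mul_left _
      (Nat.mul_le_mul_right _ h4.2.2))), this.2⟩
  refine ⟨?_, fun hq hne => ?_⟩
  · have hc1 : n * (14 * (S / q.size + 1) * J) = 14 * (n * ((S / q.size + 1) * J)) := by ring
    have hc2 : sparsity P * (16 * (S / q.size + 1) * J) =
      16 * (sparsity P * ((S / q.size + 1) * J)) := by ring
    refine hrF.bind (by omega) fun Fq h1 => ?_
    refine hrG.bind (by omega) fun Gq h2 => ?_
    refine hrH.bind (by omega) fun Hq h3 => ?_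
    refine hrP.bind (by omega) fun Pq h4 => ?_
    refine (hver h1 h2 h3 h4).1.mono (by omega) fun b hb h => hb ?_
    rw [h, hmod]
  · rw [mean_bind]
    refine mean_le hrF fun Fq h1 => ?_
    rw [mean_bind]
    refine mean_le hrG fun Gq h2 => ?_
    rw [mean_bind]
    refine mean_le hrH fun Hq h3 => ?_
    rw [mean_bind]
    refine mean_le hrP fun Pq h4 => ?_
    exact (hver h1 h2 h3 h4).2 hq fun h => hne (by rw [hmod, h])

theorem sat_reduceVerifySparse (hM : ModSetup I W J q M) (hadm : Admissible P F G H)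
    (hW : (P.natDegree + 1) * (P.natDegree + 1) < 2 ^ W) (hPS : (norm P).size ≤ S)
    (hFS : (norm F).size ≤ S) (hGS : (norm G).size ≤ S) (hHS : (norm H).size ≤ S) {e : ℕ}
    (he : e = (P.natDegree - 1) / (P.natDegree - (P - X ^ P.natDegree).natDegree)) :
    Sat (do
        let Fq ← reduceSparse I M (sparseRep F)
        let Gq ← reduceSparse I M (sparseRep G)
        let Hq ← reduceSparse I M (sparseRep H)
        let Pq ← reduceSparse I M (sparseRep P).reverse
        verifySparse I M Pq Fq Gq Hq) (fun b => H = (F * G) %ₘ P → b = true)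
      (48 * ((maxSparsity F G H + sparsity P) * ((S / q.size + 1) * J)) +
        222 * (maxSparsity F G H * (2 * sparsity P ^ e) + sparsity P) *
          (P.natDegree.size * J) + 3 * e * J) ∧
    (q.Prime → H.map (Int.castRingHom (ZMod q)) ≠ ((F * G) %ₘ P).map (Int.castRingHom (ZMod q)) →
      mean (do
        let Fq ← reduceSparse I M (sparseRep F)
        let Gq ← reduceSparse I M (sparseRep G)
        let Hq ← reduceSparse I M (sparseRep H)
        let Pq ← reduceSparse I M (sparseRep P).reverse
        verifySparse I M Pq Fq Gq Hq) (fun b => if b = true then 1 else 0) ≤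
          (P.natDegree : ℝ) / q) := by
  obtain ⟨hP, hn0, hF, hG, hH⟩ := hadm
  have : Fact (1 < q) := ⟨by have := hM.two_le; omega⟩
  have hk := natDegree_sub_X_pow_lt hP hn0
  set φ := Int.castRingHom (ZMod q) with hφ
  set n := P.natDegree with hn
  set T := maxSparsity F G H with hT
  have hdeg : (P.map φ).natDegree = n := hP.natDegree_map φ
  have hlt : ∀ {A : ℤ[X]}, A.degree < n → (A.map φ).degree < ((P.map φ).natDegree : ℕ) :=
    fun hA => by rw [hdeg]; exact degree_map_le.trans_lt hA
  have hnat : ∀ {A : ℤ[X]}, A.degree < n → A.natDegree < 2 ^ W := fun hA => by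
    have : n < 2 ^ W := lt_of_le_of_lt (by nlinarith) hW
    exact (natDegree_le_of_degree_le hA.le).trans_lt this
  have hmod : ((F * G) %ₘ P).map φ = (F.map φ * G.map φ) %ₘ P.map φ := by
    rw [map_modByMonic φ hP, Polynomial.map_mul]
  have hgap : (P.map φ - X ^ (P.map φ).natDegree).natDegree + (n - (P - X ^ n).natDegree) ≤
      (P.map φ).natDegree := by
    have h1 : P.map φ - X ^ (P.map φ).natDegree = (P - X ^ n).map φ := by
      rw [hdeg, Polynomial.map_sub, Polynomial.map_pow, map_X]
    have h2 : ((P - X ^ n).map φ).natDegree ≤ (P - X ^ n).natDegree := natDegree_map_le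
    rw [h1, hdeg]
    omega
  have hrF := sat_reduceSparse_of_perm hM (List.Perm.refl _) (hnat hF) hFS
  have hrG := sat_reduceSparse_of_perm hM (List.Perm.refl _) (hnat hG) hGS
  have hrH := sat_reduceSparse_of_perm hM (List.Perm.refl _) (hnat hH) hHS
  have hrP := sat_reduceSparse_of_perm hM (List.reverse_perm (sparseRep P))
    (lt_of_le_of_lt (by nlinarith) hW) hPS
  have hFT : sparsity F ≤ T := (le_max_left _ _).trans (le_max_left _ _)
  have hGT : sparsity G ≤ T := (le_max_right _ _).trans (le_max_left _ _)
  have hHT : sparsity H ≤ T := le_max_right _ _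
  have hver : ∀ {Fq Gq Hq Pq},
      (Fq.map Prod.fst).Sublist ((sparseRep F).map Prod.fst) ∧
        SparseRep q Fq (F.map φ) ∧ Fq.length ≤ sparsity F →
      (Gq.map Prod.fst).Sublist ((sparseRep G).map Prod.fst) ∧
        SparseRep q Gq (G.map φ) ∧ Gq.length ≤ sparsity G →
      (Hq.map Prod.fst).Sublist ((sparseRep H).map Prod.fst) ∧
        SparseRep q Hq (H.map φ) ∧ Hq.length ≤ sparsity H →
      (Pq.map Prod.fst).Sublist ((sparseRep P).reverse.map Prod.fst) ∧
        SparseRep q Pq (P.map φ) ∧ Pq.length ≤ sparsity P →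
      Sat (verifySparse I M Pq Fq Gq Hq)
          (fun b => (F.map φ * G.map φ) %ₘ P.map φ = H.map φ → b = true)
          (222 * (T * (2 * sparsity P ^ e) + sparsity P) * (n.size * J) + 3 * e * J) ∧
        (q.Prime → (F.map φ * G.map φ) %ₘ P.map φ ≠ H.map φ →
          mean (verifySparse I M Pq Fq Gq Hq) (fun b => if b = true then 1 else 0) ≤
            (n : ℝ) / q) := fun {Fq Gq Hq Pq} h1 h2 h3 h4 => by
    have := sat_verifySparse hM (by rwa [hdeg]) (by rwa [hdeg]) (hP.map φ) (hlt hF) (hlt hG)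
      (hlt hH) h4.2.1 ((pairwise_reverse_sparseRep P).sublist h4.1) h1.2.1 h2.2.1
      ((pairwise_sparseRep G).sublist h2.1) h3.2.1 (by omega) hgap (h1.2.2.trans hFT)
      (h2.2.2.trans hGT) (h3.2.2.trans hHT)
    rw [hdeg, ← he] at this
    refine ⟨this.1.mono_cost (Nat.add_le_add_right (Nat.mul_le_mul_right _ (Nat.mul_le_mul_left _
      (Nat.add_le_add (Nat.mul_le_mul_left _ (Nat.mul_le_mul_left _ ?_)) h4.2.2))) _), this.2⟩
    exact Nat.pow_le_pow_left h4.2.2 e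
  refine ⟨?_, fun hq hne => ?_⟩
  · have hc : ∀ {A : ℤ[X]}, sparsity A ≤ T → sparsity A * (16 * (S / q.size + 1) * J) ≤
        16 * (T * ((S / q.size + 1) * J)) := fun hA =>
      (Nat.mul_le_mul_right _ hA).trans_eq (by ring)
    have hcF := hc hFT
    have hcG := hc hGT
    have hcH := hc hHT
    have hcP : sparsity P * (16 * (S / q.size + 1) * J) =
      16 * (sparsity P * ((S / q.size + 1) * J)) := by ring
    have hct : 48 * ((T + sparsity P) * ((S / q.size + 1) * J)) =
      48 * (T * ((S / q.size + 1) * J)) + 48 * (sparsity P * ((S / q.size + 1) * J)) := by ring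
    refine hrF.bind (by omega) fun Fq h1 => ?_
    refine hrG.bind (by omega) fun Gq h2 => ?_
    refine hrH.bind (by omega) fun Hq h3 => ?_
    refine hrP.bind (by omega) fun Pq h4 => ?_
    refine (hver h1 h2 h3 h4).1.mono (by omega) fun b hb h => hb ?_
    rw [h, hmod]
  · rw [mean_bind]
    refine mean_le hrF fun Fq h1 => ?_
    rw [mean_bind]
    refine mean_le hrG fun Gq h2 => ?_
    rw [mean_bind]
    refine mean_le hrH fun Hq h3 => ?_
    rw [mean_bind]
    refine mean_le hrP fun Pq h4 => ?_
    exact (hver h1 h2 h3 h4).2 hq fun h => hne (by rw [hmod, h])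

end Reduction

/-! ### The range of the prime -/

section Statistics

variable {I : ℕ → ℕ} {W J : ℕ}

theorem sat_supNorm {S : ℕ} (cs : List ℤ) (m : ℕ) (hm : m.size ≤ S)
    (hcs : ∀ c ∈ cs, c.natAbs.size ≤ S) :
    Sat (supNorm cs m) (fun r => r.size ≤ S ∧ m ≤ r ∧ ∀ c ∈ cs, c.natAbs ≤ r)
      (cs.length * (2 * S + 1)) := by
  induction cs generalizing m with
  | nil => exact ⟨hm, le_rfl, by simp⟩
  | cons c cs ih =>
    have hc := hcs c (by simp)
    rw [supNorm, List.length_cons, Nat.succ_mul]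
    have hmax : Sat (maximum c.natAbs m) (· = max c.natAbs m) (2 * S + 1) :=
      ⟨by omega, rfl⟩
    refine hmax.bind (by omega) ?_
    rintro _ rfl
    refine (ih _ ?_ fun c hc => hcs c (by simp [hc])).mono (by omega) ?_
    · rcases le_total c.natAbs m with h | h
      · rwa [max_eq_right h]
      · rwa [max_eq_left h]
    · rintro r ⟨h1, h2, h3⟩
      exact ⟨h1, (le_max_right _ _).trans h2, List.forall_mem_cons.2
        ⟨(le_max_left _ _).trans h2, h3⟩⟩

theorem sat_countNonzero (hB : Budget I W J) (cs : List ℤ) (m : ℕ) (h : m + cs.length < 2 ^ W) :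
    Sat (countNonzero cs m) (· = m + (cs.filter (· ≠ 0)).length) (cs.length * J) := by
  have hJ := hB.lin
  induction cs generalizing m with
  | nil => rfl
  | cons c cs ih =>
    rw [List.length_cons] at h
    rw [countNonzero, List.length_cons, Nat.succ_mul]
    split_ifs with hc
    · refine ⟨by omega, (ih m (by omega)).mono (by omega) ?_⟩
      rintro _ rfl
      simp [hc]
    · refine (sat_add hB (by omega) (by omega)).bind (by omega) ?_
      rintro _ rfl
      refine (ih (m + 1) (by omega)).mono (by omega) ?_
      rintro _ rfl
      simp [hc]
      omega

/-- A list of the coefficients of `F`, possibly with zeros. -/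
structure CoefList (l : List ℤ) (F : ℤ[X]) : Prop where
  mem : ∀ i, F.coeff i ≠ 0 → F.coeff i ∈ l
  natAbs_le : ∀ c ∈ l, c.natAbs ≤ norm F
  filter : (l.filter (· ≠ 0)).length = sparsity F

theorem coefList_of_perm {F : ℤ[X]} {l : List (ℕ × ℤ)} (hl : l.Perm (sparseRep F)) :
    CoefList (l.map Prod.snd) F := by
  have hne : ∀ c ∈ l.map Prod.snd, c ≠ 0 ∧ c.natAbs ≤ norm F := fun c hc => by
    obtain ⟨⟨e, z⟩, h1, rfl⟩ := List.mem_map.1 hc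
    obtain ⟨h2, rfl⟩ := mem_sparseRep.1 (hl.mem_iff.1 h1)
    exact ⟨h2, natAbs_coeff_le_norm F e⟩
  refine ⟨fun i hi => ?_, fun c hc => (hne c hc).2, ?_⟩
  · exact List.mem_map.2 ⟨(i, F.coeff i), hl.mem_iff.2 (mem_sparseRep.2 ⟨hi, rfl⟩), rfl⟩
  · rw [List.filter_eq_self.2 fun c hc => by simpa using (hne c hc).1, List.length_map,
      hl.length_eq, length_sparseRep]

theorem coefList_denseRep {F : ℤ[X]} {n : ℕ} (hF : F.degree < n) : CoefList (denseRep n F) F := by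
  have hlt : ∀ i, F.coeff i ≠ 0 → i < n := fun i hi => by
    by_contra! h
    exact hi (coeff_eq_zero_of_degree_lt (hF.trans_le (by exact_mod_cast h)))
  refine ⟨fun i hi => List.mem_map.2 ⟨i, List.mem_range.2 (hlt i hi), rfl⟩, fun c hc => ?_, ?_⟩
  · obtain ⟨i, -, rfl⟩ := List.mem_map.1 hc
    exact natAbs_coeff_le_norm F i
  · rw [denseRep, List.filter_map, List.length_map, sparsity]
    rw [← List.toFinset_card_of_nodup (List.nodup_range.filter _)]
    congr 1
    ext i
    simp only [List.mem_toFinset, List.mem_filter, List.mem_range, Function.comp_apply,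
      decide_eq_true_eq, mem_support_iff]
    exact ⟨fun h => h.2, fun h => ⟨hlt i h, h⟩⟩

variable {S : ℕ}

theorem sat_supNorm_coefList {l : List ℤ} {F : ℤ[X]} (hl : CoefList l F) (hS : (norm F).size ≤ S) :
    Sat (supNorm l 0) (fun r => r.size ≤ S ∧ norm F < 2 ^ r.size) (l.length * (2 * S + 1)) := by
  refine (sat_supNorm (S := S) l 0 (by simp) fun c hc =>
    (Nat.size_le_size (hl.natAbs_le c hc)).trans hS).mono le_rfl ?_
  rintro r ⟨h1, -, h3⟩
  refine ⟨h1, lt_of_le_of_lt (norm_le_iff.2 fun i => ?_) (Nat.lt_size_self r)⟩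
  by_cases hi : F.coeff i = 0
  · simp [hi]
  · exact h3 _ (hl.mem i hi)

theorem sat_countNonzero_coefList (hB : Budget I W J) {l : List ℤ} {F : ℤ[X]} (hl : CoefList l F)
    (h : l.length < 2 ^ W) : Sat (countNonzero l 0) (· = sparsity F) (l.length * J) := by
  refine (sat_countNonzero hB l 0 (by omega)).mono le_rfl fun r hr => ?_
  rw [hr, hl.filter, zero_add]

theorem sparsity_le {F : ℤ[X]} {n : ℕ} (hF : F.degree < n) : sparsity F ≤ n := by
  have : F.support ⊆ Finset.range n := fun i hi => by
    rw [Finset.mem_range]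
    by_contra! h
    exact mem_support_iff.1 hi (coeff_eq_zero_of_degree_lt (hF.trans_le (by exact_mod_cast h)))
  simpa [sparsity] using Finset.card_le_card this

theorem size_le_self (a : ℕ) : a.size ≤ a := Nat.size_le.2 Nat.lt_two_pow_self

variable {P F G H : ℤ[X]} {s : ℕ}

/-- The choice of the range for inputs given by any lists of the coefficients. -/
theorem sat_chooseLambda (hB : Budget I W J) (hadm : Admissible P F G H)
    (hPS : (norm P).size ≤ S) (hFS : (norm F).size ≤ S)
    (hGS : (norm G).size ≤ S) (hHS : (norm H).size ≤ S) {Fc Gc Hc : List ℤ}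
    (hFc : CoefList Fc F) (hGc : CoefList Gc G) (hHc : CoefList Hc H)
    (hFl : Fc.length ≤ P.natDegree) (hGl : Gc.length ≤ P.natDegree)
    {e : ℕ}
    (he : e = (P.natDegree - 1) / (P.natDegree - (P - X ^ P.natDegree).natDegree) + 1)
    (hW : 21 + 2 * (s * P.natDegree) + 5 * (s * ((P.natDegree + 2) * (P.natDegree + S + 2))) +
      s + (P.natDegree + 2) * (P.natDegree + S + 2) < 2 ^ W) :
    Sat (chooseLambda I s (sparseRep P).reverse Fc Gc Hc)
      (fun lam => ∃ B, norm H + min (sparsity F) (sparsity G) * (norm F * norm G) *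
          (sparsity P * norm P) ^ e < 2 ^ B ∧ maxNorm P F G H < 2 ^ B ∧
          B ≤ (P.natDegree + 2) * (P.natDegree + S + 2) ∧
          lam = max 21 (max (2 * (s * P.natDegree)) (5 * (s * B))))
      ((Fc.length + Gc.length + Hc.length + sparsity P) * (2 * S + 1 + J) + 4 * (S + 1) +
        (4 * P.natDegree.size + 24) * J) := by
  obtain ⟨hP, hn0, hF, hG, hH⟩ := hadm
  have hk := natDegree_sub_X_pow_lt hP hn0
  have hPc : CoefList ((sparseRep P).reverse.map Prod.snd) P :=
    coefList_of_perm (List.reverse_perm _)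
  have hPl : ((sparseRep P).reverse.map Prod.snd).length = sparsity P := by
    rw [List.length_map, List.length_reverse, length_sparseRep]
  have hPs := pairwise_reverse_sparseRep P
  have hPf := toFinset_reverse_sparseRep P
  have hsF := sparsity_le hF
  have hsG := sparsity_le hG
  have hsP : sparsity P ≤ P.natDegree + 1 := sparsity_le (degree_le_natDegree.trans_lt (by
    exact_mod_cast Nat.lt_succ_self _))
  set n := P.natDegree with hn
  have hen : e ≤ n := by
    have := Nat.div_le_self (n - 1) (n - (P - X ^ n).natDegree)
    omega
  have hX : (n + 2) * (n + S + 2) = n * n + n * S + 4 * n + 2 * S + 4 := by ring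
  have hnS : n * 1 ≤ n * n := Nat.mul_le_mul_left _ hn0
  have hcost : (Fc.length + Gc.length + Hc.length + sparsity P) * (2 * S + 1 + J) + 4 * (S + 1) +
      (4 * n.size + 24) * J = Fc.length * (2 * S + 1) + Gc.length * (2 * S + 1) +
        Hc.length * (2 * S + 1) + sparsity P * (2 * S + 1) + Fc.length * J + Gc.length * J +
        Hc.length * J + sparsity P * J + 4 * (S + 1) + (4 * n.size + 8) * J + 16 * J := by ring
  have hlen : ∀ r : ℕ, r.size ≤ S → Sat (len r) (· = r.size) (S + 1) := fun r hr =>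
    ⟨by omega, rfl⟩
  have hsF' := sat_supNorm_coefList hFc hFS
  have hsG' := sat_supNorm_coefList hGc hGS
  have hsH' := sat_supNorm_coefList hHc hHS
  have hsP' := sat_supNorm_coefList hPc hPS
  have hcF := sat_countNonzero_coefList hB hFc (by omega)
  have hcG := sat_countNonzero_coefList hB hGc (by omega)
  have hcP := sat_countNonzero_coefList hB hPc (by omega)
  rw [hPl] at hsP' hcP
  rw [chooseLambda, leadExp_eq_natDegree hPs hPf, leadExp_tail hP hPs hPf, ← hn]
  refine (sat_ceilInvGap hB hk (by omega)).bind (by omega) ?_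
  rintro _ rfl
  rw [← he]
  refine hsF'.bind (by omega) fun rF hrF => ?_
  refine (hlen _ hrF.1).bind (by omega) ?_
  rintro _ rfl
  refine hsG'.bind (by omega) fun rG hrG => ?_
  refine (hlen _ hrG.1).bind (by omega) ?_
  rintro _ rfl
  refine hsH'.bind (by omega) fun rH hrH => ?_
  refine (hlen _ hrH.1).bind (by omega) ?_
  rintro _ rfl
  refine hsP'.bind (by omega) fun rP hrP => ?_
  refine (hlen _ hrP.1).bind (by omega) ?_
  rintro _ rfl
  refine hcF.bind (by omega) ?_
  rintro _ rfl
  refine hcG.bind (by omega) ?_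
  rintro _ rfl
  refine hcP.bind (by omega) ?_
  rintro _ rfl
  refine (sat_len hB (by omega)).bind (by omega) ?_
  rintro _ rfl
  refine (sat_minimum hB (by omega) (by omega)).bind (by omega) ?_
  rintro _ rfl
  have hminle : min (sparsity F) (sparsity G) ≤ n := (min_le_left _ _).trans hsF
  refine (sat_len hB (by omega)).bind (by omega) ?_
  rintro _ rfl
  have hsP2 := Nat.lt_size_self (sparsity P)
  have hmin2 := Nat.lt_size_self (min (sparsity F) (sparsity G))
  have hsPs : (sparsity P).size ≤ n + 1 := (size_le_self _).trans hsP
  have hmins : (min (sparsity F) (sparsity G)).size ≤ n := (size_le_self _).trans hminle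
  generalize (sparsity P).size = cP at *
  generalize (min (sparsity F) (sparsity G)).size = m at *
  generalize rF.size = lF at *
  generalize rG.size = lG at *
  generalize rH.size = lH at *
  generalize rP.size = lP at *
  have hx : e * (cP + lP) ≤ n * n + n + n * S := by
    calc e * (cP + lP) ≤ n * (n + 1 + S) := Nat.mul_le_mul hen (by omega)
      _ = _ := by ring
  refine (sat_add hB (by omega) (by omega)).bind (by omega) ?_
  rintro _ rfl
  refine (sat_mul hB (by omega) (by omega)).bind (by omega) ?_
  rintro _ rfl
  refine (sat_add hB (by omega) (by omega)).bind (by omega) ?_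
  rintro _ rfl
  refine (sat_add hB (by omega) (by omega)).bind (by omega) ?_
  rintro _ rfl
  refine (sat_add hB (by omega) (by omega)).bind (by omega) ?_
  rintro _ rfl
  refine (sat_maximum hB (by omega) (by omega)).bind (by omega) ?_
  rintro _ rfl
  refine (sat_add hB (by omega) (by omega)).bind (by omega) ?_
  rintro _ rfl
  set B := max lH (e * (cP + lP) + m + lF + lG) + 1 with hBdef
  have hBle : B ≤ (n + 2) * (n + S + 2) := by omega
  have hsB : s * B ≤ s * ((n + 2) * (n + S + 2)) := Nat.mul_le_mul_left _ hBle
  refine (sat_mul hB (by omega) (by omega)).bind (by omega) ?_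
  rintro _ rfl
  refine (sat_mul hB (by omega) (by omega)).bind (by omega) ?_
  rintro _ rfl
  refine (sat_mul hB (by omega) (by omega)).bind (by omega) ?_
  rintro _ rfl
  refine (sat_mul hB (by omega) (by omega)).bind (by omega) ?_
  rintro _ rfl
  refine (sat_maximum hB (by omega) (by omega)).bind (by omega) ?_
  rintro _ rfl
  refine (sat_maximum hB (by omega) (by omega)).mono (by omega) ?_
  rintro _ rfl
  have hexp : ∀ {a l : ℕ}, a < 2 ^ l → l ≤ B → a < 2 ^ B := fun h1 h2 =>
    h1.trans_le (Nat.pow_le_pow_right (by norm_num) h2)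
  have hlPe : lP ≤ e * (cP + lP) := by
    have h1 : 1 * (cP + lP) ≤ e * (cP + lP) :=
      Nat.mul_le_mul_right _ (he ▸ Nat.le_add_left _ _)
    omega
  refine ⟨B, ?_, max_lt (max_lt (hexp hrP.2 (by omega)) (hexp hrF.2 (by omega)))
    (max_lt (hexp hrG.2 (by omega)) (hexp hrH.2 (by omega))), hBle, rfl⟩
  have h1 : min (sparsity F) (sparsity G) * (norm F * norm G) * (sparsity P * norm P) ^ e ≤
      2 ^ (e * (cP + lP) + m + lF + lG) := by
    calc _ ≤ 2 ^ m * (2 ^ lF * 2 ^ lG) * (2 ^ cP * 2 ^ lP) ^ e :=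
          Nat.mul_le_mul (Nat.mul_le_mul hmin2.le (Nat.mul_le_mul hrF.2.le hrG.2.le))
            (Nat.pow_le_pow_left (Nat.mul_le_mul hsP2.le hrP.2.le) e)
      _ = _ := by simp only [← pow_add, ← pow_mul]; congr 1; ring
  have h2 : 2 ^ (e * (cP + lP) + m + lF + lG) ≤ 2 ^ (B - 1) :=
    Nat.pow_le_pow_right (by norm_num) (by omega)
  have h3 : 2 ^ lH ≤ 2 ^ (B - 1) := Nat.pow_le_pow_right (by norm_num) (by omega)
  have h4 : 2 ^ B = 2 ^ (B - 1) + 2 ^ (B - 1) := by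
    rw [← two_mul, ← pow_succ', show B - 1 + 1 = B by omega]
  have := hrH.2
  omega

end Statistics

/-! ### Correctness over the integers -/

/-- Few primes of the interval `[lam, 2 lam]` divide a given nonzero integer. -/
theorem card_primesIn_dvd_le {lam B s : ℕ} (hs : 0 < s) (hlam : 21 ≤ lam) (hB : 5 * (s * B) ≤ lam)
    {a : ℤ} (ha : a ≠ 0) (haB : a.natAbs < 2 ^ B) :
    (((primesIn lam).filter fun p : ℕ => (p : ℤ) ∣ a).card : ℝ) / (primesIn lam).card ≤
      3 / (8 * s) := by
  set S := (primesIn lam).filter fun p : ℕ => (p : ℤ) ∣ a with hS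
  have hprime : ∀ p ∈ S, lam ≤ p ∧ p.Prime ∧ (p : ℤ) ∣ a := fun p hp => by
    rw [hS, Finset.mem_filter, primesIn, Finset.mem_filter, Finset.mem_Icc] at hp
    exact ⟨hp.1.1.1, hp.1.2, hp.2⟩
  -- The product of these primes divides `a`.
  have h1 : lam ^ S.card ≤ a.natAbs := by
    refine (Finset.pow_card_le_prod S (fun p => p) lam fun p hp => (hprime p hp).1).trans
      (Nat.le_of_dvd (Int.natAbs_pos.2 ha) ?_)
    exact Finset.prod_primes_dvd _ (fun p hp => (hprime p hp).2.1.prime) fun p hp =>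
      Int.natCast_dvd.1 (hprime p hp).2.2
  have h2 : S.card * Nat.log 2 lam < B := by
    have h3 : 2 ^ (S.card * Nat.log 2 lam) ≤ lam ^ S.card := by
      rw [mul_comm, pow_mul]
      exact Nat.pow_le_pow_left (Nat.pow_log_le_self 2 (by omega)) _
    exact (Nat.pow_lt_pow_iff_right (by norm_num)).1 ((h3.trans h1).trans_lt haB)
  have hπ := le_card_primesIn_mul_log hlam
  have hπ0 : 0 < (primesIn lam).card := by
    rcases Nat.eq_zero_or_pos (primesIn lam).card with h | h
    · rw [h] at hπ; omega
    · exact h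
  rw [div_le_div_iff₀ (by exact_mod_cast hπ0) (by positivity)]
  have h4 : S.card * (8 * lam) ≤ 15 * ((primesIn lam).card * B) := by
    calc S.card * (8 * lam) ≤ S.card * (15 * (primesIn lam).card * Nat.log 2 lam) :=
          Nat.mul_le_mul_left _ hπ
      _ = 15 * ((primesIn lam).card * (S.card * Nat.log 2 lam)) := by ring
      _ ≤ _ := Nat.mul_le_mul_left _ (Nat.mul_le_mul_left _ h2.le)
  have h5 : 5 * (S.card * (8 * s)) * lam ≤ 5 * (3 * (primesIn lam).card) * lam := by
    calc 5 * (S.card * (8 * s)) * lam = 5 * s * (S.card * (8 * lam)) := by ring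
      _ ≤ 5 * s * (15 * ((primesIn lam).card * B)) := Nat.mul_le_mul_left _ h4
      _ = 15 * (primesIn lam).card * (5 * (s * B)) := by ring
      _ ≤ 15 * (primesIn lam).card * lam := Nat.mul_le_mul_left _ hB
      _ = _ := by ring
  have h6 : S.card * (8 * s) ≤ 3 * (primesIn lam).card := by
    have := Nat.le_of_mul_le_mul_right h5 (by omega)
    omega
  exact_mod_cast h6

section Run

variable {I : ℕ → ℕ} {W J s : ℕ}

/-- The generation of the prime, where the error exponent `s.size + 3` is such that a composite number
is returned with probability at most `1 / (8 s)`. -/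
theorem sat_primeStage (hB : Budget I W J) {lam : ℕ} (hlam : 3 ≤ lam)
    (hW : 4 * (2 * lam).size ≤ W) (hs : s < 2 ^ W)
    (hR : 16 * (lam.size * (s.size + 3)) + (s.size + 3) + 2 < 2 ^ W) :
    Sat (do randomPrime I lam (← add (← len s) 3))
      (fun M => ∃ q, lam ≤ q ∧ q ≤ 2 * lam ∧ ModSetup I W J q M)
      ((16 * (lam.size * (s.size + 3)) + 1) * ((48 * (2 * lam).size + 5) * J) + 2 * J) := by
  refine (sat_len hB hs).bind (by omega) ?_
  rintro _ rfl
  refine (sat_add hB (by omega) (by omega)).bind (by omega) ?_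
  rintro _ rfl
  exact (sat_randomPrime hB hlam hW hR).mono_cost (by omega)

open Classical in
/-- The probability that the drawn number is not prime, or that it divides the nonzero integer
`a`. -/
theorem mean_primeStage_le (hB : Budget I W J) {lam B : ℕ} (hs0 : 0 < s) (hlam : 21 ≤ lam)
    (hlB : 5 * (s * B) ≤ lam) (hW : 4 * (2 * lam).size ≤ W) (hs : s < 2 ^ W)
    (hR : 16 * (lam.size * (s.size + 3)) + (s.size + 3) + 2 < 2 ^ W) {a : ℤ} (ha : a ≠ 0)
    (haB : a.natAbs < 2 ^ B) :
    mean (do randomPrime I lam (← add (← len s) 3))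
      (fun M => (if M.q.Prime then 0 else 1) +
        (if M.q ∈ (primesIn lam).filter fun p : ℕ => (p : ℤ) ∣ a then 1 else 0)) ≤
      1 / (2 * s) := by
  have hπ := le_card_primesIn_mul_log hlam
  have hπ0 : 0 < (primesIn lam).card := by
    rcases Nat.eq_zero_or_pos (primesIn lam).card with h | h
    · rw [h] at hπ; omega
    · exact h
  rw [mean_bind]
  refine mean_le (sat_len hB hs) ?_
  rintro _ rfl
  rw [mean_bind]
  refine mean_le (sat_add hB (by omega) (by omega)) ?_
  rintro _ rfl
  rw [mean_add]
  have h1 := mean_randomPrime_composite_le hB hlam hW (w := s.size + 3) (by omega) hR hπ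
  have h2 := mean_randomPrime_mem_le hB (by omega) hW hR _ (Finset.filter_subset
    (fun p : ℕ => (p : ℤ) ∣ a) (primesIn lam)) hπ0
  have h3 := card_primesIn_dvd_le hs0 hlam hlB ha haB
  -- The error `1 / (2 s)` is the sum of `1 / (8 s)` for composite numbers and `3 / (8 s)` for the
  -- primes that divide `a`.
  have h4 : (1 : ℝ) / 2 ^ (s.size + 3) ≤ 1 / (8 * s) := by
    have : (s : ℝ) ≤ 2 ^ s.size := by exact_mod_cast (Nat.lt_size_self s).le
    have hs' : (0 : ℝ) < s := by exact_mod_cast hs0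
    gcongr
    rw [pow_add]
    linarith
  have h5 : (1 : ℝ) / (2 * s) = 1 / (8 * s) + 3 / (8 * s) := by
    have hs' : (s : ℝ) ≠ 0 := by exact_mod_cast hs0.ne'
    field_simp
    norm_num
  rw [h5]
  exact add_le_add (h1.trans h4) (h2.trans h3)

variable {P F G H : ℤ[X]} {S c0 : ℕ}

/-- What is known on the lower end `lam` of the range of the prime. -/
def IsRange (P F G H : ℤ[X]) (S s lam : ℕ) : Prop :=
  ∃ B, norm H + min (sparsity F) (sparsity G) * (norm F * norm G) * (sparsity P * norm P) ^
      ((P.natDegree - 1) / (P.natDegree - (P - X ^ P.natDegree).natDegree) + 1) < 2 ^ B ∧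
    maxNorm P F G H < 2 ^ B ∧ B ≤ (P.natDegree + 2) * (P.natDegree + S + 2) ∧
    lam = max 21 (max (2 * (s * P.natDegree)) (5 * (s * B)))

/-- A coefficient of `H - F G mod P` is bounded by the quantity that determines the range. -/
theorem IsRange.natAbs_lt (hadm : Admissible P F G H) {B : ℕ}
    (hB : norm H + min (sparsity F) (sparsity G) * (norm F * norm G) * (sparsity P * norm P) ^
      ((P.natDegree - 1) / (P.natDegree - (P - X ^ P.natDegree).natDegree) + 1) < 2 ^ B) (i : ℕ) :
    ((H - (F * G) %ₘ P).coeff i).natAbs < 2 ^ B := by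
  obtain ⟨hP, hn0, hF, hG, -⟩ := hadm
  have hk := natDegree_sub_X_pow_lt hP hn0
  rw [coeff_sub]
  calc _ ≤ norm H + norm ((F * G) %ₘ P) := (Int.natAbs_sub_le _ _).trans
        (Nat.add_le_add (natAbs_coeff_le_norm _ _) (natAbs_coeff_le_norm _ _))
    _ ≤ _ := Nat.add_le_add_left (norm_mul_modByMonic_le hP hn0 (Nat.sub_pos_of_lt hk)
        (by omega) (le_ceil_mul (by omega)) hF hG) _
    _ < 2 ^ B := hB

/-- The properties of a verification that is carried out modulo `q`, and correct for a prime `q`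
unless the difference of the compared polynomials vanishes modulo `q`. -/
structure Verifies (I : ℕ → ℕ) (W J q : ℕ) (P F G H : ℤ[X]) (p : Prog Bool) (c : ℕ) : Prop where
  sat : Sat p (fun b => H = (F * G) %ₘ P → b = true) c
  mean_le : q.Prime →
    H.map (Int.castRingHom (ZMod q)) ≠ ((F * G) %ₘ P).map (Int.castRingHom (ZMod q)) →
      mean p (fun b => if b = true then 1 else 0) ≤ (P.natDegree : ℝ) / q

/-- The outcomes of a run of the algorithm; `c q` bounds the cost of the verification modulo
`q`. -/
theorem run_of_mem_support (hB : Budget I W J) (hs : s < 2 ^ W) {choose : Prog ℕ}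
    {ver : Modulus → Prog Bool} {c : ℕ → ℕ} (hchoose : Sat choose (IsRange P F G H S s) c0)
    (hW : ∀ lam, IsRange P F G H S s lam → 4 * (2 * lam).size ≤ W ∧
      16 * (lam.size * (s.size + 3)) + (s.size + 3) + 2 < 2 ^ W)
    (hver : ∀ q M, ModSetup I W J q M → Verifies I W J q P F G H (ver M) (c q)) {r : Run}
    (hr : r ∈ (choose.dist.bind fun l =>
      (do randomPrime I l.1 (← add (← len s) 3) : Prog Modulus).dist.bind fun M =>
      (ver M.1).dist.bind fun b => PMF.pure ⟨b.1, M.2, l.2 + b.2⟩).support) :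
    ∃ lam q, IsRange P F G H S s lam ∧ lam ≤ q ∧ q ≤ 2 * lam ∧
      (H = (F * G) %ₘ P → r.answer = true) ∧
      r.primeOps ≤ (16 * (lam.size * (s.size + 3)) + 1) * ((48 * (2 * lam).size + 5) * J) + 2 * J ∧
      r.otherOps ≤ c0 + c q := by
  rw [PMF.mem_support_bind_iff] at hr
  obtain ⟨l, hl, hr⟩ := hr
  rw [PMF.mem_support_bind_iff] at hr
  obtain ⟨M, hM, hr⟩ := hr
  rw [PMF.mem_support_bind_iff] at hr
  obtain ⟨b, hb, hr⟩ := hr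
  rw [PMF.support_pure, Set.mem_singleton_iff] at hr
  subst hr
  obtain ⟨hl1, hl2⟩ := hchoose.of_mem_support hl
  have h21 : 21 ≤ l.1 := by
    obtain ⟨B, -, -, -, h⟩ := hl1
    omega
  obtain ⟨⟨q, hq1, hq2, hq⟩, hM2⟩ :=
    (sat_primeStage hB (by omega) (hW _ hl1).1 hs (hW _ hl1).2).of_mem_support hM
  obtain ⟨hb1, hb2⟩ := (hver q M.1 hq).sat.of_mem_support hb
  exact ⟨l.1, q, hl1, hq1, hq2, hb1, hM2, Nat.add_le_add hl2 hb2⟩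

/-- If the compared polynomials are different, the answer is `false` with probability at least
`1 - 1 / s`: the drawn number is prime and does not divide a fixed nonzero coefficient of the
difference with probability at least `1 - 1 / (2 s)`, and then the values at a random point are
different with probability at least `1 - n / q`. -/
theorem run_soundness (hB : Budget I W J) (hs0 : 0 < s) (hs : s < 2 ^ W) {choose : Prog ℕ}
    {ver : Modulus → Prog Bool} {c : ℕ → ℕ} (hchoose : Sat choose (IsRange P F G H S s) c0)
    (hW : ∀ lam, IsRange P F G H S s lam → 4 * (2 * lam).size ≤ W ∧
      16 * (lam.size * (s.size + 3)) + (s.size + 3) + 2 < 2 ^ W)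
    (hver : ∀ q M, ModSetup I W J q M → Verifies I W J q P F G H (ver M) (c q))
    (hadm : Admissible P F G H) (hne : H ≠ (F * G) %ₘ P) :
    ENNReal.ofReal (1 - 1 / s) ≤ (choose.dist.bind fun l =>
      (do randomPrime I l.1 (← add (← len s) 3) : Prog Modulus).dist.bind fun M =>
      (ver M.1).dist.bind fun b => PMF.pure (⟨b.1, M.2, l.2 + b.2⟩ : Run)).toOuterMeasure
        {r | r.answer = false} := by
  classical
  have hs' : (0 : ℝ) < s := by exact_mod_cast hs0
  obtain ⟨i, hi⟩ : ∃ i, (H - (F * G) %ₘ P).coeff i ≠ 0 := by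
    by_contra! h
    exact hne (sub_eq_zero.1 (Polynomial.ext h))
  set a := (H - (F * G) %ₘ P).coeff i with ha
  rw [← mean_const choose (1 - 1 / (s : ℝ))]
  refine ofReal_mean_le hchoose _ _ _ fun l hl => ?_
  obtain ⟨hl1, hl2⟩ := hW _ hl
  obtain ⟨B, hΔ, -, -, hlam⟩ := hl
  have h21 : 21 ≤ l.1 := by omega
  have hstage := sat_primeStage hB (by omega) hl1 hs hl2
  set stage : Prog Modulus := do randomPrime I l.1 (← add (← len s) 3) with hst
  have hsum : ∀ M, mean (ver M) (fun b => if b = true then 0 else 1) =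
      1 - mean (ver M) (fun b => if b = true then 1 else 0) := fun M => by
    rw [eq_sub_iff_add_eq, ← mean_add]
    refine Eq.trans ?_ (mean_const (ver M) 1)
    congr 1
    funext b
    cases b <;> simp
  -- The probability of a wrong answer.
  have hbad : mean stage (fun M => mean (ver M) (fun b => if b = true then 1 else 0)) ≤ 1 / s := by
    have h1 : (1 : ℝ) / s = 1 / (2 * s) + 1 / (2 * s) := by field_simp; norm_num
    have hn : (P.natDegree : ℝ) / l.1 ≤ 1 / (2 * s) := by
      rw [div_le_div_iff₀ (by exact_mod_cast (by omega : 0 < l.1)) (by positivity)]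
      have : P.natDegree * (2 * s) ≤ 1 * l.1 := by
        have : P.natDegree * (2 * s) = 2 * (s * P.natDegree) := by ring
        omega
      exact_mod_cast this
    rw [h1]
    refine le_trans ?_ (add_le_add (mean_primeStage_le hB hs0 h21 (B := B) (by omega) hl1 hs hl2 hi
      (IsRange.natAbs_lt hadm hΔ i)) hn)
    rw [← hst, ← mean_const stage ((P.natDegree : ℝ) / l.1), ← mean_add]
    refine mean_mono_of_sat hstage ?_
    rintro M ⟨q, hq1, hq2, hM⟩
    rw [hM.hq]
    have hnn : (0 : ℝ) ≤ (P.natDegree : ℝ) / l.1 := by positivity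
    have hle1 : mean (ver M) (fun b => if b = true then 1 else 0) ≤ 1 :=
      (mean_mono (ver M) fun b => by split_ifs <;> norm_num).trans_eq (mean_const (ver M) 1)
    by_cases hp : q.Prime
    · by_cases hd : (q : ℤ) ∣ a
      · have hmem : q ∈ (primesIn l.1).filter fun p : ℕ => (p : ℤ) ∣ a := by
          rw [Finset.mem_filter, primesIn, Finset.mem_filter, Finset.mem_Icc]
          exact ⟨⟨⟨hq1, hq2⟩, hp⟩, hd⟩
        rw [if_pos hp, if_pos hmem]
        linarith
      · have h2 := (hver q M hM).mean_le hp fun h => hd (by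
          have := congrArg (coeff · i) h
          simp only [coeff_map, eq_intCast] at this
          rw [← ZMod.intCast_zmod_eq_zero_iff_dvd, ha, coeff_sub, Int.cast_sub, this, sub_self])
        have h3 : (P.natDegree : ℝ) / q ≤ (P.natDegree : ℝ) / l.1 := by
          have : (0 : ℝ) < l.1 := by exact_mod_cast (by omega : 0 < l.1)
          gcongr
        have h4 : (0 : ℝ) ≤
            if q ∈ (primesIn l.1).filter fun p : ℕ => (p : ℤ) ∣ a then 1 else 0 := by
          split_ifs <;> norm_num
        rw [if_pos hp]
        linarith
    · have h4 : (0 : ℝ) ≤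
          if q ∈ (primesIn l.1).filter fun p : ℕ => (p : ℤ) ∣ a then 1 else 0 := by
        split_ifs <;> norm_num
      rw [if_neg hp]
      linarith
  have hgood : 1 - 1 / (s : ℝ) ≤
      mean stage (fun M => mean (ver M) (fun b => if b = true then 0 else 1)) := by
    simp only [hsum]
    have := mean_add stage (fun M => 1 - mean (ver M) (fun b => if b = true then 1 else 0))
      (fun M => mean (ver M) (fun b => if b = true then 1 else 0))
    simp only [sub_add_cancel, mean_const] at this
    linarith
  refine (ENNReal.ofReal_le_ofReal hgood).trans (ofReal_mean_le hstage _ _ _ ?_)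
  rintro M ⟨q, -, -, hM⟩
  refine ofReal_mean_le (hver q M.1 hM).sat _ _ _ fun b _ => ?_
  rw [PMF.toOuterMeasure_pure_apply]
  cases h : b.1 <;> simp

end Run

/-! ### Parameters and costs -/

section MulCost

variable {I : ℕ → ℕ}

theorem IsMulCost.le_self (hI : IsMulCost I) {m : ℕ} (hm : 1 ≤ m) : m ≤ I m := by
  have h1 := hI.superlinear 1 m le_rfl hm
  have h2 := Nat.mul_le_mul_right m hI.one_le
  omega

theorem IsMulCost.mono (hI : IsMulCost I) {m n : ℕ} (hm : 1 ≤ m) (hmn : m ≤ n) : I m ≤ I n := by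
  have h1 := hI.superlinear m n hm hmn
  exact Nat.le_of_mul_le_mul_right (h1.trans (Nat.mul_le_mul_left _ hmn)) (by omega)

/-- The cost of an operation on numbers of at most `W` bits. The term `I 0` is there because nothing
is assumed on the cost of multiplying zeros. -/
def opCost (I : ℕ → ℕ) (W : ℕ) : ℕ := 3 * W + 3 + (I 0 + I W + 1)

theorem budget_opCost (hI : IsMulCost I) (W : ℕ) : Budget I W (opCost I W) := by
  refine ⟨Nat.le_add_right _ _, fun m hm => ?_⟩
  rw [opCost]
  rcases Nat.eq_zero_or_pos m with rfl | h
  · omega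
  · have := hI.mono h hm
    omega

/-- By the doubling property, operations on words of `64 l` bits cost `O(I l)`. -/
theorem exists_opCost_le (hI : IsMulCost I) :
    ∃ K : ℕ, ∀ l, 1 ≤ l → opCost I (64 * l) ≤ K * I l := by
  obtain ⟨K, hK⟩ := hI.doubling
  have hdbl : ∀ t l, 1 ≤ l → I (2 ^ t * l) ≤ K ^ t * I l := fun t l hl => by
    induction t with
    | zero => simp
    | succ t ih =>
      have h1 : 2 ^ (t + 1) * l = 2 * (2 ^ t * l) := by rw [pow_succ]; ring
      rw [h1]
      calc _ ≤ K * I (2 ^ t * l) := hK _ (Nat.mul_pos (by positivity) hl)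
        _ ≤ K * (K ^ t * I l) := Nat.mul_le_mul_left _ ih
        _ = _ := by rw [pow_succ]; ring
  -- `opCost I (64 l) = 192 l + 4 + I 0 + I (2 ^ 6 l)`.
  refine ⟨196 + I 0 + K ^ 6, fun l hl => ?_⟩
  have h1 := hdbl 6 l hl
  have h2 := hI.le_self hl
  have h3 : I 0 * 1 ≤ I 0 * I l := Nat.mul_le_mul_left _ (by omega)
  have h4 : (196 + I 0 + K ^ 6) * I l = 196 * I l + I 0 * I l + K ^ 6 * I l := by ring
  rw [opCost, h4]
  norm_num at h1
  omega

end MulCost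

theorem one_le_lg (x : ℝ) : 1 ≤ lg x := le_max_left _ _

theorem size_le_lg_add_one (a : ℕ) : (a.size : ℝ) ≤ lg a + 1 := by
  rcases Nat.eq_zero_or_pos a with rfl | h
  · have := one_le_lg ((0 : ℕ) : ℝ)
    simp only [Nat.size_zero]
    push_cast at this ⊢
    linarith
  · obtain ⟨b, hb⟩ := Nat.exists_eq_add_of_lt (Nat.size_pos.2 h)
    rw [zero_add] at hb
    have h1 : 2 ^ b ≤ a := Nat.lt_size.1 (by omega)
    have h2 : (b : ℝ) ≤ Real.logb 2 a := by
      rw [Real.le_logb_iff_rpow_le (by norm_num) (by exact_mod_cast h), Real.rpow_natCast]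
      exact_mod_cast h1
    rw [hb]
    push_cast
    linarith [le_max_right 1 (Real.logb 2 (a : ℝ)), show lg (a : ℝ) = max 1 (Real.logb 2 a) from rfl]

theorem lg_le_natCast {x : ℝ} {b : ℕ} (hx0 : 0 ≤ x) (hb : 1 ≤ b) (hx : x ≤ 2 ^ b) : lg x ≤ b := by
  refine max_le (by exact_mod_cast hb) ?_
  rcases hx0.eq_or_lt with rfl | h
  · simp
  · rw [Real.logb_le_iff_le_rpow (by norm_num) h, Real.rpow_natCast]
    exact hx

theorem le_two_pow_ceil_lg {x : ℝ} (hx : 0 < x) : x ≤ 2 ^ ⌈lg x⌉₊ := by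
  rw [← Real.rpow_natCast, ← Real.logb_le_iff_le_rpow (by norm_num) hx]
  exact (le_max_right _ _).trans (Nat.le_ceil _)

section Parameters

variable {P F G H : ℤ[X]} {ε : ℝ}

/-- The bit length of the quantity that measures the input. -/
noncomputable def bitLen (ε : ℝ) (P F G H : ℤ[X]) : ℕ := ⌈logSize ε P F G H⌉₊

theorem one_le_bitLen : 1 ≤ bitLen ε P F G H :=
  Nat.one_le_ceil_iff.2 (zero_lt_one.trans_le (one_le_lg _))

theorem bitLen_le : (bitLen ε P F G H : ℝ) ≤ 2 * logSize ε P F G H := by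
  have h1 := one_le_lg ((P.natDegree : ℝ) / ε * lg (maxNorm P F G H))
  have h2 := (Nat.ceil_lt_add_one (zero_le_one.trans h1)).le
  rw [bitLen, logSize]
  linarith

/-- All the parameters of the input are bounded in terms of its bit length. -/
theorem parameters_le (hn : 0 < P.natDegree) (hε : 0 < ε) (hε1 : ε < 1) :
    P.natDegree ≤ 2 ^ bitLen ε P F G H ∧ ⌈1 / ε⌉₊ ≤ 2 ^ bitLen ε P F G H ∧
      (maxNorm P F G H).size ≤ 2 * 2 ^ bitLen ε P F G H := by
  have hn' : (1 : ℝ) ≤ P.natDegree := by exact_mod_cast hn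
  have hlg := one_le_lg (maxNorm P F G H : ℝ)
  have hε' : 1 ≤ 1 / ε := by rw [le_div_iff₀ hε]; linarith
  have hmul : (P.natDegree : ℝ) / ε = P.natDegree * (1 / ε) := by ring
  have hY : (P.natDegree : ℝ) / ε * lg (maxNorm P F G H) ≤ 2 ^ bitLen ε P F G H :=
    le_two_pow_ceil_lg (by positivity)
  have h1 : (P.natDegree : ℝ) / ε ≤ 2 ^ bitLen ε P F G H :=
    (le_mul_of_one_le_right (by positivity) hlg).trans hY
  have h2 : (P.natDegree : ℝ) ≤ 2 ^ bitLen ε P F G H :=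
    (by rw [hmul]; exact le_mul_of_one_le_right (by positivity) hε' :
      (P.natDegree : ℝ) ≤ P.natDegree / ε).trans h1
  have h3 : 1 / ε ≤ 2 ^ bitLen ε P F G H :=
    (by rw [hmul]; exact le_mul_of_one_le_left (by positivity) hn' :
      1 / ε ≤ P.natDegree / ε).trans h1
  have h4 : lg (maxNorm P F G H) ≤ 2 ^ bitLen ε P F G H :=
    (le_mul_of_one_le_left (by positivity) (by rw [hmul]; nlinarith)).trans hY
  refine ⟨by exact_mod_cast h2, Nat.ceil_le.2 (by exact_mod_cast h3), ?_⟩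
  have h5 := size_le_lg_add_one (maxNorm P F G H)
  have h6 : (((maxNorm P F G H).size : ℕ) : ℝ) ≤ ((2 * 2 ^ bitLen ε P F G H : ℕ) : ℝ) := by
    push_cast
    linarith
  exact_mod_cast h6

/-- Numbers of `64 l` bits suffice, where `l` is the bit length of the input. -/
theorem word_bounds {l n s S : ℕ} (hl : 1 ≤ l) (hn : n ≤ 2 ^ l) (hs : s ≤ 2 ^ l)
    (hS : S ≤ 2 * 2 ^ l) :
    21 + 2 * (s * n) + 5 * (s * ((n + 2) * (n + S + 2))) + s + (n + 2) * (n + S + 2) <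
        2 ^ (64 * l) ∧ (n + 1) * (n + 1) < 2 ^ (64 * l) ∧ s < 2 ^ (64 * l) ∧
      ∀ lam B, B ≤ (n + 2) * (n + S + 2) → lam = max 21 (max (2 * (s * n)) (5 * (s * B))) →
        (2 * lam).size ≤ 11 * l ∧ lam.size ≤ 11 * l ∧ s.size + 3 ≤ 5 * l ∧
        4 * (2 * lam).size ≤ 64 * l ∧
        16 * (lam.size * (s.size + 3)) + (s.size + 3) + 2 < 2 ^ (64 * l) := by
  set x := 2 ^ l with hx
  have hx2 : 2 ≤ x := by
    calc 2 = 2 ^ 1 := rfl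
      _ ≤ _ := Nat.pow_le_pow_right (by norm_num) hl
  have hX : (n + 2) * (n + S + 2) ≤ 15 * (x * x) := by
    calc (n + 2) * (n + S + 2) ≤ (3 * x) * (5 * x) := Nat.mul_le_mul (by omega) (by omega)
      _ = _ := by ring
  have hsX : s * ((n + 2) * (n + S + 2)) ≤ 15 * (x * x * x) := by
    calc _ ≤ x * (15 * (x * x)) := Nat.mul_le_mul hs hX
      _ = _ := by ring
  have hsn : s * n ≤ x * x := Nat.mul_le_mul hs hn
  have hxx : 2 * x ≤ x * x := Nat.mul_le_mul_right _ hx2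
  have hxxx : 2 * (x * x) ≤ x * x * x := by
    calc 2 * (x * x) ≤ x * (x * x) := Nat.mul_le_mul_right _ hx2
      _ = _ := by ring
  have hpow : 256 * (x * x * x) ≤ 2 ^ (11 * l) := by
    calc 256 * (x * x * x) = 2 ^ (8 + (l + l + l)) := by rw [pow_add, pow_add, pow_add, ← hx]; norm_num
      _ ≤ _ := Nat.pow_le_pow_right (by norm_num) (by omega)
  have hpow' : 2 ^ (11 * l) ≤ 2 ^ (64 * l) := Nat.pow_le_pow_right (by norm_num) (by omega)
  have hnn : (n + 1) * (n + 1) ≤ (2 * x) * (2 * x) := Nat.mul_le_mul (by omega) (by omega)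
  have hnn' : (2 * x) * (2 * x) = 4 * (x * x) := by ring
  refine ⟨by omega, by omega, by omega, fun lam B hB hlam => ?_⟩
  have hsB : s * B ≤ s * ((n + 2) * (n + S + 2)) := Nat.mul_le_mul_left _ hB
  have h1 : (2 * lam).size ≤ 11 * l := Nat.size_le.2 (by omega)
  have h2 : lam.size ≤ 11 * l := Nat.size_le.2 (by omega)
  have h3 : s.size ≤ l + 1 := Nat.size_le.2 (by rw [pow_succ]; omega)
  refine ⟨h1, h2, by omega, by omega, ?_⟩
  have h4 : lam.size * (s.size + 3) ≤ 55 * (x * x) := by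
    have hlx : l ≤ x := Nat.lt_two_pow_self.le
    calc lam.size * (s.size + 3) ≤ (11 * x) * (5 * x) := Nat.mul_le_mul (by omega) (by omega)
      _ = _ := by ring
  have hpow2 : 1024 * (x * x) ≤ 2 ^ (64 * l) := by
    calc 1024 * (x * x) = 2 ^ (10 + (l + l)) := by rw [pow_add, pow_add, ← hx]; norm_num
      _ ≤ _ := Nat.pow_le_pow_right (by norm_num) (by omega)
  have h5 : s.size + 3 ≤ 5 * x := by
    have hlx : l ≤ x := Nat.lt_two_pow_self.le
    omega
  omega

/-- The drawn number is at least of the order of the square root of `(n / ε) log C`, so that reducing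
a coefficient modulo it takes `O(log C / log ((n / ε) log C) + 1)` steps. -/
theorem logSize_le_two_mul_size {S lam q : ℕ} (hε : 0 < ε) (hn : 0 < P.natDegree)
    (hlam : IsRange P F G H S ⌈1 / ε⌉₊ lam) (hq : lam ≤ q) :
    logSize ε P F G H ≤ 2 * q.size := by
  obtain ⟨B, -, hC, -, hlam⟩ := hlam
  set s := ⌈1 / ε⌉₊ with hs
  have hs1 : 1 / ε ≤ s := Nat.le_ceil _
  have hs0 : 1 ≤ s := Nat.one_le_ceil_iff.2 (by positivity)
  have hq0 : 1 ≤ q.size := Nat.size_pos.2 (by omega)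
  have h1 : lg (maxNorm P F G H) ≤ (B + 1 : ℕ) := by
    refine lg_le_natCast (by positivity) (by omega) ?_
    exact_mod_cast hC.le.trans (Nat.pow_le_pow_right (by norm_num) (Nat.le_succ _))
  have h2 : s * P.natDegree * (B + 1) ≤ q * q := by
    have h3 : 2 * (s * P.natDegree) ≤ q := by omega
    have h4 : 5 * (s * B) ≤ q := by omega
    have h5 : B ≤ s * B := Nat.le_mul_of_pos_left _ hs0
    have h6 : 21 ≤ q := by omega
    calc s * P.natDegree * (B + 1) ≤ (2 * (s * P.natDegree)) * (B + 1) :=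
          Nat.mul_le_mul_right _ (by omega)
      _ ≤ q * q := Nat.mul_le_mul h3 (by omega)
  have h7 : q * q < 2 ^ (2 * q.size) := by
    have := Nat.lt_size_self q
    calc q * q < 2 ^ q.size * 2 ^ q.size := Nat.mul_lt_mul'' this this
      _ = _ := by rw [← pow_add, two_mul]
  have h8 : (P.natDegree : ℝ) / ε * lg (maxNorm P F G H) ≤ 2 ^ (2 * q.size) := by
    calc (P.natDegree : ℝ) / ε * lg (maxNorm P F G H) =
          (1 / ε) * P.natDegree * lg (maxNorm P F G H) := by ring
      _ ≤ s * P.natDegree * (B + 1 : ℕ) := by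
          have := zero_le_one.trans (one_le_lg (maxNorm P F G H : ℝ))
          gcongr
      _ ≤ ((q * q : ℕ) : ℝ) := by exact_mod_cast h2
      _ ≤ _ := by exact_mod_cast h7.le
  have h0 := zero_le_one.trans (one_le_lg (maxNorm P F G H : ℝ))
  have := lg_le_natCast (by positivity) (by omega) h8
  rw [logSize]
  exact_mod_cast this

end Parameters

/-! ### The algorithm on dense and on sparse inputs -/

section Algorithm

variable {I : ℕ → ℕ} {P F G H : ℤ[X]} {ε : ℝ} {c0 : ℕ}

/-- The number of bits of the error exponent of the prime generation is `O(log (1 / ε))`. -/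
theorem size_ceil_le (hε : 0 < ε) (hε1 : ε < 1) :
    ((⌈1 / ε⌉₊.size + 3 : ℕ) : ℝ) ≤ 6 * lg (1 / ε) := by
  have h1 : 1 < 1 / ε := by rw [lt_div_iff₀ hε]; linarith
  have h2 : (⌈1 / ε⌉₊ : ℝ) ≤ 2 * (1 / ε) := by
    have := (Nat.ceil_lt_add_one (by positivity : 0 ≤ 1 / ε)).le
    linarith
  have h0 : (0 : ℝ) < ⌈1 / ε⌉₊ := by exact_mod_cast Nat.ceil_pos.2 (by positivity)
  have h3 : lg (⌈1 / ε⌉₊ : ℝ) ≤ 1 + lg (1 / ε) := by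
    have h4 : Real.logb 2 ⌈1 / ε⌉₊ ≤ 1 + Real.logb 2 (1 / ε) := by
      refine (Real.logb_le_logb_of_le (by norm_num) h0 h2).trans_eq ?_
      rw [Real.logb_mul (by norm_num) (by positivity), Real.logb_self_eq_one (by norm_num)]
    refine max_le (by linarith [one_le_lg (1 / ε)]) (h4.trans ?_)
    exact add_le_add_right (le_max_right _ _) _
  have h5 := size_le_lg_add_one ⌈1 / ε⌉₊
  have h6 := one_le_lg (1 / ε)
  push_cast
  linarith

/-- The exponent that arises from the algorithm is at most `⌈1 / γ - 1⌉`, where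
`1 / γ - 1 = k / (n - k)`. -/
theorem div_le_ceil_invGap (hadm : Admissible P F G H) :
    (P.natDegree - 1) / (P.natDegree - (P - X ^ P.natDegree).natDegree) ≤
      ⌈1 / gap P - 1⌉₊ := by
  obtain ⟨hP, hn0, -⟩ := hadm
  have hk := natDegree_sub_X_pow_lt hP hn0
  set n := P.natDegree with hn
  set k := (P - X ^ n).natDegree with hkdef
  have hnk : (0 : ℝ) < n - k := by
    have : (k : ℝ) < n := by exact_mod_cast hk
    linarith
  have hn' : (0 : ℝ) < n := by exact_mod_cast hn0
  have hgap : 1 / gap P = n / (n - k) := by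
    rw [gap, ← hn, ← hkdef, one_div_div]
  rcases Nat.eq_zero_or_pos ((n - 1) / (n - k)) with h | h
  · rw [h]; exact Nat.zero_le _
  · obtain ⟨m, hm⟩ := Nat.exists_eq_add_of_lt h
    rw [zero_add] at hm
    rw [hm, Nat.succ_le_iff, Nat.lt_ceil, hgap, lt_sub_iff_add_lt, lt_div_iff₀ hnk]
    have h1 := Nat.div_mul_le_self (n - 1) (n - k)
    have h2 : (m + 1) * (n - k) < n := by rw [← hm]; omega
    have h3 : ((m : ℝ) + 1) * ((n - k : ℕ) : ℝ) < n := by exact_mod_cast h2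
    rwa [Nat.cast_sub hk.le] at h3

/-- The conditions on the components of the algorithm that make it correct. -/
structure IsSetup (I : ℕ → ℕ) (ε : ℝ) (P F G H : ℤ[X]) (choose : Prog ℕ)
    (ver : Modulus → Prog Bool) (c0 : ℕ) (c : ℕ → ℕ) : Prop where
  range : Sat choose (IsRange P F G H (maxNorm P F G H).size ⌈1 / ε⌉₊) c0
  verifies : ∀ q M, ModSetup I (64 * bitLen ε P F G H) (opCost I (64 * bitLen ε P F G H)) q M →
    Verifies I (64 * bitLen ε P F G H) (opCost I (64 * bitLen ε P F G H)) q P F G H (ver M) (c q)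

/-- The law of a run with the given components. -/
noncomputable def runOf (I : ℕ → ℕ) (s : ℕ) (choose : Prog ℕ) (ver : Modulus → Prog Bool) :
    PMF Run :=
  choose.dist.bind fun l =>
    (do randomPrime I l.1 (← add (← len s) 3) : Prog Modulus).dist.bind fun M =>
    (ver M.1).dist.bind fun b => PMF.pure ⟨b.1, M.2, l.2 + b.2⟩

variable {choose : Prog ℕ} {ver : Modulus → Prog Bool} {c : ℕ → ℕ}

theorem IsRange.bounds (hadm : Admissible P F G H) (hε : 0 < ε) (hε1 : ε < 1) {lam : ℕ}
    (h : IsRange P F G H (maxNorm P F G H).size ⌈1 / ε⌉₊ lam) :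
    (2 * lam).size ≤ 11 * bitLen ε P F G H ∧ lam.size ≤ 11 * bitLen ε P F G H ∧
      ⌈1 / ε⌉₊.size + 3 ≤ 5 * bitLen ε P F G H ∧
      4 * (2 * lam).size ≤ 64 * bitLen ε P F G H ∧
      16 * (lam.size * (⌈1 / ε⌉₊.size + 3)) + (⌈1 / ε⌉₊.size + 3) + 2 <
        2 ^ (64 * bitLen ε P F G H) := by
  obtain ⟨h1, h2, h3⟩ := parameters_le (F := F) (G := G) (H := H) hadm.2.1 hε hε1
  obtain ⟨B, -, -, hB, hlam⟩ := h
  exact (word_bounds one_le_bitLen h1 h2 h3).2.2.2 lam B hB hlam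

theorem IsSetup.correct (hI : IsMulCost I) (hadm : Admissible P F G H) (hε : 0 < ε) (hε1 : ε < 1)
    (h : IsSetup I ε P F G H choose ver c0 c) :
    Correct ε P F G H (runOf I ⌈1 / ε⌉₊ choose ver) := by
  obtain ⟨h1, h2, h3⟩ := parameters_le (F := F) (G := G) (H := H) hadm.2.1 hε hε1
  have hs := (word_bounds one_le_bitLen h1 h2 h3).2.2.1
  have hs0 : 0 < ⌈1 / ε⌉₊ := Nat.ceil_pos.2 (by positivity)
  have hW := fun lam (hlam : IsRange P F G H (maxNorm P F G H).size ⌈1 / ε⌉₊ lam) =>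
    (hlam.bounds hadm hε hε1).2.2.2
  refine ⟨fun hH r hr => ?_, fun hne => ?_⟩
  · obtain ⟨lam, q, -, -, -, hr, -⟩ :=
      run_of_mem_support (budget_opCost hI _) hs h.range hW h.verifies hr
    exact hr hH
  · refine le_trans (ENNReal.ofReal_le_ofReal ?_)
      (run_soundness (budget_opCost hI _) hs0 hs h.range hW h.verifies hadm hne)
    have h4 : 1 / (⌈1 / ε⌉₊ : ℝ) ≤ ε := by
      rw [div_le_iff₀ (by exact_mod_cast hs0), mul_comm, ← div_le_iff₀ hε]
      exact Nat.le_ceil _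
    linarith

/-- The cost of the generation of the prime, and a bound for all other costs that depends on the
drawn number. -/
theorem IsSetup.cost (hI : IsMulCost I) (hadm : Admissible P F G H) (hε : 0 < ε) (hε1 : ε < 1)
    (h : IsSetup I ε P F G H choose ver c0 c) {K : ℕ}
    (hK : ∀ l, 1 ≤ l → opCost I (64 * l) ≤ K * I l) {r : Run}
    (hr : r ∈ (runOf I ⌈1 / ε⌉₊ choose ver).support) :
    (r.primeOps : ℝ) ≤ (94343 * 24 * K : ℕ) * primeBound I ε P F G H ∧
      ∃ q, 0 < q.size ∧ q.size ≤ 64 * bitLen ε P F G H ∧ logSize ε P F G H ≤ 2 * q.size ∧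
        r.otherOps ≤ c0 + c q := by
  obtain ⟨h1, h2, h3⟩ := parameters_le (F := F) (G := G) (H := H) hadm.2.1 hε hε1
  have hs := (word_bounds one_le_bitLen h1 h2 h3).2.2.1
  have hW := fun lam (hlam : IsRange P F G H (maxNorm P F G H).size ⌈1 / ε⌉₊ lam) =>
    (hlam.bounds hadm hε hε1).2.2.2
  obtain ⟨lam, q, hlam, hq1, hq2, -, hp, ho⟩ :=
    run_of_mem_support (budget_opCost hI _) hs h.range hW h.verifies hr
  obtain ⟨b1, b2, -, b4, -⟩ := hlam.bounds hadm hε hε1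
  have hq0 : 0 < q.size := by
    obtain ⟨B, -, -, -, h⟩ := hlam
    exact Nat.size_pos.2 (by omega)
  have hq3 := Nat.size_le_size hq2
  refine ⟨?_, q, hq0, by omega, logSize_le_two_mul_size hε hadm.2.1 hlam hq1, ho⟩
  have hl := one_le_bitLen (ε := ε) (P := P) (F := F) (G := G) (H := H)
  have hw := size_ceil_le hε hε1
  have hJ := hK _ hl
  have hlL := bitLen_le (ε := ε) (P := P) (F := F) (G := G) (H := H)
  have hprime : primeBound I ε P F G H = logSize ε P F G H ^ 2 * lg (logSize ε P F G H) *
    lg (1 / ε) * I (bitLen ε P F G H) := rfl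
  set l := bitLen ε P F G H
  set w := ⌈1 / ε⌉₊.size + 3 with hwdef
  set J := opCost I (64 * l)
  have hw1 : 1 ≤ w := by omega
  have hlw : 1 ≤ l * w := Nat.mul_pos hl hw1
  have hnat : r.primeOps ≤ 94343 * (l * l * w * J) := by
    refine hp.trans ?_
    have e1 : 16 * (lam.size * w) + 1 ≤ 177 * (l * w) := by
      have : lam.size * w ≤ 11 * l * w := Nat.mul_le_mul_right _ b2
      have e2 : 11 * l * w = 11 * (l * w) := by ring
      omega
    have e2 : (48 * (2 * lam).size + 5) * J ≤ 533 * l * J := Nat.mul_le_mul_right _ (by omega)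
    have e3 : 1 * J ≤ l * l * w * J :=
      Nat.mul_le_mul_right _ (by rw [mul_assoc]; exact Nat.mul_pos hl hlw)
    calc _ ≤ 177 * (l * w) * (533 * l * J) + 2 * J :=
          Nat.add_le_add_right (Nat.mul_le_mul e1 e2) _
      _ = 94341 * (l * l * w * J) + 2 * J := by ring
      _ ≤ _ := by omega
  have hL := one_le_lg ((P.natDegree : ℝ) / ε * lg (maxNorm P F G H))
  have hL1 : 1 ≤ logSize ε P F G H := hL
  set L := logSize ε P F G H
  have hlgL := one_le_lg L
  have hlg := one_le_lg (1 / ε)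
  have hJ' : (J : ℝ) ≤ K * I l := by exact_mod_cast hJ
  calc (r.primeOps : ℝ) ≤ 94343 * ((l : ℝ) * l * w * J) := by exact_mod_cast hnat
    _ ≤ 94343 * ((2 * L) * (2 * L) * (6 * lg (1 / ε)) * (K * I l)) := by gcongr
    _ = (94343 * 24 * K : ℕ) * (L ^ 2 * 1 * lg (1 / ε) * I l) := by push_cast; ring
    -- The factor `log log` of the stated bound is not needed.
    _ ≤ (94343 * 24 * K : ℕ) * (L ^ 2 * lg L * lg (1 / ε) * I l) := by gcongr
    _ = _ := by rw [hprime]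

/-- The number of blocks of a coefficient, each of the length of the modulus. -/
theorem blocks_le {S q : ℕ} {L lgC : ℝ} (hL : 1 ≤ L) (hq : 0 < q.size) (hLq : L ≤ 2 * q.size)
    (hS : (S : ℝ) ≤ 2 * lgC) : ((S / q.size + 1 : ℕ) : ℝ) ≤ 4 * (lgC / L) + 1 := by
  have h0 : (0 : ℝ) < q.size := by exact_mod_cast hq
  push_cast
  gcongr
  refine Nat.cast_div_le.trans ?_
  rw [← mul_div_assoc, div_le_div_iff₀ h0 (by linarith)]
  have hC : 0 ≤ lgC := by
    have : (0 : ℝ) ≤ S := by positivity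
    linarith
  calc (S : ℝ) * L ≤ (2 * lgC) * (2 * q.size) := by gcongr
    _ = _ := by ring

/-- Reading a coefficient of `S` bits is not more expensive than reducing it. -/
theorem succ_le_blocks_mul {S q W J : ℕ} (hq : 0 < q.size) (hW : q.size ≤ W) (hJ : 2 * W ≤ J) :
    2 * (S + 1) ≤ (S / q.size + 1) * J := by
  have h1 := Nat.lt_mul_div_succ S hq
  calc 2 * (S + 1) ≤ 2 * (q.size * (S / q.size + 1)) := by omega
    _ ≤ 2 * (W * (S / q.size + 1)) := Nat.mul_le_mul_left _ (Nat.mul_le_mul_right _ hW)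
    _ = (S / q.size + 1) * (2 * W) := by ring
    _ ≤ _ := Nat.mul_le_mul_left _ hJ

theorem norm_size_le : (norm P).size ≤ (maxNorm P F G H).size ∧
    (norm F).size ≤ (maxNorm P F G H).size ∧ (norm G).size ≤ (maxNorm P F G H).size ∧
    (norm H).size ≤ (maxNorm P F G H).size :=
  ⟨Nat.size_le_size ((le_max_left _ _).trans (le_max_left _ _)),
    Nat.size_le_size ((le_max_right _ _).trans (le_max_left _ _)),
    Nat.size_le_size ((le_max_left _ _).trans (le_max_right _ _)),
    Nat.size_le_size ((le_max_right _ _).trans (le_max_right _ _))⟩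

theorem size_maxNorm_le : ((maxNorm P F G H).size : ℝ) ≤ 2 * lg (maxNorm P F G H) := by
  linarith [size_le_lg_add_one (maxNorm P F G H), one_le_lg (maxNorm P F G H : ℝ)]

theorem runDense_eq (I : ℕ → ℕ) (ε : ℝ) (P F G H : ℤ[X]) :
    runDense I ε P F G H = runOf I ⌈1 / ε⌉₊
      (chooseLambda I ⌈1 / ε⌉₊ (sparseRep P).reverse (denseRep P.natDegree F)
        (denseRep P.natDegree G) (denseRep P.natDegree H))
      (fun M => do
        let Fq ← reduceDense I M (denseRep P.natDegree F)
        let Gq ← reduceDense I M (denseRep P.natDegree G)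
        let Hq ← reduceDense I M (denseRep P.natDegree H)
        let Pq ← reduceSparse I M (sparseRep P).reverse
        verifyDense I M Pq Fq Gq Hq) := rfl

theorem runSparse_eq (I : ℕ → ℕ) (ε : ℝ) (P F G H : ℤ[X]) :
    runSparse I ε P F G H = runOf I ⌈1 / ε⌉₊
      (chooseLambda I ⌈1 / ε⌉₊ (sparseRep P).reverse ((sparseRep F).map Prod.snd)
        ((sparseRep G).map Prod.snd) ((sparseRep H).map Prod.snd))
      (fun M => do
        let Fq ← reduceSparse I M (sparseRep F)
        let Gq ← reduceSparse I M (sparseRep G)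
        let Hq ← reduceSparse I M (sparseRep H)
        let Pq ← reduceSparse I M (sparseRep P).reverse
        verifySparse I M Pq Fq Gq Hq) := rfl

theorem isSetup_dense (hI : IsMulCost I) (hadm : Admissible P F G H) (hε : 0 < ε) (hε1 : ε < 1)
    {S J : ℕ} (hS : S = (maxNorm P F G H).size) (hJ : J = opCost I (64 * bitLen ε P F G H)) :
    IsSetup I ε P F G H
      (chooseLambda I ⌈1 / ε⌉₊ (sparseRep P).reverse (denseRep P.natDegree F)
        (denseRep P.natDegree G) (denseRep P.natDegree H))
      (fun M => do
        let Fq ← reduceDense I M (denseRep P.natDegree F)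
        let Gq ← reduceDense I M (denseRep P.natDegree G)
        let Hq ← reduceDense I M (denseRep P.natDegree H)
        let Pq ← reduceSparse I M (sparseRep P).reverse
        verifyDense I M Pq Fq Gq Hq)
      ((P.natDegree + P.natDegree + P.natDegree + sparsity P) * (2 * S + 1 + J) + 4 * (S + 1) +
        (4 * P.natDegree.size + 24) * J)
      (fun q => 42 * (P.natDegree * ((S / q.size + 1) * J)) +
        16 * (sparsity P * ((S / q.size + 1) * J)) + 113 * (sparsity P * P.natDegree) * J) := by
  subst hS hJ
  obtain ⟨h1, h2, h3⟩ := parameters_le (F := F) (G := G) (H := H) hadm.2.1 hε hε1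
  obtain ⟨w1, w2, -⟩ := word_bounds one_le_bitLen h1 h2 h3
  obtain ⟨s1, s2, s3, s4⟩ := norm_size_le (P := P) (F := F) (G := G) (H := H)
  refine ⟨?_, fun q M hM => ?_⟩
  · have := sat_chooseLambda (budget_opCost hI (64 * bitLen ε P F G H)) hadm s1 s2 s3 s4
      (coefList_denseRep hadm.2.2.1) (coefList_denseRep hadm.2.2.2.1)
      (coefList_denseRep hadm.2.2.2.2) (length_denseRep _ _).le (length_denseRep _ _).le rfl w1
    simp only [length_denseRep] at this
    exact this
  · have := sat_reduceVerifyDense hM hadm (by nlinarith) s1 s2 s3 s4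
    exact ⟨this.1, this.2⟩

theorem isSetup_sparse (hI : IsMulCost I) (hadm : Admissible P F G H) (hε : 0 < ε) (hε1 : ε < 1)
    {S J e : ℕ} (hS : S = (maxNorm P F G H).size) (hJ : J = opCost I (64 * bitLen ε P F G H))
    (he : e = (P.natDegree - 1) / (P.natDegree - (P - X ^ P.natDegree).natDegree)) :
    IsSetup I ε P F G H
      (chooseLambda I ⌈1 / ε⌉₊ (sparseRep P).reverse ((sparseRep F).map Prod.snd)
        ((sparseRep G).map Prod.snd) ((sparseRep H).map Prod.snd))
      (fun M => do
        let Fq ← reduceSparse I M (sparseRep F)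
        let Gq ← reduceSparse I M (sparseRep G)
        let Hq ← reduceSparse I M (sparseRep H)
        let Pq ← reduceSparse I M (sparseRep P).reverse
        verifySparse I M Pq Fq Gq Hq)
      ((sparsity F + sparsity G + sparsity H + sparsity P) * (2 * S + 1 + J) + 4 * (S + 1) +
        (4 * P.natDegree.size + 24) * J)
      (fun q => 48 * ((maxSparsity F G H + sparsity P) * ((S / q.size + 1) * J)) +
        222 * (maxSparsity F G H * (2 * sparsity P ^ e) + sparsity P) *
          (P.natDegree.size * J) + 3 * e * J) := by
  subst hS hJ
  obtain ⟨h1, h2, h3⟩ := parameters_le (F := F) (G := G) (H := H) hadm.2.1 hε hε1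
  obtain ⟨w1, w2, -⟩ := word_bounds one_le_bitLen h1 h2 h3
  obtain ⟨s1, s2, s3, s4⟩ := norm_size_le (P := P) (F := F) (G := G) (H := H)
  have hlen : ∀ A : ℤ[X], ((sparseRep A).map Prod.snd).length = sparsity A := fun A => by
    rw [List.length_map, length_sparseRep]
  refine ⟨?_, fun q M hM => ?_⟩
  · have := sat_chooseLambda (budget_opCost hI (64 * bitLen ε P F G H)) hadm s1 s2 s3 s4
      (coefList_of_perm (List.Perm.refl (sparseRep F)))
      (coefList_of_perm (List.Perm.refl (sparseRep G)))
      (coefList_of_perm (List.Perm.refl (sparseRep H))) ((hlen F).trans_le (sparsity_le hadm.2.2.1))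
      ((hlen G).trans_le (sparsity_le hadm.2.2.2.1)) rfl w1
    simp only [hlen] at this
    exact this
  · have := sat_reduceVerifySparse hM hadm w2 s1 s2 s3 s4 he
    exact ⟨this.1, this.2⟩

/-- The constants are chosen to be common to the bounds for the prime and for the rest, and to dense
and sparse inputs. -/
theorem cost_runDense (hI : IsMulCost I) (hadm : Admissible P F G H) (hε : 0 < ε) (hε1 : ε < 1)
    {K : ℕ} (hK : ∀ l, 1 ≤ l → opCost I (64 * l) ≤ K * I l) {r : Run}
    (hr : r ∈ (runDense I ε P F G H).support) :
    (r.primeOps : ℝ) ≤ (94343 * 24 * K : ℕ) * primeBound I ε P F G H ∧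
      (r.otherOps : ℝ) ≤ (94343 * 24 * K : ℕ) * denseBound I ε P F G H := by
  rw [runDense_eq] at hr
  obtain ⟨hp, q, hq, hqW, hLq, ho⟩ := (isSetup_dense hI hadm hε hε1 rfl rfl).cost hI hadm hε hε1 hK hr
  refine ⟨hp, ?_⟩
  have hl := one_le_bitLen (ε := ε) (P := P) (F := F) (G := G) (H := H)
  have hL1 : 1 ≤ logSize ε P F G H := one_le_lg _
  have hD := blocks_le hL1 hq hLq
    (size_maxNorm_le (P := P) (F := F) (G := G) (H := H))
  have hJ := hK _ hl
  have hbound : denseBound I ε P F G H = ((sparsity P : ℝ) * P.natDegree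
    + P.natDegree * (lg (maxNorm P F G H) / logSize ε P F G H)) * I (bitLen ε P F G H) := rfl
  have hJW : 2 * (64 * bitLen ε P F G H) ≤ opCost I (64 * bitLen ε P F G H) := by
    rw [opCost]; omega
  have hSD := succ_le_blocks_mul (S := (maxNorm P F G H).size) hq hqW hJW
  have hn0 := hadm.2.1
  have hP1 : 1 ≤ sparsity P := Finset.card_pos.2 (nonempty_support_iff.2 hadm.1.ne_zero)
  have hPn : sparsity P ≤ P.natDegree + 1 := sparsity_le (degree_le_natDegree.trans_lt (by
    exact_mod_cast Nat.lt_succ_self _))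
  have hnsz := size_le_self P.natDegree
  rw [hbound]
  set l := bitLen ε P F G H
  set J := opCost I (64 * l)
  set S := (maxNorm P F G H).size
  set n := P.natDegree
  set p := sparsity P
  set D := S / q.size + 1
  set R := lg (maxNorm P F G H) / logSize ε P F G H
  have hnat : r.otherOps ≤ 88 * (n * (D * J)) + 141 * (p * n * J) := by
    refine ho.trans ?_
    have hDJ : D * J ≤ n * (D * J) := Nat.le_mul_of_pos_left _ hn0
    have hJD : J ≤ D * J := Nat.le_mul_of_pos_left _ (Nat.succ_pos _)
    have hnp : n * J ≤ p * n * J := Nat.mul_le_mul_right _ (Nat.le_mul_of_pos_left _ hP1)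
    have e1 : (n + n + n + p) * (2 * S + 1 + J) ≤ 10 * (n * (D * J)) := by
      calc _ ≤ (5 * n) * (2 * (D * J)) := Nat.mul_le_mul (by omega) (by omega)
        _ = _ := by ring
    have e2 : (4 * n.size + 24) * J ≤ 28 * (n * J) := by
      calc _ ≤ (28 * n) * J := Nat.mul_le_mul_right _ (by omega)
        _ = _ := by ring
    have e3 : p * (D * J) ≤ 2 * (n * (D * J)) := by
      calc _ ≤ (2 * n) * (D * J) := Nat.mul_le_mul_right _ (by omega)
        _ = _ := by ring
    have e4 : 113 * (p * n) * J = 113 * (p * n * J) := by ring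
    omega
  have hJ' : (J : ℝ) ≤ K * I l := by exact_mod_cast hJ
  have hR : 0 ≤ R := div_nonneg (zero_le_one.trans (one_le_lg _)) (by linarith)
  have hp' : (1 : ℝ) ≤ p := by exact_mod_cast hP1
  have hnn : (n : ℝ) ≤ p * n := le_mul_of_one_le_left (by positivity) hp'
  calc (r.otherOps : ℝ) ≤ 88 * (n * ((D : ℝ) * J)) + 141 * (p * n * J) := by exact_mod_cast hnat
    _ ≤ 88 * (n * ((4 * R + 1) * J)) + 141 * (p * n * J) := by gcongr
    _ = (352 * (n * R) + 88 * n + 141 * (p * n)) * J := by ring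
    _ ≤ (352 * (n * R) + 352 * (p * n)) * J := by
        refine mul_le_mul_of_nonneg_right ?_ (by positivity)
        nlinarith
    _ ≤ (352 * (n * R) + 352 * (p * n)) * (K * I l) := by gcongr
    _ = 352 * (K * ((p * n + n * R) * I l)) := by ring
    _ ≤ (94343 * 24) * (K * ((p * n + n * R) * I l)) :=
        mul_le_mul_of_nonneg_right (by norm_num) (by positivity)
    _ = _ := by push_cast; ring

/-- The terms `e` and `#P` of the costs are absorbed by `#P ^ e`; for `e = 0` this uses
that `P` has at most two terms. -/
theorem sparsity_pow_bounds (hadm : Admissible P F G H) {e : ℕ}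
    (he : e = (P.natDegree - 1) / (P.natDegree - (P - X ^ P.natDegree).natDegree)) :
    e ≤ sparsity P ^ e ∧ sparsity P ≤ 2 * sparsity P ^ e := by
  obtain ⟨hP, hn0, -⟩ := hadm
  have hcard : (P - X ^ P.natDegree).support.card + 1 = sparsity P := card_support_sub_X_pow hP
  rcases Nat.eq_zero_or_pos (P - X ^ P.natDegree).natDegree with h | h
  · have h1 := card_supp_le_succ_natDegree (P - X ^ P.natDegree)
    rw [h, Nat.sub_zero, Nat.div_eq_of_lt (by omega)] at he
    rw [he, pow_zero]
    omega
  · have h0 : P - X ^ P.natDegree ≠ 0 := fun h0 => by rw [h0] at h; simp at h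
    have h1 : 1 ≤ (P - X ^ P.natDegree).support.card :=
      Finset.card_pos.2 (nonempty_support_iff.2 h0)
    have hk := natDegree_sub_X_pow_lt hP hn0
    have he1 : 1 ≤ e := by
      rw [he]
      exact Nat.div_pos (by omega) (by omega)
    constructor
    · exact Nat.lt_two_pow_self.le.trans (Nat.pow_le_pow_left (by omega) e)
    · have := Nat.le_self_pow (show e ≠ 0 by omega) (sparsity P)
      omega

/-- The sparse evaluation contributes `T #P ^ e log n` operations modulo `q`, the reductions contribute
`T + #P` times the number of blocks of a coefficient. -/
theorem cost_runSparse (hI : IsMulCost I) (hadm : Admissible P F G H) (hε : 0 < ε) (hε1 : ε < 1)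
    (hT : 1 ≤ maxSparsity F G H) {K : ℕ} (hK : ∀ l, 1 ≤ l → opCost I (64 * l) ≤ K * I l) {r : Run}
    (hr : r ∈ (runSparse I ε P F G H).support) :
    (r.primeOps : ℝ) ≤ (94343 * 24 * K : ℕ) * primeBound I ε P F G H ∧
      (r.otherOps : ℝ) ≤ (94343 * 24 * K : ℕ) * sparseBound I ε P F G H := by
  obtain ⟨e, he⟩ : ∃ e, e = (P.natDegree - 1) / (P.natDegree - (P - X ^ P.natDegree).natDegree) :=
    ⟨_, rfl⟩
  rw [runSparse_eq] at hr
  obtain ⟨hp, q, hq, hqW, hLq, ho⟩ :=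
    (isSetup_sparse hI hadm hε hε1 rfl rfl he).cost hI hadm hε hε1 hK hr
  refine ⟨hp, ?_⟩
  have hl := one_le_bitLen (ε := ε) (P := P) (F := F) (G := G) (H := H)
  have hL1 : 1 ≤ logSize ε P F G H := one_le_lg _
  have hD := blocks_le hL1 hq hLq
    (size_maxNorm_le (P := P) (F := F) (G := G) (H := H))
  have hJ := hK _ hl
  have hbound : sparseBound I ε P F G H =
    ((maxSparsity F G H : ℝ) * (sparsity P : ℝ) ^ ⌈1 / gap P - 1⌉₊ * lg P.natDegree
      + ((maxSparsity F G H : ℝ) + sparsity P) * (lg (maxNorm P F G H) / logSize ε P F G H))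
    * I (bitLen ε P F G H) := rfl
  have hJW : 2 * (64 * bitLen ε P F G H) ≤ opCost I (64 * bitLen ε P F G H) := by
    rw [opCost]; omega
  have hSD := succ_le_blocks_mul (S := (maxNorm P F G H).size) hq hqW hJW
  have hP1 : 1 ≤ sparsity P := Finset.card_pos.2 (nonempty_support_iff.2 hadm.1.ne_zero)
  have hsz : 1 ≤ P.natDegree.size := Nat.size_pos.2 hadm.2.1
  have hszlg : (P.natDegree.size : ℝ) ≤ 2 * lg P.natDegree := by
    linarith [size_le_lg_add_one P.natDegree, one_le_lg (P.natDegree : ℝ)]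
  obtain ⟨he1, he2⟩ := sparsity_pow_bounds hadm he
  have hegap := div_le_ceil_invGap hadm
  rw [← he] at hegap
  have hF : sparsity F ≤ maxSparsity F G H := (le_max_left _ _).trans (le_max_left _ _)
  have hG : sparsity G ≤ maxSparsity F G H := (le_max_right _ _).trans (le_max_left _ _)
  have hH : sparsity H ≤ maxSparsity F G H := le_max_right _ _
  rw [hbound]
  set l := bitLen ε P F G H
  set J := opCost I (64 * l)
  set S := (maxNorm P F G H).size
  set d := P.natDegree.size
  set p := sparsity P
  set T := maxSparsity F G H
  set D := S / q.size + 1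
  set R := lg (maxNorm P F G H) / logSize ε P F G H
  set E := T * p ^ e with hE
  have hTE : T ≤ E := Nat.le_mul_of_pos_right _ (by positivity)
  have hpE : p ^ e ≤ E := Nat.le_mul_of_pos_left _ hT
  have hnat : r.otherOps ≤ 58 * ((T + p) * (D * J)) + 919 * (E * d * J) := by
    refine ho.trans ?_
    have hDJ : D * J ≤ (T + p) * (D * J) := Nat.le_mul_of_pos_left _ (by omega)
    have hJD : J ≤ D * J := Nat.le_mul_of_pos_left _ (Nat.succ_pos _)
    have e1 : (sparsity F + sparsity G + sparsity H + p) * (2 * S + 1 + J) ≤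
        6 * ((T + p) * (D * J)) := by
      calc _ ≤ (3 * (T + p)) * (2 * (D * J)) := Nat.mul_le_mul (by omega) (by omega)
        _ = _ := by ring
    have hE1 : 1 ≤ E := hT.trans hTE
    have hdJ : d * J ≤ E * d * J := by
      rw [mul_assoc]; exact Nat.le_mul_of_pos_left _ hE1
    have e2 : (4 * d + 24) * J ≤ 28 * (E * d * J) := by
      calc _ ≤ (28 * d) * J := Nat.mul_le_mul_right _ (by omega)
        _ = 28 * (d * J) := by ring
        _ ≤ _ := Nat.mul_le_mul_left _ hdJ
    have e3 : 222 * (T * (2 * p ^ e) + p) * (d * J) ≤ 888 * (E * d * J) := by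
      have : T * (2 * p ^ e) = 2 * E := by rw [hE]; ring
      calc _ ≤ 222 * (4 * E) * (d * J) :=
            Nat.mul_le_mul_right _ (Nat.mul_le_mul_left _ (by omega))
        _ = _ := by ring
    have e4 : 3 * e * J ≤ 3 * (E * d * J) := by
      calc 3 * e * J ≤ 3 * (E * d) * J := by
            refine Nat.mul_le_mul_right _ (Nat.mul_le_mul_left _ ?_)
            exact (he1.trans hpE).trans (Nat.le_mul_of_pos_right _ hsz)
        _ = _ := by ring
    omega
  have hJ' : (J : ℝ) ≤ K * I l := by exact_mod_cast hJ
  have hR : 0 ≤ R := div_nonneg (zero_le_one.trans (one_le_lg _)) (by linarith)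
  have hp' : (1 : ℝ) ≤ p := by exact_mod_cast hP1
  have hd' : (1 : ℝ) ≤ d := by exact_mod_cast hsz
  have hTpE : ((T : ℝ) + p) ≤ 3 * (E * d) := by
    have h1 : T + p ≤ 3 * (E * d) := by
      have : E ≤ E * d := Nat.le_mul_of_pos_right _ hsz
      omega
    exact_mod_cast h1
  have hEd : (E : ℝ) * d ≤ 2 * (T * (p : ℝ) ^ ⌈1 / gap P - 1⌉₊ * lg P.natDegree) := by
    rw [hE]
    push_cast
    have hlg := zero_le_one.trans (one_le_lg (P.natDegree : ℝ))
    calc (T : ℝ) * (p : ℝ) ^ e * d ≤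
          T * (p : ℝ) ^ ⌈1 / gap P - 1⌉₊ * (2 * lg P.natDegree) := by gcongr
      _ = _ := by ring
  have hQ : 0 ≤ T * (p : ℝ) ^ ⌈1 / gap P - 1⌉₊ * lg P.natDegree :=
    mul_nonneg (by positivity) (zero_le_one.trans (one_le_lg _))
  set Q := T * (p : ℝ) ^ ⌈1 / gap P - 1⌉₊ * lg P.natDegree
  calc (r.otherOps : ℝ) ≤ 58 * (((T : ℝ) + p) * ((D : ℝ) * J)) + 919 * (E * d * J) := by
        exact_mod_cast hnat
    _ ≤ 58 * (((T : ℝ) + p) * ((4 * R + 1) * J)) + 919 * (E * d * J) := by gcongr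
    _ = (232 * (((T : ℝ) + p) * R) + 58 * ((T : ℝ) + p) + 919 * (E * d)) * J := by ring
    _ ≤ (2186 * (((T : ℝ) + p) * R) + 2186 * Q) * J := by
        refine mul_le_mul_of_nonneg_right ?_ (by positivity)
        have : 0 ≤ ((T : ℝ) + p) * R := by positivity
        linarith
    _ ≤ (2186 * (((T : ℝ) + p) * R) + 2186 * Q) * (K * I l) := by gcongr
    _ = 2186 * (K * ((Q + ((T : ℝ) + p) * R) * I l)) := by ring
    _ ≤ (94343 * 24) * (K * ((Q + ((T : ℝ) + p) * R) * I l)) :=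
        mul_le_mul_of_nonneg_right (by norm_num) (by positivity)
    _ = _ := by push_cast; ring

end Algorithm

end ModVerif

theorem mainTheorem4 (I : ℕ → ℕ) (hI : ModVerif.IsMulCost I) :
    (∀ (P F G H : ℤ[X]) (ε : ℝ), ModVerif.Admissible P F G H → 0 < ε → ε < 1 →
      ModVerif.Correct ε P F G H (ModVerif.runDense I ε P F G H) ∧
      ModVerif.Correct ε P F G H (ModVerif.runSparse I ε P F G H)) ∧
    ∃ K : ℝ, ∀ (P F G H : ℤ[X]) (ε : ℝ), ModVerif.Admissible P F G H → 0 < ε → ε < 1 →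
      (∀ r ∈ (ModVerif.runDense I ε P F G H).support,
        (r.primeOps : ℝ) ≤ K * ModVerif.primeBound I ε P F G H ∧
        (r.otherOps : ℝ) ≤ K * ModVerif.denseBound I ε P F G H) ∧
      (1 ≤ ModVerif.maxSparsity F G H →
        ∀ r ∈ (ModVerif.runSparse I ε P F G H).support,
          (r.primeOps : ℝ) ≤ K * ModVerif.primeBound I ε P F G H ∧
          (r.otherOps : ℝ) ≤ K * ModVerif.sparseBound I ε P F G H) := by
  refine ⟨fun P F G H ε hadm hε hε1 => ⟨?_, ?_⟩, ?_⟩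
  · rw [ModVerif.runDense_eq]
    exact (ModVerif.isSetup_dense hI hadm hε hε1 rfl rfl).correct hI hadm hε hε1
  · rw [ModVerif.runSparse_eq]
    exact (ModVerif.isSetup_sparse hI hadm hε hε1 rfl rfl rfl).correct hI hadm hε hε1
  · obtain ⟨K, hK⟩ := ModVerif.exists_opCost_le hI
    exact ⟨(94343 * 24 * K : ℕ), fun P F G H ε hadm hε hε1 =>
      ⟨fun r hr => ModVerif.cost_runDense hI hadm hε hε1 hK hr,
        fun hT r hr => ModVerif.cost_runSparse hI hadm hε hε1 hT hK hr⟩⟩
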